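/- Let $L\ge 1$ be an integer and let $t,g,\omega,U$ be real numbers with $t\neq 0$, $g\neq 0$, $\omega\neq 0$ ($U$ is arbitrary). On the periodic chain with sites $i\in\mathbb Z/L\mathbb Z$ let $\hat c^\dagger_{i,\sigma},\hat c_{i,\sigma}$ ($\sigma\in\{\uparrow,\downarrow\}$) be the fermionic, and $\hat b^\dagger_i,\hat b_i$ the bosonic creation and annihilation operators, acting on the space of finite-particle vectors of Fock space (electrons and phonons commute). Put $\hat n_{i,\sigma}=\hat c^\dagger_{i,\sigma}\hat c_{i,\sigma}$ and consider the Holstein--Hubbard Hamiltonian $$\hat H=t\sum_{i}\sum_\sigma(\hat c^\dagger_{i,\sigma}\hat c_{i+1,\sigma}+\hat c^\dagger_{i+1,\sigma}\hat c_{i,\sigma})+g\sum_{i}\sum_\sigma\hat n_{i,\sigma}(\hat b^\dagger_i+\hat b_i)+\omega\sum_{i}\hat b^\dagger_i\hat b_i+U\sum_{i}\sum_{\sigma\ne\sigma'}\hat n_{i,\sigma}\hat n_{i,\sigma'}$$ and the spin bilinears $\hat N_{(\sigma,\sigma')}=\sum_{i}\hat c^\dagger_{i,\sigma}\hat c_{i,\sigma'}$.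 For an integer $k\ge 0$, a $k$-support operator is a polynomial with complex coefficients in the creation and annihilation operators at the sites $i,i+1,\dots,i+k-1$, for some $i$ (for $k=0$: a multiple of the identity $I$). For $k\ge 1$, a $k$-local quantity is a finite sum of $k$-support operators that is not a finite sum of $(k-1)$-support operators; it is a $k$-local conserved quantity if it commutes with $\hat H$. Then every $k$-local conserved quantity with $1\le k\le L/2$ is a complex linear combination of $I$, $\hat H$ and the four operators $\hat N_{(\sigma,\sigma')}$. Conversely, every such linear combination commutes with $\hat H$. More precisely, for $1\le k\le L/2$, an operator $\hat Q$ is a $k$-local conserved quantity if and only if - $k=1$ and $\hat Q$ is a linear combination of $I$ and the $\hat N_{(\sigma,\sigma')}$ that is not a multiple of $I$; or - $k=2$ and $\hat Q$ is a linear combination of $I$, $\hat H$ and the $\hat N_{(\sigma,\sigma')}$ that is not a linear combination of $I$ and the $\hat N_{(\sigma,\sigma')}$. In particular, there is no $k$-local conserved quantity with $3\le k\le L/2$. -/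

import Mathlib

open scoped TensorProduct

noncomputable section

namespace HolsteinHubbard

/-- Sites of the periodic chain of length `L`; `i + 1` is the right neighbour of `i`. -/
abbrev Site (L : ℕ) : Type := ZMod L

/-- The two spin states: `0` is spin up, `1` is spin down. -/
abbrev Spin : Type := Fin 2

/-- Fermionic Fock space: the exterior algebra over the one-particle space with one basis vector
for every pair (site, spin). -/
abbrev FermionFock (L : ℕ) : Type := ExteriorAlgebra ℂ (Site L × Spin → ℂ)

/-- Phonon Fock space (finite-particle vectors) in the Bargmann representation: the monomial
`∏ X i ^ m i` is, up to normalization by `√(∏ (m i)!)`, the state with `m i` phonons at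
site `i`. -/
abbrev PhononFock (L : ℕ) : Type := MvPolynomial (Site L) ℂ

/-- The (algebraic) Fock space of the electron-phonon chain. -/
abbrev FockSpace (L : ℕ) : Type := FermionFock L ⊗[ℂ] PhononFock L

/-- Linear operators on the finite-particle Fock space. -/
abbrev Op (L : ℕ) : Type := Module.End ℂ (FockSpace L)

variable {L : ℕ}

/-- Electron creation operator: exterior multiplication by the basis vector of `(i, σ)`. -/
def cDag (i : Site L) (σ : Spin) : Op L :=
  LinearMap.rTensor (PhononFock L)
    (LinearMap.mulLeft ℂ (ExteriorAlgebra.ι ℂ (Pi.single (i, σ) (1 : ℂ)) : FermionFock L))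

/-- Electron annihilation operator: contraction with the coordinate functional of `(i, σ)`. -/
def c (i : Site L) (σ : Spin) : Op L :=
  LinearMap.rTensor (PhononFock L)
    (CliffordAlgebra.contractLeft
      (LinearMap.proj (i, σ) : (Site L × Spin → ℂ) →ₗ[ℂ] ℂ) : FermionFock L →ₗ[ℂ] FermionFock L)

/-- Phonon creation operator: multiplication by the variable `X i`. -/
def bDag (i : Site L) : Op L :=
  LinearMap.lTensor (FermionFock L)
    (LinearMap.mulLeft ℂ (MvPolynomial.X i : PhononFock L))

/-- Phonon annihilation operator: the partial derivative with respect to `X i`. -/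
def b (i : Site L) : Op L :=
  LinearMap.lTensor (FermionFock L)
    ((MvPolynomial.pderiv i : Derivation ℂ (PhononFock L) (PhononFock L)) :
      PhononFock L →ₗ[ℂ] PhononFock L)

/-- Fermion-number operator of spin `σ` at site `i`. -/
def num (i : Site L) (σ : Spin) : Op L := cDag i σ * c i σ

/-- Hopping, including the hermitian conjugate. -/
def hHop (L : ℕ) [NeZero L] (t : ℝ) : Op L :=
  (t : ℂ) • ∑ i : Site L, ∑ σ : Spin,
    (cDag i σ * c (i + 1) σ + cDag (i + 1) σ * c i σ)

/-- Electron-phonon interaction. -/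
def hInt (L : ℕ) [NeZero L] (g : ℝ) : Op L :=
  (g : ℂ) • ∑ i : Site L, ∑ σ : Spin, num i σ * (bDag i + b i)

/-- Phonon energy. -/
def hPho (L : ℕ) [NeZero L] (ω : ℝ) : Op L :=
  (ω : ℂ) • ∑ i : Site L, bDag i * b i

/-- On-site Coulomb interaction; the sum runs over ordered pairs of distinct spins. -/
def hCoul (L : ℕ) [NeZero L] (U : ℝ) : Op L :=
  (U : ℂ) • ∑ i : Site L, ∑ σ : Spin, ∑ σ' ∈ Finset.univ.erase σ, num i σ * num i σ'

/-- The Holstein-Hubbard Hamiltonian on the periodic chain of `L` sites. -/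
def hamiltonian (L : ℕ) [NeZero L] (t g ω U : ℝ) : Op L :=
  hHop L t + hInt L g + hPho L ω + hCoul L U

/-- The spin bilinear `N_(σ,σ') = ∑ i, c†_{i,σ} c_{i,σ'}`. -/
def spinBilinear (L : ℕ) [NeZero L] (σ σ' : Spin) : Op L :=
  ∑ i : Site L, cDag i σ * c i σ'

/-- The algebra of operators supported on the set of sites `S`: polynomials (with complex
coefficients) in the creation and annihilation operators at the sites of `S`. -/
def localAlgebra (S : Set (Site L)) : Subalgebra ℂ (Op L) :=
  Algebra.adjoin ℂ
    {A : Op L | ∃ i ∈ S, A = bDag i ∨ A = b i ∨ ∃ σ : Spin, A = cDag i σ ∨ A = c i σ}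

/-- The `k` consecutive sites `i, i + 1, …, i + k - 1` of the periodic chain. -/
def window (i : Site L) (k : ℕ) : Set (Site L) :=
  {j | ∃ m : ℕ, m < k ∧ j = i + (m : Site L)}

/-- `A` is a `k`-support operator: its support is contained in `k` consecutive sites. -/
def IsSupportOp (k : ℕ) (A : Op L) : Prop :=
  ∃ i : Site L, A ∈ localAlgebra (window i k)

/-- The space of (finite) sums of `k`-support operators. -/
def supportSums (L k : ℕ) : Submodule ℂ (Op L) :=
  Submodule.span ℂ {A : Op L | IsSupportOp k A}

/-- `Q` is a `k`-local quantity (`k ≥ 1`): a sum of `k`-support operators that is not a sum of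
`(k - 1)`-support operators. -/
def IsLocalQuantity (k : ℕ) (Q : Op L) : Prop :=
  1 ≤ k ∧ Q ∈ supportSums L k ∧ Q ∉ supportSums L (k - 1)

/-- `Q` is a `k`-local conserved quantity of the Hamiltonian `H`. -/
def IsLocalConserved (H : Op L) (k : ℕ) (Q : Op L) : Prop :=
  IsLocalQuantity k Q ∧ Commute Q H

/-- Linear combinations of the identity and the spin bilinears. -/
def bilinearSpan (L : ℕ) [NeZero L] : Submodule ℂ (Op L) :=
  Submodule.span ℂ ({1} ∪ {A | ∃ σ σ' : Spin, A = spinBilinear L σ σ'})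

/-- Linear combinations of the identity, the Hamiltonian and the spin bilinears. -/
def trivialSpan (L : ℕ) [NeZero L] (t g ω U : ℝ) : Submodule ℂ (Op L) :=
  Submodule.span ℂ
    ({1, hamiltonian L t g ω U} ∪ {A | ∃ σ σ' : Spin, A = spinBilinear L σ σ'})

end HolsteinHubbard

end

noncomputable section

namespace HolsteinHubbard

open Matrix

/-! ### The canonical anticommutation relations -/

/-! The exterior algebra of the modes is finite-dimensional, so an operator becomes a matrix over
electron configurations with entries in the phonon Weyl algebra. Every local operator is the normal
ordering of a unique symbol: a matrix of polynomials in `X i` (for creation) and `λ i` (for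
annihilation). Commuting with the Hamiltonian becomes the equation `SymEq` on symbols. There the
coupling `g` raises the degree by one, through a linear form built from the change of occupation, or
lowers it through derivatives. All other terms preserve the degree.

The equation is read from the top degree `d > 0` downwards. The top part must preserve all
occupations and have weight zero, i.e. equal degrees in the `X` and in the `λ`. Its commutator with
the hopping also has weight zero, yet it is divisible by a form `∑ δ_i (X i + λ i)`; hence it
vanishes (`eq_zero_of_wt_of_dvd`, `SymEq.top_lie_hop`). The coefficient matrices of the top part
therefore commute with every hopping bilinear `E i j`. Since they multiply phonon operators at some
site `a`, locality makes them commute with the creation operators at the site half a ring away, so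
they are scalars (`SymEq.top_apply`).

The top part is thus one polynomial `p`. The next lower part is then fixed at charge-preserving
entries as a combination of derivatives of `p`. Looking at a hop between neighbours gives the
rotation identity `RotInv` (`SymEq.rotInv_top`). Together with locality it leaves only `p = r ∑ X i
λ i` (`eq_smul_sum_of_rotInv`), so the degree is at most two.

Subtracting a multiple of the Hamiltonian leaves an electron matrix `Y` that commutes with all `E i
j`. Locality kills one double graded commutator of `Y` with creation operators at distinct sites;
invariance carries this to all pairs of modes. So `Y` is a one-body operator up to a constant, and
its invariance gives a combination of `I` and the spin bilinears (`mem_span_of_commute`). -/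

/-- A matrix representation of the canonical anticommutation relations with modes `I` in which
every basis vector is obtained from a vacuum by applying creation operators. -/
structure FermionRep (I Cfg : Type*) [DecidableEq I] [Fintype Cfg] [DecidableEq Cfg] where
  /-- creation operators -/
  cr : I → Matrix Cfg Cfg ℂ
  /-- annihilation operators -/
  an : I → Matrix Cfg Cfg ℂ
  /-- fermion parity -/
  par : Matrix Cfg Cfg ℂ
  /-- vacuum vector -/
  vac : Cfg → ℂ
  /-- the occupied modes of a basis vector -/
  modes : Cfg → List I
  cr_cr : ∀ a b, cr a * cr b + cr b * cr a = 0
  an_an : ∀ a b, an a * an b + an b * an a = 0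
  an_cr : ∀ a b, an a * cr b + cr b * an a = if a = b then 1 else 0
  par_par : par * par = 1
  par_cr : ∀ a, par * cr a + cr a * par = 0
  par_an : ∀ a, par * an a + an a * par = 0
  an_vac : ∀ a, an a *ᵥ vac = 0
  par_vac : par *ᵥ vac = vac
  vac_ne_zero : vac ≠ 0
  basis : ∀ S, Pi.single S 1 = (modes S).foldr (fun a v => cr a *ᵥ v) vac

namespace FermionRep

section Modes

variable {I Cfg : Type*} [DecidableEq I] [Fintype Cfg] [DecidableEq Cfg] (R : FermionRep I Cfg)

/-- The vector obtained by applying the creation operators of a list of modes to the vacuum. -/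
def word (l : List I) : Cfg → ℂ := l.foldr (fun a v => R.cr a *ᵥ v) R.vac

@[simp] lemma word_nil : R.word [] = R.vac := rfl

lemma word_cons (a : I) (l : List I) : R.word (a :: l) = R.cr a *ᵥ R.word l := rfl

/-- The bilinear `c†_a c_b`. -/
def bil (a b : I) : Matrix Cfg Cfg ℂ := R.cr a * R.an b

lemma lie_bil_cr (a b d : I) : ⁅R.bil a b, R.cr d⁆ = if b = d then R.cr a else 0 := by
  have h1 := R.cr_cr a d
  have h2 := R.an_cr b d
  rw [Ring.lie_def, bil]
  have : R.cr a * R.an b * R.cr d - R.cr d * (R.cr a * R.an b) =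
      R.cr a * (R.an b * R.cr d + R.cr d * R.an b)
        - (R.cr a * R.cr d + R.cr d * R.cr a) * R.an b := by noncomm_ring
  rw [this, h1, h2]
  split_ifs <;> simp

lemma lie_bil_an (a b d : I) : ⁅R.bil a b, R.an d⁆ = - if d = a then R.an b else 0 := by
  have h1 := R.an_an b d
  have h2 := R.an_cr d a
  rw [Ring.lie_def, bil]
  have : R.cr a * R.an b * R.an d - R.an d * (R.cr a * R.an b) =
      R.cr a * (R.an b * R.an d + R.an d * R.an b)
        - (R.an d * R.cr a + R.cr a * R.an d) * R.an b := by noncomm_ring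
  rw [this, h1, h2]
  split_ifs <;> simp

lemma lie_bil_bil (a b d e : I) : ⁅R.bil a b, R.bil d e⁆ =
    (if b = d then R.bil a e else 0) - if e = a then R.bil d b else 0 := by
  have h1 := R.lie_bil_cr a b d
  have h2 := R.lie_bil_an a b e
  rw [bil, ← bil] at *
  have : ⁅R.bil a b, R.bil d e⁆ = ⁅R.bil a b, R.cr d⁆ * R.an e + R.cr d * ⁅R.bil a b, R.an e⁆ := by
    simp only [Ring.lie_def, bil]; noncomm_ring
  rw [this, h1, h2]
  split_ifs <;> simp [bil, sub_eq_add_neg]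

lemma bil_self_mul_self (a : I) : R.bil a a * R.bil a a = R.bil a a := by
  have h : R.an a * R.an a = 0 := by
    have := R.an_an a a
    rw [← two_smul ℂ] at this
    exact (smul_eq_zero.mp this).resolve_left two_ne_zero
  have h2 := R.an_cr a a
  rw [if_pos rfl] at h2
  have : R.bil a a * R.bil a a = R.cr a * (R.an a * R.cr a + R.cr a * R.an a) * R.an a
      - R.cr a * R.cr a * (R.an a * R.an a) := by
    simp only [bil]; noncomm_ring
  rw [this, h, h2]
  simp [bil]

/-- No distinctness of the modes is needed: a list with a repeated mode gives the zero vector, for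
which any eigenvalue is correct. -/
lemma bil_self_word (a : I) (l : List I) :
    R.bil a a *ᵥ R.word l = (l.count a : ℂ) • R.word l := by
  induction l with
  | nil => simp [bil, ← mulVec_mulVec, R.an_vac]
  | cons b l ih =>
    have h := R.lie_bil_cr a a b
    rw [Ring.lie_def, sub_eq_iff_eq_add'] at h
    rw [word_cons, mulVec_mulVec, h, add_mulVec, ← mulVec_mulVec, ih, mulVec_smul, List.count_cons]
    by_cases h : a = b
    · subst h; simp [add_smul]
    · simp [h, Ne.symm h]

lemma par_word (l : List I) : R.par *ᵥ R.word l = (-1 : ℂ) ^ l.length • R.word l := by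
  induction l with
  | nil => simp [R.par_vac]
  | cons b l ih =>
    have h := eq_neg_of_add_eq_zero_left (R.par_cr b)
    rw [word_cons, mulVec_mulVec, h, neg_mulVec, ← mulVec_mulVec, ih, mulVec_smul,
      List.length_cons, pow_succ]
    simp

lemma ext_word {X Y : Matrix Cfg Cfg ℂ} (h : ∀ l, X *ᵥ R.word l = Y *ᵥ R.word l) : X = Y := by
  ext i S
  have := congrFun (h (R.modes S)) i
  rw [word, ← R.basis] at this
  simpa using this

lemma eq_diagonal {X : Matrix Cfg Cfg ℂ} {f : List I → ℂ}
    (h : ∀ l, X *ᵥ R.word l = f l • R.word l) : X = diagonal fun S => f (R.modes S) := by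
  ext i S
  have := congrFun (h (R.modes S)) i
  rw [word, ← R.basis] at this
  rw [diagonal_apply]
  simp only [mulVec_single_one, col_apply, Pi.smul_apply, Pi.single_apply, smul_eq_mul] at this
  rw [this]
  split_ifs with h1 <;> simp [h1]

end Modes

end FermionRep

end HolsteinHubbard

namespace HolsteinHubbard

open Matrix

/-! ### The matrix form of operators on Fock space -/

section Exterior

variable {I : Type*} [DecidableEq I]

/-- Creation operator of the mode `a` on the exterior algebra. -/
def extCr (a : I) : Module.End ℂ (ExteriorAlgebra ℂ (I → ℂ)) :=
  LinearMap.mulLeft ℂ (ExteriorAlgebra.ι ℂ (Pi.single a (1 : ℂ)))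

/-- Annihilation operator of the mode `a` on the exterior algebra. -/
def extAn (a : I) : Module.End ℂ (ExteriorAlgebra ℂ (I → ℂ)) :=
  CliffordAlgebra.contractLeft (LinearMap.proj a : (I → ℂ) →ₗ[ℂ] ℂ)

/-- The parity automorphism of the exterior algebra. -/
def extPar (I : Type*) : Module.End ℂ (ExteriorAlgebra ℂ (I → ℂ)) :=
  (CliffordAlgebra.involute (Q := (0 : QuadraticForm ℂ (I → ℂ)))).toLinearMap

lemma extCr_add (a b : I) : extCr a * extCr b + extCr b * extCr a = 0 := by
  refine LinearMap.ext fun x => ?_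
  change ExteriorAlgebra.ι ℂ (Pi.single a (1 : ℂ)) * (ExteriorAlgebra.ι ℂ (Pi.single b (1 : ℂ)) * x)
    + ExteriorAlgebra.ι ℂ (Pi.single b (1 : ℂ)) * (ExteriorAlgebra.ι ℂ (Pi.single a (1 : ℂ)) * x)
    = 0
  rw [← mul_assoc, ← mul_assoc, ← add_mul, ExteriorAlgebra.ι_add_mul_swap, zero_mul]

omit [DecidableEq I] in
lemma extAn_add (a b : I) : extAn a * extAn b + extAn b * extAn a = 0 := by
  refine LinearMap.ext fun x => ?_
  have := CliffordAlgebra.contractLeft_comm (Q := (0 : QuadraticForm ℂ (I → ℂ)))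
    (LinearMap.proj a) (LinearMap.proj b) x
  exact eq_neg_iff_add_eq_zero.mp this

omit [DecidableEq I] in
lemma extAn_apply_mul (a : I) (m : I → ℂ) (y : CliffordAlgebra (0 : QuadraticForm ℂ (I → ℂ))) :
    extAn a (CliffordAlgebra.ι _ m * y) = m a • y - CliffordAlgebra.ι _ m * extAn a y :=
  CliffordAlgebra.contractLeft_ι_mul _ _ _

lemma extAn_extCr (a b : I) :
    extAn a * extCr b + extCr b * extAn a = if a = b then 1 else 0 := by
  refine LinearMap.ext fun x => ?_
  have := extAn_apply_mul a (Pi.single b 1) x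
  refine (congrArg (· + extCr b (extAn a x)) this).trans ?_
  refine (sub_add_cancel _ _).trans ?_
  simp only [Pi.single_apply]
  split_ifs
  · exact one_smul _ _
  · exact zero_smul _ _

omit [DecidableEq I] in
lemma extPar_extPar : extPar I * extPar I = 1 := by
  refine LinearMap.ext fun x => ?_
  exact CliffordAlgebra.involute_involute (Q := (0 : QuadraticForm ℂ (I → ℂ))) x

lemma extPar_extCr (a : I) : extPar I * extCr a + extCr a * extPar I = 0 := by
  refine LinearMap.ext fun x => ?_
  refine eq_neg_iff_add_eq_zero.mp ?_
  change CliffordAlgebra.involute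
      (CliffordAlgebra.ι (0 : QuadraticForm ℂ (I → ℂ)) (Pi.single a 1) * x) =
    -(CliffordAlgebra.ι (0 : QuadraticForm ℂ (I → ℂ)) (Pi.single a 1) * CliffordAlgebra.involute x)
  rw [map_mul, CliffordAlgebra.involute_ι, neg_mul]

omit [DecidableEq I] in
lemma extPar_extAn (a : I) : extPar I * extAn a + extAn a * extPar I = 0 := by
  refine LinearMap.ext fun x => ?_
  refine eq_neg_iff_add_eq_zero.mp ?_
  change CliffordAlgebra.involute (Q := (0 : QuadraticForm ℂ (I → ℂ))) (extAn a x) =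
    -(extAn a (CliffordAlgebra.involute (Q := (0 : QuadraticForm ℂ (I → ℂ))) x))
  induction x using CliffordAlgebra.left_induction with
  | algebraMap r =>
    have : extAn a (algebraMap ℂ (CliffordAlgebra (0 : QuadraticForm ℂ (I → ℂ))) r) = 0 :=
      CliffordAlgebra.contractLeft_algebraMap _ _ _
    rw [AlgHom.commutes, this, map_zero, neg_zero]
  | add x y hx hy =>
    refine (congrArg (CliffordAlgebra.involute (Q := (0 : QuadraticForm ℂ (I → ℂ))))
      (LinearMap.map_add (extAn a) x y)).trans ?_
    refine (map_add _ _ _).trans ?_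
    rw [hx, hy, map_add]
    refine (neg_add _ _).symm.trans (congrArg Neg.neg ?_)
    exact (LinearMap.map_add (extAn a) _ _).symm
  | ι_mul x m hx =>
    rw [map_mul (CliffordAlgebra.involute (Q := (0 : QuadraticForm ℂ (I → ℂ)))),
      CliffordAlgebra.involute_ι, neg_mul]
    refine (congrArg (CliffordAlgebra.involute (Q := (0 : QuadraticForm ℂ (I → ℂ))))
      (extAn_apply_mul a m x)).trans ?_
    have h : extAn a (-(CliffordAlgebra.ι (0 : QuadraticForm ℂ (I → ℂ)) m *
        CliffordAlgebra.involute x)) = -(m a • CliffordAlgebra.involute x -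
        CliffordAlgebra.ι (0 : QuadraticForm ℂ (I → ℂ)) m *
          extAn a (CliffordAlgebra.involute x)) := by
      refine (LinearMap.map_neg (extAn a) _).trans ?_
      exact congrArg Neg.neg (extAn_apply_mul a m _)
    refine Eq.trans ?_ (congrArg Neg.neg h).symm
    refine (map_sub _ _ _).trans ?_
    rw [map_smul, map_mul, CliffordAlgebra.involute_ι, hx]
    refine Eq.trans ?_ (neg_neg _).symm
    congr 1
    exact neg_mul_neg _ _

lemma exists_basis_extCr (I : Type*) [DecidableEq I] [Fintype I] :
    ∃ (e : Module.Basis (Finset I) ℂ (ExteriorAlgebra ℂ (I → ℂ))) (l : Finset I → List I),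
      ∀ S, e S = (l S).foldr (fun a v => extCr a v) 1 := by
  classical
  -- An arbitrary order on the modes fixes the order of the factors in the basis wedge products.
  let _ : LinearOrder I := LinearOrder.lift' (Fintype.equivFin I) (Fintype.equivFin I).injective
  refine ⟨(Pi.basisFun ℂ I).ExteriorAlgebra,
    fun S => List.ofFn (Set.powersetCard.ofFinEmbEquiv.symm (Set.powersetCard.prodEquiv.symm S).2),
    fun S => ?_⟩
  have h : ∀ l : List I, l.foldr (fun a v => extCr a v) 1 =
      (l.map fun a => ExteriorAlgebra.ι ℂ (Pi.single a (1 : ℂ))).prod := by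
    intro l
    induction l with
    | nil => rfl
    | cons a l ih => rw [List.foldr_cons, ih]; rfl
  rw [ExteriorAlgebra.basis_apply, h, List.map_ofFn]
  refine (ExteriorAlgebra.ιMulti_apply (R := ℂ) _).trans ?_
  congr 2
  funext i
  simp only [Function.comp_apply, Pi.basisFun_apply]
  congr!

end Exterior

/-- A basis of the exterior algebra splits Fock space into finitely many copies of the phonon space.
Electron operators act on the index only and become matrices of numbers; phonon operators act alike
on every copy and become constant diagonal matrices. -/
lemma exists_matrix_form (L : ℕ) [NeZero L] :
    ∃ (R : FermionRep (Site L × Spin) (Finset (Site L × Spin)))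
      (ent : Op L →ₐ[ℂ] Matrix (Finset (Site L × Spin)) (Finset (Site L × Spin))
        (Module.End ℂ (PhononFock L))),
      Function.Injective ent ∧
      (∀ i σ, ent (cDag i σ) = (R.cr (i, σ)).map (algebraMap ℂ _)) ∧
      (∀ i σ, ent (c i σ) = (R.an (i, σ)).map (algebraMap ℂ _)) ∧
      (∀ i, ent (bDag i) = diagonal fun _ =>
        LinearMap.mulLeft ℂ (MvPolynomial.X i : PhononFock L)) ∧
      (∀ i, ent (b i) = diagonal fun _ =>
        ((MvPolynomial.pderiv i : Derivation ℂ (PhononFock L) (PhononFock L)) :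
          PhononFock L →ₗ[ℂ] PhononFock L)) := by
  classical
  obtain ⟨e, l, hl⟩ := exists_basis_extCr (Site L × Spin)
  let M : Module.End ℂ (FermionFock L) ≃ₐ[ℂ] _ := LinearMap.toMatrixAlgEquiv e
  have hM : ∀ f x, M f *ᵥ (e.equivFun x) = e.equivFun (f x) := fun f x =>
    LinearMap.toMatrix_mulVec_repr e e f x
  let R : FermionRep (Site L × Spin) (Finset (Site L × Spin)) :=
    { cr := fun a => M (extCr a)
      an := fun a => M (extAn a)
      par := M (extPar _)
      vac := e.equivFun 1
      modes := l
      cr_cr := fun a b => by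
        rw [← map_mul, ← map_mul, ← map_add]; exact (congrArg M (extCr_add a b)).trans (map_zero M)
      an_an := fun a b => by
        rw [← map_mul, ← map_mul, ← map_add]; exact (congrArg M (extAn_add a b)).trans (map_zero M)
      an_cr := fun a b => by
        rw [← map_mul, ← map_mul, ← map_add]
        refine (congrArg M (extAn_extCr a b)).trans ?_
        split_ifs
        · exact map_one M
        · exact map_zero M
      par_par := by
        rw [← map_mul]; exact (congrArg M extPar_extPar).trans (map_one M)
      par_cr := fun a => by
        rw [← map_mul, ← map_mul, ← map_add]; exact (congrArg M (extPar_extCr a)).trans (map_zero M)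
      par_an := fun a => by
        rw [← map_mul, ← map_mul, ← map_add]; exact (congrArg M (extPar_extAn a)).trans (map_zero M)
      an_vac := fun a => by
        rw [hM]
        refine (congrArg e.equivFun (?_ : extAn a 1 = 0)).trans (map_zero _)
        exact CliffordAlgebra.contractLeft_one _ _
      par_vac := by
        rw [hM]
        exact congrArg e.equivFun
          (map_one (CliffordAlgebra.involute (Q := (0 : QuadraticForm ℂ (Site L × Spin → ℂ)))))
      vac_ne_zero := fun h => one_ne_zero (e.equivFun.map_eq_zero_iff.mp h)
      basis := fun S => by
        have h : ∀ l : List (Site L × Spin),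
            l.foldr (fun a v => M (extCr a) *ᵥ v) (e.equivFun 1) =
            e.equivFun (l.foldr (fun a v => extCr a v) 1) := by
          intro l
          induction l with
          | nil => rfl
          | cons a l ih => rw [List.foldr_cons, ih, hM, List.foldr_cons]
        rw [h, ← hl]
        ext S'
        rw [e.equivFun_self, Pi.single_apply]
        simp only [eq_comm] }
  let φ : FockSpace L ≃ₗ[ℂ] (Finset (Site L × Spin) → PhononFock L) :=
    (TensorProduct.equivFinsuppOfBasisLeft e).trans (Finsupp.linearEquivFunOnFinite ℂ _ _)
  have hφ : ∀ x p S, φ (x ⊗ₜ p) S = e.repr x S • p := fun x p S => by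
    simp [φ, TensorProduct.equivFinsuppOfBasisLeft_apply_tmul]
  have hφs : ∀ S p, φ.symm (Pi.single S p) = e S ⊗ₜ p := fun S p => by
    rw [LinearEquiv.symm_apply_eq]
    ext S' : 1
    rw [hφ, e.repr_self, Finsupp.single_apply, Pi.single_apply]
    simp only [eq_comm (a := S)]
    split_ifs <;> simp
  let ent : Op L ≃ₐ[ℂ] Matrix (Finset (Site L × Spin)) (Finset (Site L × Spin))
      (Module.End ℂ (PhononFock L)) :=
    (φ.conjAlgEquiv ℂ).trans (endVecAlgEquivMatrixEnd _ ℂ _ _)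
  have hent : ∀ Q S S' p, ent Q S S' p = φ (Q (e S' ⊗ₜ p)) S := fun Q S S' p => by
    rw [← hφs]; rfl
  have hF : ∀ (f : Module.End ℂ (FermionFock L)) (S S' : Finset (Site L × Spin))
      (p : PhononFock L), e.repr (f (e S')) S • p =
        (algebraMap ℂ (Module.End ℂ (PhononFock L)) (M f S S')) p := fun f S S' p => by
    rw [Module.algebraMap_end_apply]
    exact congrArg (· • p) (LinearMap.toMatrixAlgEquiv_apply e f S S').symm
  have hP : ∀ (f : Module.End ℂ (PhononFock L)) (S S' : Finset (Site L × Spin))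
      (p : PhononFock L), e.repr (e S') S • f p =
        (diagonal (fun _ => f) : Matrix (Finset (Site L × Spin)) (Finset (Site L × Spin)) _)
          S S' p := fun f S S' p => by
    rw [e.repr_self, Finsupp.single_apply, diagonal_apply]
    simp only [eq_comm (a := S)]
    split_ifs <;> simp
  refine ⟨R, ent.toAlgHom, ent.injective, fun i σ => ?_, fun i σ => ?_, fun i => ?_, fun i => ?_⟩
    <;> ext1 S S' <;> refine LinearMap.ext fun p => (hent _ _ _ _).trans ?_
  · exact (hφ (extCr (i, σ) (e S')) p S).trans (hF _ _ _ _)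
  · exact (hφ (extAn (i, σ) (e S')) p S).trans (hF _ _ _ _)
  · exact (hφ (e S') _ S).trans (hP _ _ _ _)
  · exact (hφ (e S') _ S).trans (hP _ _ _ _)

end HolsteinHubbard

namespace HolsteinHubbard

open Matrix

lemma ring_sum_lie {A ι : Type*} [Ring A] (s : Finset ι) (f : ι → A) (y : A) :
    ⁅∑ i ∈ s, f i, y⁆ = ∑ i ∈ s, ⁅f i, y⁆ := by
  simp only [Ring.lie_def, Finset.sum_mul, Finset.mul_sum, Finset.sum_sub_distrib]

lemma ring_lie_sum {A ι : Type*} [Ring A] (s : Finset ι) (f : ι → A) (y : A) :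
    ⁅y, ∑ i ∈ s, f i⁆ = ∑ i ∈ s, ⁅y, f i⁆ := by
  simp only [Ring.lie_def, Finset.sum_mul, Finset.mul_sum, Finset.sum_sub_distrib]

lemma ring_lie_add {A : Type*} [Ring A] (x y z : A) : ⁅x, y + z⁆ = ⁅x, y⁆ + ⁅x, z⁆ := by
  simp only [Ring.lie_def]; noncomm_ring

lemma ring_lie_smul {A : Type*} [Ring A] [Algebra ℂ A] (r : ℂ) (x y : A) :
    ⁅x, r • y⁆ = r • ⁅x, y⁆ := by
  simp only [Ring.lie_def, mul_smul_comm, smul_mul_assoc, smul_sub]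

namespace FermionRep

/-! ### Electrons with spin on a ring -/

section Sites

variable {L : ℕ} {Cfg : Type*} [Fintype Cfg] [DecidableEq Cfg]
  (R : FermionRep (Site L × Spin) Cfg)

/-- The hopping bilinear `∑ σ, c†_{i,σ} c_{j,σ}`. -/
def E (i j : Site L) : Matrix Cfg Cfg ℂ := ∑ σ : Spin, R.bil (i, σ) (j, σ)

/-- The spin bilinear `∑ i, c†_{i,σ} c_{i,τ}`. -/
def N [NeZero L] (σ τ : Spin) : Matrix Cfg Cfg ℂ := ∑ i : Site L, R.bil (i, σ) (i, τ)

/-- The number of electrons at site `i` in a basis vector. -/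
def occ (S : Cfg) (i : Site L) : ℕ := ((R.modes S).map Prod.fst).count i

lemma lie_E_cr (i j l : Site L) (ρ : Spin) :
    ⁅R.E i j, R.cr (l, ρ)⁆ = if j = l then R.cr (i, ρ) else 0 := by
  rw [E, ring_sum_lie]
  simp only [lie_bil_cr, Prod.mk.injEq]
  by_cases h : j = l <;> simp [h]

lemma lie_E_E (i j l m : Site L) :
    ⁅R.E i j, R.E l m⁆ = (if j = l then R.E i m else 0) - if m = i then R.E l j else 0 := by
  rw [E, E, ring_sum_lie]
  simp only [ring_lie_sum, lie_bil_bil, Prod.mk.injEq, E, Finset.sum_sub_distrib]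
  congr 1
  · by_cases h : j = l <;> simp [h]
  · by_cases h : m = i <;> simp [h]

lemma lie_N_cr [NeZero L] (σ τ : Spin) (l : Site L) (ρ : Spin) :
    ⁅R.N σ τ, R.cr (l, ρ)⁆ = if τ = ρ then R.cr (l, σ) else 0 := by
  rw [N, ring_sum_lie]
  simp only [lie_bil_cr, Prod.mk.injEq]
  by_cases h : τ = ρ <;> simp [h]

lemma lie_N_E [NeZero L] (σ τ : Spin) (l m : Site L) : ⁅R.N σ τ, R.E l m⁆ = 0 := by
  rw [N, E, ring_sum_lie]
  simp only [ring_lie_sum, lie_bil_bil, Prod.mk.injEq, Finset.sum_sub_distrib, ite_and]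
  simp

lemma lie_E_self_E (i a b : Site L) :
    ⁅R.E i i, R.E a b⁆ = ((if i = a then (1 : ℂ) else 0) - if i = b then 1 else 0) • R.E a b := by
  rw [lie_E_E, sub_smul]
  congr 1
  · split_ifs with h
    · rw [h, one_smul]
    · rw [zero_smul]
  · simp only [eq_comm (a := b)]
    split_ifs with h
    · rw [h, one_smul]
    · rw [zero_smul]

lemma E_self_word (i : Site L) (l : List (Site L × Spin)) :
    R.E i i *ᵥ R.word l = ((l.map Prod.fst).count i : ℂ) • R.word l := by
  induction l with
  | nil =>
    rw [E, sum_mulVec]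
    exact (Finset.sum_eq_zero fun σ _ => by simpa using R.bil_self_word (i, σ) []).trans (by simp)
  | cons a l ih =>
    obtain ⟨j, σ⟩ := a
    have h := R.lie_E_cr i i j σ
    rw [Ring.lie_def, sub_eq_iff_eq_add'] at h
    rw [word_cons, mulVec_mulVec, h, add_mulVec, ← mulVec_mulVec, ih, mulVec_smul, List.map_cons,
      List.count_cons]
    by_cases h : i = j
    · subst h; simp [add_smul]
    · simp [h, Ne.symm h]

lemma E_self (i : Site L) : R.E i i = diagonal fun S => (R.occ S i : ℂ) :=
  R.eq_diagonal (R.E_self_word i)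

lemma par_eq [NeZero L] : R.par = diagonal fun S => (-1 : ℂ) ^ ∑ i, R.occ S i := by
  rw [R.eq_diagonal R.par_word]
  congr 1
  funext S
  congr 1
  simpa [occ] using (Multiset.sum_count_eq_card (s := Finset.univ)
    (m := ((R.modes S).map Prod.fst : Multiset (Site L))) (by simp)).symm

lemma lie_E_self_apply (i : Site L) (X : Matrix Cfg Cfg ℂ) (S S' : Cfg) :
    ⁅R.E i i, X⁆ S S' = ((R.occ S i : ℂ) - R.occ S' i) * X S S' := by
  rw [Ring.lie_def, E_self, Matrix.sub_apply, diagonal_mul, mul_diagonal]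
  ring

lemma occ_sub_of_E_apply_ne_zero {i j : Site L} {S S' : Cfg} (h : R.E i j S S' ≠ 0) (m : Site L) :
    (R.occ S m : ℂ) - R.occ S' m = (if m = i then 1 else 0) - if m = j then 1 else 0 := by
  have h1 := R.lie_E_self_apply m (R.E i j) S S'
  rw [lie_E_self_E, Matrix.smul_apply, smul_eq_mul] at h1
  exact (mul_right_cancel₀ h h1).symm

/-- The occupation operators are diagonal, so a joint eigenvector is supported on configurations
with exactly the prescribed occupations. -/
lemma mem_of_occ_eigen {v : Cfg → ℂ} {ν : Site L → ℕ} (hv : ∀ i, R.E i i *ᵥ v = (ν i : ℂ) • v)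
    {p : Submodule ℂ (Cfg → ℂ)} (hp : ∀ l, (∀ i, (l.map Prod.fst).count i = ν i) → R.word l ∈ p) :
    v ∈ p := by
  rw [pi_eq_sum_univ v]
  refine p.sum_mem fun S _ => ?_
  by_cases h : v S = 0
  · rw [h, zero_smul]; exact p.zero_mem
  · refine p.smul_mem _ ?_
    have : (fun j => if S = j then (1 : ℂ) else 0) = R.word (R.modes S) := by
      rw [word, ← R.basis]; ext j; simp [Pi.single_apply, eq_comm]
    rw [this]
    refine hp _ fun i => ?_
    have h1 := congrFun (hv i) S
    rw [E_self, mulVec_diagonal, Pi.smul_apply, smul_eq_mul] at h1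
    exact_mod_cast mul_right_cancel₀ h h1

lemma exists_mulVec_vac {X : Matrix Cfg Cfg ℂ} (hX : ∀ i, Commute (R.E i i) X) :
    ∃ α : ℂ, X *ᵥ R.vac = α • R.vac := by
  have : X *ᵥ R.vac ∈ Submodule.span ℂ {R.vac} := by
    refine R.mem_of_occ_eigen (ν := 0) (fun i => ?_) fun l hl => ?_
    · have := R.E_self_word i []
      rw [word_nil] at this
      rw [mulVec_mulVec, (hX i).eq, ← mulVec_mulVec, this]
      simp
    · have : l.map Prod.fst = [] := by
        rw [List.eq_nil_iff_forall_not_mem]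
        exact fun a => List.count_eq_zero.mp (hl a)
      rw [List.map_eq_nil_iff] at this
      rw [this]
      exact Submodule.mem_span_singleton_self _
  obtain ⟨α, h⟩ := Submodule.mem_span_singleton.mp this
  exact ⟨α, h.symm⟩

lemma exists_mulVec_cr_vac {X : Matrix Cfg Cfg ℂ} (hX : ∀ i, Commute (R.E i i) X) (a : Site L)
    (σ : Spin) : ∃ β : Spin → ℂ, X *ᵥ R.word [(a, σ)] = ∑ τ, β τ • R.word [(a, τ)] := by
  have : X *ᵥ R.word [(a, σ)] ∈ Submodule.span ℂ (Set.range fun τ => R.word [(a, τ)]) := by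
    refine R.mem_of_occ_eigen (ν := fun i => if i = a then 1 else 0) (fun i => ?_) fun l hl => ?_
    · rw [mulVec_mulVec, (hX i).eq, ← mulVec_mulVec, E_self_word, mulVec_smul]
      simp [List.count_singleton, @eq_comm _ a i]
    · have : (l.map Prod.fst).Perm [a] := by
        rw [List.perm_iff_count]
        intro i
        rw [hl]
        simp [List.count_singleton, @eq_comm _ a i]
      rw [List.perm_singleton, List.map_eq_singleton_iff] at this
      obtain ⟨⟨a', τ⟩, rfl, rfl⟩ := this
      exact Submodule.subset_span ⟨τ, rfl⟩
  obtain ⟨β, h⟩ := (Submodule.mem_span_range_iff_exists_fun ℂ).mp this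
  exact ⟨β, h.symm⟩

lemma E_word_singleton (i j : Site L) (σ : Spin) :
    R.E i j *ᵥ R.word [(j, σ)] = R.word [(i, σ)] := by
  have h := R.lie_E_cr i j j σ
  rw [Ring.lie_def, sub_eq_iff_eq_add', if_pos rfl] at h
  have h0 : R.E i j *ᵥ R.vac = 0 := by
    rw [E, sum_mulVec]
    exact Finset.sum_eq_zero fun σ _ => by simp [bil, ← mulVec_mulVec, R.an_vac]
  rw [word_cons, mulVec_mulVec, h, add_mulVec, ← mulVec_mulVec, word_nil, h0, mulVec_zero, zero_add,
    word_cons, word_nil]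

lemma word_singleton_ne_zero (a : Site L × Spin) : R.word [a] ≠ 0 := by
  intro h
  have h2 := R.an_cr a a
  rw [if_pos rfl] at h2
  apply R.vac_ne_zero
  rw [← one_mulVec R.vac, ← h2, add_mulVec, ← mulVec_mulVec, ← mulVec_mulVec, R.an_vac, mulVec_zero,
    add_zero]
  rw [word_cons, word_nil] at h
  rw [h, mulVec_zero]

lemma E_ne_zero (i j : Site L) : R.E i j ≠ 0 := by
  intro h
  apply R.word_singleton_ne_zero (i, 0)
  rw [← R.E_word_singleton i j, h, zero_mulVec]

/-- A matrix commuting with all hopping bilinears and with the creation operators at one site is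
a multiple of the identity. -/
lemma eq_smul_one_of_commute {X : Matrix Cfg Cfg ℂ} (hX : ∀ i j, Commute (R.E i j) X) (a : Site L)
    (ha : ∀ σ, Commute (R.cr (a, σ)) X) : ∃ α : ℂ, X = α • (1 : Matrix Cfg Cfg ℂ) := by
  -- The relation `⁅E m a, c†_a⁆ = c†_m` carries commutation from the site `a` to every other site.
  have h1 : ∀ d : Site L × Spin, Commute (R.cr d) X := by
    rintro ⟨m, σ⟩
    have := R.lie_E_cr m a a σ
    rw [if_pos rfl, Ring.lie_def] at this
    rw [← this]
    exact ((hX m a).mul_left (ha σ)).sub_left ((ha σ).mul_left (hX m a))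
  obtain ⟨α, hα⟩ := R.exists_mulVec_vac fun i => hX i i
  refine ⟨α, R.ext_word fun l => ?_⟩
  rw [smul_mulVec, one_mulVec]
  induction l with
  | nil => exact hα
  | cons d l ih => rw [word_cons, mulVec_mulVec, ← (h1 d).eq, ← mulVec_mulVec, ih, mulVec_smul]

/-- The iterated graded commutator of an even element `X` with two odd elements `a` and `b`. -/
def Phi {A : Type*} [Ring A] (X a b : A) : A := a * (b * X - X * b) + (b * X - X * b) * a

lemma lie_Phi {A : Type*} [Ring A] (e X a b : A) :
    ⁅e, Phi X a b⁆ = Phi X ⁅e, a⁆ b + Phi X a ⁅e, b⁆ + Phi ⁅e, X⁆ a b := by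
  simp only [Phi, Ring.lie_def]
  noncomm_ring

/-- As `X` commutes with `E i j`, bracketing with `E i j` acts on the two arguments of `Phi` alone
and moves them between sites. Since `a ≠ b`, the second argument can be moved anywhere, then the
first as long as the second is not at `a`. The antisymmetry `hanti`, which holds because creation
operators anticommute, covers the remaining case. -/
lemma Phi_cr_eq_zero {X : Matrix Cfg Cfg ℂ} (hX : ∀ i j, Commute (R.E i j) X) {a b : Site L}
    (hab : a ≠ b) (h : ∀ σ τ, Phi X (R.cr (a, σ)) (R.cr (b, τ)) = 0) (d e : Site L × Spin) :
    Phi X (R.cr d) (R.cr e) = 0 := by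
  have hanti : ∀ d e, Phi X (R.cr d) (R.cr e) = 0 → Phi X (R.cr e) (R.cr d) = 0 := by
    intro d e hde
    have h1 := R.cr_cr d e
    have : Phi X (R.cr d) (R.cr e) + Phi X (R.cr e) (R.cr d) =
        (R.cr d * R.cr e + R.cr e * R.cr d) * X - X * (R.cr d * R.cr e + R.cr e * R.cr d) := by
      simp only [Phi]; noncomm_ring
    rwa [h1, hde, zero_add, zero_mul, mul_zero, sub_zero] at this
  have hmove : ∀ i j d e, Phi X (R.cr d) (R.cr e) = 0 →
      Phi X ⁅R.E i j, R.cr d⁆ (R.cr e) + Phi X (R.cr d) ⁅R.E i j, R.cr e⁆ = 0 := by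
    intro i j d e hde
    have := lie_Phi (R.E i j) X (R.cr d) (R.cr e)
    have hz : Phi (0 : Matrix Cfg Cfg ℂ) (R.cr d) (R.cr e) = 0 := by simp [Phi]
    rwa [hde, Ring.lie_def _ (0 : Matrix Cfg Cfg ℂ), mul_zero, zero_mul, sub_zero, Ring.lie_def _ X, (hX i j).eq, sub_self, hz, add_zero, eq_comm] at this
  have hz1 : ∀ y, Phi X 0 y = 0 := fun y => by simp [Phi]
  have hz2 : ∀ y, Phi X y 0 = 0 := fun y => by simp [Phi]
  have h2 : ∀ m σ τ, Phi X (R.cr (a, σ)) (R.cr (m, τ)) = 0 := by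
    intro m σ τ
    have := hmove m b _ _ (h σ τ)
    rwa [lie_E_cr, lie_E_cr, if_neg hab.symm, if_pos rfl, hz1, zero_add] at this
  have h3 : ∀ l m σ τ, m ≠ a → Phi X (R.cr (l, σ)) (R.cr (m, τ)) = 0 := by
    intro l m σ τ hm
    have := hmove l a _ _ (h2 m σ τ)
    rwa [lie_E_cr, lie_E_cr, if_neg hm.symm, if_pos rfl, hz2, add_zero] at this
  obtain ⟨l, σ⟩ := d
  obtain ⟨m, τ⟩ := e
  by_cases hm : m = a
  · subst hm; exact hanti _ _ (h2 _ _ _)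
  · exact h3 _ _ _ _ hm

variable [NeZero L]

/-- The commutator of a bilinear with a creation operator is zero or another creation operator, and
creation operators anticommute. -/
lemma Phi_eq_zero_of_mem {Y : Matrix Cfg Cfg ℂ}
    (hY : Y ∈ Submodule.span ℂ ({1} ∪ {A | ∃ σ τ, A = R.N σ τ})) (d e : Site L × Spin) :
    Phi Y (R.cr d) (R.cr e) = 0 := by
  induction hY using Submodule.span_induction with
  | mem x hx =>
    rcases hx with rfl | ⟨σ, τ, rfl⟩
    · simp [Phi]
    · obtain ⟨l, ρ⟩ := e
      have := R.lie_N_cr σ τ l ρ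
      rw [Ring.lie_def] at this
      rw [Phi, ← neg_sub, this]
      split_ifs
      · rw [mul_neg, neg_mul, ← neg_add, R.cr_cr, neg_zero]
      · simp
  | zero => simp [Phi]
  | add x y _ _ hx hy =>
    have : Phi (x + y) (R.cr d) (R.cr e) = Phi x (R.cr d) (R.cr e) + Phi y (R.cr d) (R.cr e) := by
      simp only [Phi]; noncomm_ring
    rw [this, hx, hy, add_zero]
  | smul r x _ hx =>
    have : Phi (r • x) (R.cr d) (R.cr e) = r • Phi x (R.cr d) (R.cr e) := by
      simp only [Phi, smul_mul_assoc, mul_smul_comm, ← smul_sub, ← smul_add]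
    rw [this, hx, smul_zero]

omit [NeZero L] in
/-- Matrices with vanishing double graded commutators with creation operators are determined by
their action on states with at most one electron. -/
lemma ext_of_Phi {X Y : Matrix Cfg Cfg ℂ} (hX : ∀ d e, Phi X (R.cr d) (R.cr e) = 0)
    (hY : ∀ d e, Phi Y (R.cr d) (R.cr e) = 0) (h0 : X *ᵥ R.vac = Y *ᵥ R.vac)
    (h1 : ∀ d, X *ᵥ R.word [d] = Y *ᵥ R.word [d]) : X = Y := by
  -- The vanishing double commutator expresses `Z` on a word through its values on words shorter by
  -- one and by two.
  have key : ∀ Z : Matrix Cfg Cfg ℂ, (∀ d e, Phi Z (R.cr d) (R.cr e) = 0) → ∀ d e l,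
      Z *ᵥ R.word (d :: e :: l) = R.cr e *ᵥ (R.cr d *ᵥ (Z *ᵥ R.word l))
        - R.cr e *ᵥ (Z *ᵥ R.word (d :: l)) + R.cr d *ᵥ (Z *ᵥ R.word (e :: l)) := by
    intro Z hZ d e l
    have : Z * R.cr d * R.cr e
        = R.cr e * R.cr d * Z - R.cr e * Z * R.cr d + R.cr d * Z * R.cr e := by
      have := hZ e d
      rw [Phi] at this
      rw [← sub_eq_zero, ← neg_eq_zero, ← this]
      noncomm_ring
    simp only [word_cons, mulVec_mulVec, ← add_mulVec, ← sub_mulVec, ← mul_assoc]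
    rw [this]
  refine R.ext_word fun l => ?_
  induction hn : l.length using Nat.strong_induction_on generalizing l with
  | _ n ih =>
    match l with
    | [] => exact h0
    | [d] => exact h1 d
    | d :: e :: l =>
      simp only [List.length_cons] at hn
      rw [key X hX, key Y hY, ih l.length (by omega) l rfl, ih (l.length + 1) (by omega) (d :: l) rfl,
        ih (l.length + 1) (by omega) (e :: l) rfl]

/-- A matrix that commutes with all hopping bilinears and satisfies the locality relation for one
pair of sites is a combination of the identity and the spin bilinears. -/
lemma mem_span_of_commute {X : Matrix Cfg Cfg ℂ} (hX : ∀ i j, Commute (R.E i j) X) {a b : Site L}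
    (hab : a ≠ b) (h : ∀ σ τ, Phi X (R.cr (a, σ)) (R.cr (b, τ)) = 0) :
    X ∈ Submodule.span ℂ ({1} ∪ {A | ∃ σ τ, A = R.N σ τ}) := by
  obtain ⟨α, hα⟩ := R.exists_mulVec_vac fun i => hX i i
  choose β hβ using R.exists_mulVec_cr_vac (fun i => hX i i) a
  -- Here `α` is the eigenvalue on the vacuum and `β` the spin matrix on one electron at `a`. The
  -- identity already contributes `α` on one-electron states, whence the subtraction.
  set Y : Matrix Cfg Cfg ℂ := α • 1 +
    ∑ σ, ∑ τ, (β σ τ - if τ = σ then α else 0) • R.N τ σ with hYdef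
  have hY : Y ∈ Submodule.span ℂ ({1} ∪ {A | ∃ σ τ, A = R.N σ τ}) := by
    refine add_mem (Submodule.smul_mem _ _ (Submodule.subset_span (Or.inl rfl)))
      (sum_mem fun σ _ => sum_mem fun τ _ => Submodule.smul_mem _ _
        (Submodule.subset_span (Or.inr ⟨τ, σ, rfl⟩)))
  have hNv : ∀ σ τ, R.N σ τ *ᵥ R.vac = 0 := fun σ τ => by
    simp [N, sum_mulVec, bil, ← mulVec_mulVec, R.an_vac]
  have hNw : ∀ σ τ m ρ, R.N σ τ *ᵥ R.word [(m, ρ)] = if τ = ρ then R.word [(m, σ)] else 0 := by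
    intro σ τ m ρ
    have h := R.lie_N_cr σ τ m ρ
    rw [Ring.lie_def, sub_eq_iff_eq_add'] at h
    rw [word_cons, mulVec_mulVec, h, add_mulVec, ← mulVec_mulVec, word_nil, hNv, mulVec_zero,
      zero_add]
    split_ifs <;> simp [word_cons]
  have : X = Y := by
    refine R.ext_of_Phi (R.Phi_cr_eq_zero hX hab h) (R.Phi_eq_zero_of_mem hY) ?_ ?_
    · simp [hα, hYdef, add_mulVec, smul_mulVec, hNv]
    · rintro ⟨m, σ⟩
      -- Every one-electron state is transported from `a` by `E m a`, which commutes with `X`; so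
      -- the spin matrix `β` is the same at all sites.
      rw [← R.E_word_singleton m a, mulVec_mulVec, ← (hX m a).eq, ← mulVec_mulVec, hβ, mulVec_sum]
      simp only [mulVec_smul, E_word_singleton, hYdef, add_mulVec, smul_mulVec, sum_mulVec, hNw,
        one_mulVec, smul_ite, smul_zero]
      simp [sub_smul, Finset.sum_sub_distrib, ite_smul]
  rwa [this]

/-- The hopping operator. -/
def hop : Matrix Cfg Cfg ℂ := ∑ i : Site L, (R.E i (i + 1) + R.E (i + 1) i)

omit [NeZero L] in
lemma site_ne_add_one (hL : 1 < L) (i : Site L) : i ≠ i + 1 := by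
  have : Fact (1 < L) := ⟨hL⟩
  simp

/-- Bracketing with `E i i` multiplies `E a b` by `δ_{ia} - δ_{ib}`, so the two brackets together
retain only terms joining `i` and `i + 1`. -/
lemma exists_lie_lie_hop (hL : 1 < L) (i : Site L) : ∃ r : ℂ, r ≠ 0 ∧
    ⁅R.E (i + 1) (i + 1), ⁅R.E i i, R.hop⁆⁆ = r • (R.E i (i + 1) + R.E (i + 1) i) := by
  have : Fact (1 < L) := ⟨hL⟩
  have hne := site_ne_add_one hL
  -- This marks the indices `a` whose bond joins `i` and `i + 1`. For `L = 2` there are two of them,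
  -- so the factor is minus their number and not always `-1`.
  let χ : Site L → ℕ := fun a => if a = i ∨ (a = i + 1 ∧ a + 1 = i) then 1 else 0
  refine ⟨-((∑ a, χ a : ℕ) : ℂ), ?_, ?_⟩
  · rw [neg_ne_zero, Nat.cast_ne_zero]
    have : χ i ≤ ∑ a, χ a := Finset.single_le_sum (fun _ _ => Nat.zero_le _) (Finset.mem_univ i)
    have h1 : χ i = 1 := by simp [χ]
    omega
  · rw [hop, ring_lie_sum, ring_lie_sum, Nat.cast_sum, ← Finset.sum_neg_distrib, Finset.sum_smul]
    refine Finset.sum_congr rfl fun a _ => ?_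
    simp only [ring_lie_add, lie_E_self_E, ring_lie_smul, smul_smul]
    have e1 : (i + 1 = a + 1) ↔ i = a := add_left_inj 1
    by_cases h1 : i = a
    · subst h1
      simp [χ, hne i, (hne i).symm]
    · by_cases h2 : i + 1 = a
      · by_cases h3 : i = a + 1
        · subst h2
          simp [χ, ← h3, (hne i).symm, add_comm]
        · simp [χ, e1, Ne.symm h1, h1, h3, Ne.symm h3]
      · simp [χ, e1, Ne.symm h1, h1, h2, Ne.symm h2]

/-- The commutant of `X` is closed under brackets. It contains each bond term by the double bracket,
each of its two halves by one more bracket with `E i i`, and then all `E i j` by chaining neighbours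
along the ring. -/
lemma commute_E_of_commute_hop (hL : 1 < L) {X : Matrix Cfg Cfg ℂ}
    (h1 : ∀ i, Commute (R.E i i) X) (h2 : Commute R.hop X) (i j : Site L) :
    Commute (R.E i j) X := by
  have hlie : ∀ a b : Matrix Cfg Cfg ℂ, Commute a X → Commute b X → Commute ⁅a, b⁆ X :=
    fun a b ha hb => by
      rw [Ring.lie_def]; exact (ha.mul_left hb).sub_left (hb.mul_left ha)
  have hadj : ∀ i, Commute (R.E i (i + 1)) X := by
    intro i
    obtain ⟨r, hr, h⟩ := R.exists_lie_lie_hop hL i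
    have hs : Commute (R.E i (i + 1) + R.E (i + 1) i) X := by
      have := (hlie _ _ (h1 (i + 1)) (hlie _ _ (h1 i) h2)).smul_left r⁻¹
      rwa [h, smul_smul, inv_mul_cancel₀ hr, one_smul] at this
    have hd := hlie _ _ (h1 i) hs
    rw [ring_lie_add, lie_E_self_E, lie_E_self_E, if_pos rfl, if_neg (site_ne_add_one hL i), sub_zero,
      one_smul, zero_sub, neg_one_smul] at hd
    have := (hs.add_left hd).smul_left (2⁻¹ : ℂ)
    have e : R.E i (i + 1) + R.E (i + 1) i + (R.E i (i + 1) + -R.E (i + 1) i)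
      = (2 : ℂ) • R.E i (i + 1) := by rw [two_smul]; abel
    rwa [e, smul_smul, inv_mul_cancel₀ two_ne_zero, one_smul] at this
  have hn : ∀ n : ℕ, Commute (R.E i (i + n)) X := by
    intro n
    induction n with
    | zero => simpa using h1 i
    | succ n ih =>
      have h3 := hlie _ _ ih (hadj (i + n))
      rw [lie_E_E, if_pos rfl] at h3
      push_cast
      rw [← add_assoc]
      -- When the chain closes up at `i`, the bracket has an extra diagonal term.
      split_ifs at h3 with h4
      · simpa using h3.add_left (h1 (i + n))
      · simpa using h3
  have := hn (j - i).val
  rwa [ZMod.natCast_zmod_val, add_sub_cancel] at this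

/-- The double bracket isolates one bond, whose two terms shift the occupations in opposite
directions and so cannot cancel at a common entry. -/
lemma exists_hop_apply_ne_zero (hL : 1 < L) (i : Site L) : ∃ S S', R.hop S S' ≠ 0 ∧
    ∀ m, (R.occ S m : ℂ) - R.occ S' m = (if m = i then 1 else 0) - if m = i + 1 then 1 else 0 := by
  have hne := site_ne_add_one hL i
  obtain ⟨S, S', h⟩ : ∃ S S', R.E i (i + 1) S S' ≠ 0 := by
    by_contra! h
    exact R.E_ne_zero i (i + 1) (by ext S S'; exact h S S')
  have ho := R.occ_sub_of_E_apply_ne_zero h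
  refine ⟨S, S', fun h0 => ?_, ho⟩
  obtain ⟨r, hr, h1⟩ := R.exists_lie_lie_hop hL i
  have h2 := congrFun (congrFun h1 S) S'
  rw [lie_E_self_apply, lie_E_self_apply, h0, mul_zero, mul_zero, Matrix.smul_apply, smul_eq_mul, eq_comm,
    mul_eq_zero, or_iff_right hr, Matrix.add_apply] at h2
  have h3 : R.E (i + 1) i S S' = 0 := by
    by_contra h3
    have h4 := R.occ_sub_of_E_apply_ne_zero h3 i
    rw [ho, if_pos rfl, if_neg hne] at h4
    norm_num at h4
  rw [h3, add_zero] at h2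
  exact h h2

end Sites

end FermionRep

end HolsteinHubbard

namespace HolsteinHubbard

open MvPolynomial

/-! ### Polynomials in the variables `X i` and `λ i` -/

/-- Polynomials in two families of variables indexed by `ι`; normal-ordered symbols of phonon
operators, with `inl i` standing for creation and `inr i` for annihilation at the site `i`. -/
abbrev SymPoly (ι : Type*) : Type _ := MvPolynomial (ι ⊕ ι) ℂ

section Coeff

variable {σ : Type*}

lemma pderiv_pderiv_comm (i j : σ) (p : MvPolynomial σ ℂ) :
    pderiv i (pderiv j p) = pderiv j (pderiv i p) := by
  classical
  ext M
  simp only [coeff_pderiv, Finsupp.add_apply, Finsupp.single_apply]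
  rw [add_right_comm]
  by_cases h : i = j
  · subst h; rfl
  · rw [if_neg h, if_neg (Ne.symm h)]; push_cast; ring

lemma eq_C_of_pderiv_eq_zero {p : MvPolynomial σ ℂ} (h : ∀ i, pderiv i p = 0) :
    p = C (coeff 0 p) := by
  classical
  ext M
  rw [coeff_C]
  split_ifs with hM
  · rw [hM]
  · obtain ⟨i, hi⟩ := Finsupp.ne_iff.mp (Ne.symm hM)
    have h1 : Finsupp.single i 1 ≤ M := by
      rw [Finsupp.single_le_iff]; exact Nat.one_le_iff_ne_zero.mpr hi
    have h2 := congrArg (coeff (M - Finsupp.single i 1)) (h i)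
    rw [coeff_pderiv, tsub_add_cancel_of_le h1, coeff_zero, mul_eq_zero] at h2
    refine h2.resolve_right ?_
    exact Nat.cast_add_one_ne_zero _

lemma homogeneousComponent_succ_X_mul (n : ℕ) (j : σ) (p : MvPolynomial σ ℂ) :
    homogeneousComponent (n + 1) (X j * p) = X j * homogeneousComponent n p := by
  classical
  ext M
  rw [coeff_homogeneousComponent, coeff_X_mul', coeff_X_mul', coeff_homogeneousComponent]
  by_cases h : j ∈ M.support
  · have h1 : M.degree = (M - Finsupp.single j 1).degree + 1 := by
      have : Finsupp.single j 1 ≤ M := by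
        rw [Finsupp.single_le_iff]; exact Nat.one_le_iff_ne_zero.mpr (Finsupp.mem_support_iff.mp h)
      conv_lhs => rw [← tsub_add_cancel_of_le this, map_add, Finsupp.degree_single]
    simp [h, h1]
  · simp [h]

lemma homogeneousComponent_zero_X_mul (j : σ) (p : MvPolynomial σ ℂ) :
    homogeneousComponent 0 (X j * p) = 0 := by
  classical
  rw [homogeneousComponent_zero, coeff_X_mul']
  simp

lemma homogeneousComponent_pderiv (n : ℕ) (j : σ) (p : MvPolynomial σ ℂ) :
    homogeneousComponent n (pderiv j p) = pderiv j (homogeneousComponent (n + 1) p) := by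
  classical
  ext M
  rw [coeff_homogeneousComponent, coeff_pderiv, coeff_pderiv, coeff_homogeneousComponent, map_add,
    Finsupp.degree_single]
  simp

lemma coeff_X_mul_pderiv (j : σ) (p : MvPolynomial σ ℂ) (M : σ →₀ ℕ) :
    coeff M (X j * pderiv j p) = M j * coeff M p := by
  classical
  induction p using MvPolynomial.induction_on' with
  | add p q hp hq => rw [map_add, mul_add, coeff_add, coeff_add, hp, hq, mul_add]
  | monomial n a =>
    rw [X_mul_pderiv_monomial, coeff_smul, coeff_monomial]
    split_ifs with h
    · rw [h, nsmul_eq_mul]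
    · simp

end Coeff

/-! ### The grading by the number of creation minus annihilation variables. -/

section Weight

variable {ι : Type*} [Fintype ι]

/-- The derivation counting the variables `X i` minus the variables `λ i`. -/
def wt : SymPoly ι →ₗ[ℂ] SymPoly ι :=
  ∑ i : ι, (LinearMap.mulLeft ℂ (X (Sum.inl i)) ∘ₗ (pderiv (Sum.inl i)).toLinearMap -
    LinearMap.mulLeft ℂ (X (Sum.inr i)) ∘ₗ (pderiv (Sum.inr i)).toLinearMap)

lemma wt_apply (p : SymPoly ι) : wt p = ∑ i : ι, (X (Sum.inl i) * pderiv (Sum.inl i) p -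
    X (Sum.inr i) * pderiv (Sum.inr i) p) := by
  simp [wt]

lemma coeff_wt (p : SymPoly ι) (M : ι ⊕ ι →₀ ℕ) :
    coeff M (wt p) = ((∑ i, M (Sum.inl i) : ℕ) - (∑ i, M (Sum.inr i) : ℕ) : ℂ) * coeff M p := by
  rw [wt_apply, coeff_sum]
  simp only [coeff_sub, coeff_X_mul_pderiv, ← sub_mul, ← Finset.sum_mul, Finset.sum_sub_distrib]
  push_cast
  rfl

lemma homogeneousComponent_wt (n : ℕ) (p : SymPoly ι) :
    homogeneousComponent n (wt p) = wt (homogeneousComponent n p) := by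
  ext M
  rw [coeff_homogeneousComponent, coeff_wt, coeff_wt, coeff_homogeneousComponent]
  split_ifs <;> simp

/-- All monomials of `p` have degree `m` in the variables `X i`. -/
def XDeg (m : ℕ) (p : SymPoly ι) : Prop := ∀ M, coeff M p ≠ 0 → ∑ i, M (Sum.inl i) = m

lemma degree_eq_add (M : ι ⊕ ι →₀ ℕ) :
    M.degree = ∑ i, M (Sum.inl i) + ∑ i, M (Sum.inr i) := by
  rw [Finsupp.degree_eq_sum, Fintype.sum_sum_type]

lemma two_mul_sum_of_wt {d : ℕ} {p : SymPoly ι} (hd : p.IsHomogeneous d) (h : wt p = 0)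
    {M : ι ⊕ ι →₀ ℕ} (hM : coeff M p ≠ 0) :
    2 * ∑ i, M (Sum.inl i) = d ∧ 2 * ∑ i, M (Sum.inr i) = d := by
  have h1 : M.degree = d := by
    by_contra h1
    exact hM (hd.coeff_eq_zero h1)
  have h2 := congrArg (coeff M) h
  rw [coeff_wt, coeff_zero, mul_eq_zero, or_iff_left hM, sub_eq_zero, Nat.cast_inj] at h2
  rw [degree_eq_add] at h1
  omega

lemma eq_zero_of_wt_of_odd {d : ℕ} {p : SymPoly ι} (hd : p.IsHomogeneous d) (h : wt p = 0)
    (ho : Odd d) : p = 0 := by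
  ext M
  by_contra hM
  have := (two_mul_sum_of_wt hd h hM).1
  obtain ⟨k, hk⟩ := ho
  omega

lemma XDeg.add {m : ℕ} {p q : SymPoly ι} (hp : XDeg m p) (hq : XDeg m q) : XDeg m (p + q) := by
  intro M hM
  rw [coeff_add] at hM
  by_cases h : coeff M p = 0
  · exact hq M fun h2 => hM (by rw [h, h2, add_zero])
  · exact hp M h

lemma XDeg.smul {m : ℕ} {p : SymPoly ι} (hp : XDeg m p) (r : ℂ) : XDeg m (r • p) := by
  intro M hM
  exact hp M fun h => hM (by rw [coeff_smul, h, smul_zero])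

lemma XDeg.zero (m : ℕ) : XDeg m (0 : SymPoly ι) := fun M hM => absurd (coeff_zero M) hM

lemma XDeg.sum {m : ℕ} {κ : Type*} (s : Finset κ) {f : κ → SymPoly ι} (h : ∀ k ∈ s, XDeg m (f k)) :
    XDeg m (∑ k ∈ s, f k) :=
  Finset.sum_induction f (XDeg m) (fun _ _ => XDeg.add) (XDeg.zero m) h

lemma XDeg.pderiv_inl {m : ℕ} {p : SymPoly ι} (hp : XDeg (m + 1) p) (i : ι) :
    XDeg m (pderiv (Sum.inl i) p) := by
  classical
  intro M hM
  rw [coeff_pderiv] at hM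
  have := hp _ (left_ne_zero_of_mul hM)
  simpa [Finset.sum_add_distrib, Finsupp.single_apply] using this

lemma XDeg.pderiv_inr {m : ℕ} {p : SymPoly ι} (hp : XDeg m p) (i : ι) :
    XDeg m (pderiv (Sum.inr i) p) := by
  classical
  intro M hM
  rw [coeff_pderiv] at hM
  have := hp _ (left_ne_zero_of_mul hM)
  simpa [Finset.sum_add_distrib, Finsupp.single_apply] using this

/-- The substitution `X i ↦ s * X i`. -/
def scaleX : SymPoly ι →ₐ[ℂ] Polynomial (SymPoly ι) :=
  aeval (Sum.elim (fun i => Polynomial.C (X (Sum.inl i)) * Polynomial.X)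
    (fun i => Polynomial.C (X (Sum.inr i))))

lemma scaleX_eq {m : ℕ} {p : SymPoly ι} (hp : XDeg m p) :
    scaleX p = Polynomial.C p * Polynomial.X ^ m := by
  have hmon : ∀ (M : ι ⊕ ι →₀ ℕ) (a : ℂ), scaleX (monomial M a) =
      Polynomial.C (monomial M a) * Polynomial.X ^ (∑ i, M (Sum.inl i)) := by
    intro M a
    rw [scaleX, aeval_monomial, monomial_eq, Finsupp.prod_fintype _ _ (by simp),
      Finsupp.prod_fintype _ _ (by simp), Fintype.prod_sum_type, Fintype.prod_sum_type]
    simp only [Sum.elim_inl, Sum.elim_inr, mul_pow, Finset.prod_mul_distrib, map_mul, map_prod,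
      map_pow, Finset.prod_pow_eq_pow_sum]
    have : algebraMap ℂ (Polynomial (SymPoly ι)) a = Polynomial.C (C a) := rfl
    rw [this]
    ring
  conv_lhs => rw [p.as_sum]
  conv_rhs => rw [p.as_sum]
  rw [map_sum, map_sum, Finset.sum_mul]
  refine Finset.sum_congr rfl fun M hM => ?_
  rw [hmon, hp M (mem_support_iff.mp hM)]

/-- If `(u + v) * h = f₁ + f₂` where `u`, `f₁`, `f₂`, `v` have degrees `1`, `m`, `m + 1`, `0` in the
variables `X i`, then `u * f₁ = v * f₂`. -/
lemma mul_eq_mul_of_XDeg {m : ℕ} {u v f₁ f₂ h : SymPoly ι} (hu : XDeg 1 u) (hv : XDeg 0 v)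
    (hu0 : u ≠ 0) (hv0 : v ≠ 0) (h₁ : XDeg m f₁) (h₂ : XDeg (m + 1) f₂)
    (he : f₁ + f₂ = (u + v) * h) : u * f₁ = v * f₂ := by
  have he := congrArg scaleX he
  rw [map_mul, map_add, map_add, scaleX_eq hu, scaleX_eq hv, scaleX_eq h₁, scaleX_eq h₂, pow_one,
    pow_zero, mul_one] at he
  -- The powers of the scaling variable separate the degrees in the `X i`. The lowest and highest
  -- parts of a product with `u + v` cannot cancel, so only the part `P.coeff m` of `h` matters: `f₁
  -- = v * P.coeff m` and `f₂ = u * P.coeff m`.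
  set P := scaleX h
  have hc0 : ∀ n, Polynomial.coeff (Polynomial.C f₁ * Polynomial.X ^ m +
      Polynomial.C f₂ * Polynomial.X ^ (m + 1)) n =
      (if n = m then f₁ else 0) + if n = m + 1 then f₂ else 0 := fun n => by
    rw [Polynomial.coeff_add, Polynomial.coeff_C_mul_X_pow, Polynomial.coeff_C_mul_X_pow]
  have hc : ∀ n, (if n + 1 = m then f₁ else 0) + (if n + 1 = m + 1 then f₂ else 0) =
      u * P.coeff n + v * P.coeff (n + 1) := fun n => by
    rw [← hc0, he, add_mul, Polynomial.coeff_add, mul_assoc, Polynomial.coeff_C_mul,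
      Polynomial.coeff_C_mul, Polynomial.coeff_X_mul]
  have hz : (if 0 = m then f₁ else 0) = v * P.coeff 0 := by
    have := hc0 0
    rw [he, add_mul, Polynomial.coeff_add, mul_assoc, Polynomial.coeff_C_mul,
      Polynomial.coeff_C_mul, Polynomial.coeff_X_mul_zero, mul_zero, zero_add,
      if_neg (Nat.succ_ne_zero m).symm, add_zero] at this
    exact this.symm
  have hlow : ∀ n, n < m → P.coeff n = 0 := by
    intro n
    induction n with
    | zero =>
      intro hn
      rw [if_neg (by omega)] at hz
      exact (mul_eq_zero.mp hz.symm).resolve_left hv0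
    | succ n ih =>
      intro hn
      have := hc n
      rw [ih (by omega), if_neg (by omega), if_neg (by omega), mul_zero, zero_add, zero_add] at this
      exact (mul_eq_zero.mp this.symm).resolve_left hv0
  have hhigh : P.coeff (m + 1) = 0 := by
    by_contra hne
    have hP : P ≠ 0 := fun h => hne (by rw [h, Polynomial.coeff_zero])
    have hle : m + 1 ≤ P.natDegree := Polynomial.le_natDegree_of_ne_zero hne
    have := hc P.natDegree
    rw [if_neg (by omega), if_neg (by omega), Polynomial.coeff_eq_zero_of_natDegree_lt
      (Nat.lt_succ_self _), mul_zero, add_zero, add_zero] at this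
    exact (mul_ne_zero hu0 (Polynomial.leadingCoeff_ne_zero.mpr hP)) this.symm
  have e2 : f₂ = u * P.coeff m := by
    have := hc m
    rwa [if_neg (by omega), if_pos rfl, hhigh, mul_zero, zero_add, add_zero] at this
  have e1 : f₁ = v * P.coeff m := by
    rcases m with _ | m
    · simpa using hz
    · have := hc m
      rwa [if_pos rfl, if_neg (by omega), hlow m (by omega), mul_zero, zero_add, add_zero] at this
  rw [e1, e2]
  ring

/-- A linear form `∑ δ_i (X i + λ i)` does not divide a nonzero polynomial of weight zero. -/
lemma eq_zero_of_wt_of_dvd {d : ℕ} {f h : SymPoly ι} {δ : ι → ℂ} (hδ : δ ≠ 0)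
    (hf : f.IsHomogeneous d) (hw : wt f = 0)
    (he : f = (∑ i, δ i • (X (Sum.inl i) + X (Sum.inr i))) * h) : f = 0 := by
  classical
  by_contra hne
  obtain ⟨M, hM⟩ := MvPolynomial.ne_zero_iff.mp hne
  set m := ∑ i, M (Sum.inl i) with hm
  have hX : XDeg m f := fun M' hM' => by
    have h1 := (two_mul_sum_of_wt hf hw hM).1
    have h2 := (two_mul_sum_of_wt hf hw hM').1
    omega
  set u : SymPoly ι := ∑ i, δ i • X (Sum.inl i) with hu
  set v : SymPoly ι := ∑ i, δ i • X (Sum.inr i) with hv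
  have hu0 : u ≠ 0 := fun h0 => hδ (funext fun i => by
    simpa [hu, coeff_sum, coeff_smul, coeff_X, Finsupp.single_left_inj] using
      congrArg (coeff (Finsupp.single (Sum.inl i) 1)) h0)
  have hv0 : v ≠ 0 := fun h0 => hδ (funext fun i => by
    simpa [hv, coeff_sum, coeff_smul, coeff_X, Finsupp.single_left_inj] using
      congrArg (coeff (Finsupp.single (Sum.inr i) 1)) h0)
  have hXu : XDeg 1 u := XDeg.sum _ fun i _ => XDeg.smul (fun M hM => by
    rw [coeff_X] at hM
    have : Finsupp.single (Sum.inl i) 1 = M := by by_contra h; exact hM (if_neg h)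
    simp [← this, Finsupp.single_apply]) _
  have hXv : XDeg 0 v := XDeg.sum _ fun i _ => XDeg.smul (fun M hM => by
    rw [coeff_X] at hM
    have : Finsupp.single (Sum.inr i) 1 = M := by by_contra h; exact hM (if_neg h)
    simp [← this]) _
  -- Weight zero and homogeneity confine `f` to a single `X`-degree; with `f₂ = 0` the conclusion
  -- reads `u * f = 0`.
  have := mul_eq_mul_of_XDeg (f₂ := 0) (h := h) hXu hXv hu0 hv0 hX (XDeg.zero _) (by
    rw [add_zero, he, hu, hv, ← Finset.sum_add_distrib]
    simp only [smul_add])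
  rw [mul_zero] at this
  exact hne ((mul_eq_zero.mp this).resolve_left hu0)

end Weight

end HolsteinHubbard

namespace HolsteinHubbard

open MvPolynomial

/-! ### Local rotation-invariant polynomials -/

section Rotation

variable {ι : Type*} [Fintype ι]

/-- All mixed second derivatives of `p` at the sites `a` and `b` vanish. -/
def MixedZero (p : SymPoly ι) (a b : ι) : Prop :=
  ∀ z z' : ι → ι ⊕ ι, (z = Sum.inl ∨ z = Sum.inr) → (z' = Sum.inl ∨ z' = Sum.inr) →
    pderiv (z a) (pderiv (z' b) p) = 0

/-- `p` is invariant under rotations of the relative coordinate of the sites `i` and `j`. -/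
def RotInv (p : SymPoly ι) (i j : ι) : Prop :=
  (X (Sum.inl i) - X (Sum.inl j)) * (pderiv (Sum.inl i) p - pderiv (Sum.inl j) p) =
    (X (Sum.inr i) - X (Sum.inr j)) * (pderiv (Sum.inr i) p - pderiv (Sum.inr j) p)

omit [Fintype ι] in
lemma RotInv.symm {p : SymPoly ι} {i j : ι} (h : RotInv p i j) : RotInv p j i := by
  rw [RotInv] at *
  linear_combination h

omit [Fintype ι] in
-- Differentiate the rotation identity once at `a` and once at `i`. Every term containing
-- derivatives at both `a` and `i` dies, and what survives, from differentiating the linear factor,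
-- is the mixed derivative at `a` and `j`.
lemma MixedZero.move {p : SymPoly ι} {a i j : ι} (hij : i ≠ j) (hi : a ≠ i) (hj : a ≠ j)
    (hr : RotInv p i j) (h : MixedZero p a i) : MixedZero p a j := by
  classical
  have hl : ∀ z : ι → ι ⊕ ι, (z = Sum.inl ∨ z = Sum.inr) →
      pderiv (z a) (pderiv (Sum.inl i) p) = 0 := fun z hz => h z _ hz (Or.inl rfl)
  have hr' : ∀ z : ι → ι ⊕ ι, (z = Sum.inl ∨ z = Sum.inr) →
      pderiv (z a) (pderiv (Sum.inr i) p) = 0 := fun z hz => h z _ hz (Or.inr rfl)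
  intro z z' hz hz'
  have hXa : ∀ (w : ι → ι ⊕ ι) (k : ι), (w = Sum.inl ∨ w = Sum.inr) → a ≠ k →
      pderiv (z a) (X (w k) : SymPoly ι) = 0 := by
    intro w k hw hk
    refine pderiv_X_of_ne ?_
    rcases hz with rfl | rfl <;> rcases hw with rfl | rfl <;> simp [hk.symm]
  have third : ∀ w : ι ⊕ ι, (w = Sum.inl i ∨ w = Sum.inr i) → ∀ y,
      pderiv (z a) (pderiv w (pderiv y p)) = 0 := by
    intro w hw y
    rw [pderiv_pderiv_comm w, pderiv_pderiv_comm (z a)]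
    rcases hw with rfl | rfl
    · rw [hl z hz, map_zero]
    · rw [hr' z hz, map_zero]
  rcases hz' with rfl | rfl
  · have h1 := congrArg (fun q => pderiv (z a) (pderiv (Sum.inl i) q)) hr
    simp only [pderiv_mul, map_sub, map_add, hXa Sum.inl _ (Or.inl rfl) hi,
      hXa Sum.inl _ (Or.inl rfl) hj, hXa Sum.inr _ (Or.inr rfl) hi,
      hXa Sum.inr _ (Or.inr rfl) hj, third _ (Or.inl rfl), hl z hz, pderiv_X_self,
      pderiv_X_of_ne (show Sum.inl j ≠ Sum.inl i by simp [hij.symm]),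
      pderiv_X_of_ne (show (Sum.inr i : ι ⊕ ι) ≠ Sum.inl i by simp),
      pderiv_X_of_ne (show (Sum.inr j : ι ⊕ ι) ≠ Sum.inl i by simp), pderiv_one, map_zero] at h1
    linear_combination -h1
  · have h1 := congrArg (fun q => pderiv (z a) (pderiv (Sum.inr i) q)) hr
    simp only [pderiv_mul, map_sub, map_add, hXa Sum.inl _ (Or.inl rfl) hi,
      hXa Sum.inl _ (Or.inl rfl) hj, hXa Sum.inr _ (Or.inr rfl) hi,
      hXa Sum.inr _ (Or.inr rfl) hj, third _ (Or.inr rfl), hr' z hz, pderiv_X_self,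
      pderiv_X_of_ne (show Sum.inr j ≠ Sum.inr i by simp [hij.symm]),
      pderiv_X_of_ne (show (Sum.inl i : ι ⊕ ι) ≠ Sum.inr i by simp),
      pderiv_X_of_ne (show (Sum.inl j : ι ⊕ ι) ≠ Sum.inr i by simp), pderiv_one, map_zero] at h1
    linear_combination h1

omit [Fintype ι] in
-- Applying `∂λ_j ∂X_i` to the rotation identity leaves minus one diagonal second derivative on each
-- side.
lemma RotInv.pderiv_pderiv_eq {p : SymPoly ι} {i j : ι} (hij : i ≠ j) (hr : RotInv p i j)
    (h : MixedZero p j i) : pderiv (Sum.inl j) (pderiv (Sum.inr j) p) =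
      pderiv (Sum.inl i) (pderiv (Sum.inr i) p) := by
  classical
  have h1 := congrArg (fun q => pderiv (Sum.inr j) (pderiv (Sum.inl i) q)) hr
  have h0 := h Sum.inr Sum.inl (Or.inr rfl) (Or.inl rfl)
  have third : ∀ y, pderiv (Sum.inr j) (pderiv (Sum.inl i) (pderiv y p)) = 0 := by
    intro y
    rw [pderiv_pderiv_comm (Sum.inl i), pderiv_pderiv_comm (Sum.inr j), h0, map_zero]
  have h2 : pderiv (Sum.inl i) (pderiv (Sum.inr j) p) = 0 := by rw [pderiv_pderiv_comm, h0]
  simp only [pderiv_mul, map_sub, map_add, third, h0, h2, pderiv_X_self,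
    pderiv_X_of_ne (show Sum.inl j ≠ Sum.inl i by simp [hij.symm]),
    pderiv_X_of_ne (show Sum.inr i ≠ Sum.inr j by simp [hij]),
    pderiv_X_of_ne (show (Sum.inr i : ι ⊕ ι) ≠ Sum.inl i by simp),
    pderiv_X_of_ne (show (Sum.inr j : ι ⊕ ι) ≠ Sum.inl i by simp),
    pderiv_X_of_ne (show (Sum.inl i : ι ⊕ ι) ≠ Sum.inr j by simp),
    pderiv_X_of_ne (show (Sum.inl j : ι ⊕ ι) ≠ Sum.inr j by simp), pderiv_one, map_zero] at h1
  rw [pderiv_pderiv_comm (Sum.inl j)]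
  linear_combination -h1

end Rotation

/-! ### Rotation-invariant local polynomials on the periodic chain. -/

section Ring

variable {L : ℕ} [NeZero L]

/-- Starting from distance `n`, the second site is moved one step at a time, up to distance `L - 1`
and down to distance `1`, without ever meeting `a`. -/
lemma mixedZero_of_ne {p : SymPoly (Site L)} (hL : 1 < L) (hr : ∀ i, RotInv p i (i + 1)) {n : ℕ}
    (hn : 0 < n) (hnL : n < L) (h : ∀ a : Site L, MixedZero p a (a + n)) {a b : Site L}
    (hab : a ≠ b) : MixedZero p a b := by
  have hne : ∀ (a : Site L) (k : ℕ), 0 < k → k < L → a ≠ a + k := by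
    intro a k hk hkL h
    rw [left_eq_add, ZMod.natCast_eq_zero_iff] at h
    exact absurd (Nat.le_of_dvd hk h) (by omega)
  have hup : ∀ k, n ≤ k → k < L → ∀ a : Site L, MixedZero p a (a + k) := by
    intro k hk
    induction k, hk using Nat.le_induction with
    | base => exact fun _ => h
    | succ k hk ih =>
      intro hkL a
      have := (ih (by omega) a).move (FermionRep.site_ne_add_one hL (a + k))
        (hne a k (by omega) (by omega)) (by
          have := hne a (k + 1) (by omega) hkL
          push_cast at this
          rwa [← add_assoc] at this) (hr _)
      push_cast
      rwa [← add_assoc]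
  have hdown : ∀ k, k < n → ∀ a : Site L, MixedZero p a (a + (n - k : ℕ)) := by
    intro k
    induction k with
    | zero => exact fun _ => h
    | succ k ih =>
      intro hk a
      have e : ((n - k : ℕ) : Site L) = (n - (k + 1) : ℕ) + 1 := by
        rw [show n - k = n - (k + 1) + 1 by omega]; push_cast; rfl
      have h1 := ih (by omega) a
      have h2 := hne a (n - k) (by omega) (by omega)
      rw [e, ← add_assoc] at h1 h2
      exact h1.move (FermionRep.site_ne_add_one hL _).symm h2 (hne a _ (by omega) (by omega))
        (hr _).symm
  have hb : b = a + ((b - a).val : ℕ) := by rw [ZMod.natCast_zmod_val]; ring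
  have hval := ZMod.val_lt (b - a)
  have hpos : 0 < (b - a).val := by
    rw [Nat.pos_iff_ne_zero, ne_eq, ZMod.val_eq_zero, sub_eq_zero]; exact hab.symm
  rw [hb]
  rcases le_or_gt n (b - a).val with h1 | h1
  · exact hup _ h1 hval a
  · have := hdown (n - (b - a).val) (by omega) a
    rwa [show n - (n - (b - a).val) = (b - a).val by omega] at this

/-- A polynomial of weight zero without constant term that is invariant under rotations of
neighbouring sites and local is a multiple of `∑ X i * λ i`. -/
lemma eq_smul_sum_of_rotInv {p : SymPoly (Site L)} {d : ℕ} (hd : p.IsHomogeneous d) (hd0 : d ≠ 0)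
    (hw : wt p = 0) (hL : 1 < L) (hr : ∀ i, RotInv p i (i + 1)) {n : ℕ}
    (hn : 0 < n) (hnL : n < L) (h : ∀ a : Site L, MixedZero p a (a + n)) :
    ∃ r : ℂ, p = r • ∑ i, X (Sum.inl i) * X (Sum.inr i) := by
  classical
  have hmix : ∀ {a b : Site L}, a ≠ b → MixedZero p a b :=
    fun hab => mixedZero_of_ne hL hr hn hnL h hab
  have hadj : ∀ i : Site L, pderiv (Sum.inl (i + 1)) (pderiv (Sum.inr (i + 1)) p) =
      pderiv (Sum.inl i) (pderiv (Sum.inr i) p) := fun i =>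
    (hr i).pderiv_pderiv_eq (FermionRep.site_ne_add_one hL i)
      (hmix (FermionRep.site_ne_add_one hL i).symm)
  set q := pderiv (Sum.inl (0 : Site L)) (pderiv (Sum.inr (0 : Site L)) p) with hq
  have hall : ∀ i : Site L, pderiv (Sum.inl i) (pderiv (Sum.inr i) p) = q := by
    intro i
    rw [← ZMod.natCast_zmod_val i]
    induction i.val with
    | zero => simp [hq]
    | succ k ih => push_cast; rw [hadj, ih]
  -- The value `q` is the same at every site. To differentiate at `a`, it is computed at `a + 1`,
  -- where mixed derivatives vanish.
  have hconst : ∀ y, pderiv y q = 0 := by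
    intro y
    obtain ⟨a, z, hz, rfl⟩ : ∃ a, ∃ z : Site L → Site L ⊕ Site L,
        (z = Sum.inl ∨ z = Sum.inr) ∧ y = z a := by
      rcases y with a | a
      · exact ⟨a, Sum.inl, Or.inl rfl, rfl⟩
      · exact ⟨a, Sum.inr, Or.inr rfl, rfl⟩
    rw [← hall (a + 1), pderiv_pderiv_comm,
      hmix (FermionRep.site_ne_add_one hL a) z Sum.inr hz (Or.inr rfl), map_zero]
  obtain ⟨r, hrq⟩ : ∃ r, q = C r := ⟨_, eq_C_of_pderiv_eq_zero hconst⟩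
  have hder : ∀ a b, pderiv (Sum.inl a) (pderiv (Sum.inr b) p) = if a = b then C r else 0 := by
    intro a b
    split_ifs with hab
    · rw [hab, hall, hrq]
    · exact hmix hab _ _ (Or.inl rfl) (Or.inr rfl)
  refine ⟨r, ?_⟩
  ext M
  have hsum : coeff M (r • ∑ i : Site L, X (Sum.inl i) * X (Sum.inr i) : SymPoly (Site L)) =
      r * ∑ i : Site L, if Finsupp.single (Sum.inl i) 1 + Finsupp.single (Sum.inr i) 1 = M
        then 1 else 0 := by
    rw [coeff_smul, coeff_sum, smul_eq_mul]
    congr 1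
    refine Finset.sum_congr rfl fun i _ => ?_
    rw [X, X, monomial_mul, coeff_monomial, mul_one]
  rw [hsum]
  -- A monomial containing some `X a` and some `λ b` is read off from `∂X_a ∂λ_b p`. Weight zero and
  -- positive degree exclude all others.
  by_cases hM : ∃ a b, M (Sum.inl a) ≠ 0 ∧ M (Sum.inr b) ≠ 0
  · obtain ⟨a, b, ha, hb⟩ := hM
    have hle : Finsupp.single (Sum.inl a) 1 + Finsupp.single (Sum.inr b) 1 ≤ M := by
      intro y
      rcases y with y | y <;>
        simp only [Finsupp.add_apply, Finsupp.single_apply, Sum.inl.injEq, Sum.inr.injEq,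
          reduceCtorEq, if_false, add_zero, zero_add]
      · split_ifs with h
        · subst h; omega
        · omega
      · split_ifs with h
        · subst h; omega
        · omega
    obtain ⟨M', rfl⟩ := exists_add_of_le hle
    have h1 := congrArg (coeff M') (hder a b)
    have hc1 : ∀ k : ℕ, (k : ℂ) + 1 ≠ 0 := Nat.cast_add_one_ne_zero
    rw [coeff_pderiv, coeff_pderiv] at h1
    have e : M' + Finsupp.single (Sum.inl a) 1 + Finsupp.single (Sum.inr b) 1 =
      Finsupp.single (Sum.inl a) 1 + Finsupp.single (Sum.inr b) 1 + M' := by abel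
    rw [e] at h1
    by_cases h0 : M' = 0 ∧ a = b
    · obtain ⟨rfl, rfl⟩ := h0
      rw [if_pos rfl, coeff_C, if_pos rfl] at h1
      rw [Finset.sum_eq_single a, if_pos (by simp)]
      · simpa using h1
      · intro i _ hi
        rw [if_neg]
        intro h2
        have := DFunLike.congr_fun h2 (Sum.inl i)
        simp [hi] at this
      · simp
    · rw [Finset.sum_eq_zero, mul_zero]
      · have : (coeff M' (if a = b then C r else 0) : ℂ) = 0 := by
          split_ifs with hab
          · rw [coeff_C, if_neg]
            exact fun h2 => h0 ⟨h2.symm, hab⟩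
          · exact coeff_zero _
        rw [this, mul_eq_zero, mul_eq_zero] at h1
        exact (h1.resolve_right (hc1 _)).resolve_right (hc1 _)
      · intro i _
        rw [if_neg]
        intro h2
        apply h0
        have h3 := DFunLike.congr_fun h2 (Sum.inl a)
        have h4 := DFunLike.congr_fun h2 (Sum.inr b)
        simp only [Finsupp.add_apply, Finsupp.single_apply, Sum.inl.injEq, Sum.inr.injEq,
          reduceCtorEq, if_false, add_zero, zero_add, if_true] at h3 h4
        have ha' : i = a := by by_contra h; rw [if_neg h] at h3; omega
        have hb' : i = b := by by_contra h; rw [if_neg h] at h4; omega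
        subst ha'
        subst hb'
        exact ⟨by simpa using h2, rfl⟩
  · push Not at hM
    have hz : coeff M p = 0 := by
      by_contra hne
      obtain ⟨h1, h2⟩ := two_mul_sum_of_wt hd hw hne
      obtain ⟨a, _, ha⟩ : ∃ a ∈ Finset.univ, M (Sum.inl a) ≠ 0 :=
        Finset.exists_ne_zero_of_sum_ne_zero (by omega)
      have : ∑ i, M (Sum.inr i) = 0 := Finset.sum_eq_zero fun b _ => hM a b ha
      omega
    rw [hz, Finset.sum_eq_zero, mul_zero]
    intro i _
    rw [if_neg]
    rintro rfl
    exact absurd (hM i i (by simp)) (by simp)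

end Ring

end HolsteinHubbard

namespace HolsteinHubbard

open MvPolynomial

/-! ### Normal ordering -/

/-- Operators satisfying the canonical commutation relations. -/
structure WeylRep (ι W : Type*) [DecidableEq ι] [Ring W] where
  /-- creation operators -/
  bd : ι → W
  /-- annihilation operators -/
  b : ι → W
  bd_comm : ∀ i j, bd i * bd j = bd j * bd i
  b_comm : ∀ i j, b i * b j = b j * b i
  ccr : ∀ i j, b i * bd j = bd j * b i + if i = j then 1 else 0

namespace WeylRep

variable {ι W : Type*} [DecidableEq ι] [Ring W] [Algebra ℂ W] (B : WeylRep ι W)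

/-- Left multiplication by creation and right multiplication by annihilation operators. -/
def gen : ι ⊕ ι → Module.End ℂ W :=
  Sum.elim (fun i => LinearMap.mulLeft ℂ (B.bd i)) (fun i => LinearMap.mulRight ℂ (B.b i))

lemma gen_comm (x y : ι ⊕ ι) : B.gen x * B.gen y = B.gen y * B.gen x := by
  refine LinearMap.ext fun w => ?_
  rcases x with i | i <;> rcases y with j | j <;> simp only [gen, Sum.elim_inl, Sum.elim_inr,
    Module.End.mul_apply, LinearMap.mulLeft_apply, LinearMap.mulRight_apply]
  · rw [← mul_assoc, B.bd_comm, mul_assoc]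
  · rw [mul_assoc]
  · rw [mul_assoc]
  · rw [mul_assoc, B.b_comm, mul_assoc]

/-- Left multiplications by creation operators and right multiplications by annihilation operators
all commute, so the polynomial ring acts on `W`; normal ordering is this action on `1`. -/
lemma exists_normalOrder : ∃ ν : SymPoly ι →ₗ[ℂ] W, ν 1 = 1 ∧
    (∀ i p, ν (X (Sum.inl i) * p) = B.bd i * ν p) ∧
    (∀ i p, ν (X (Sum.inr i) * p) = ν p * B.b i) := by
  have hcomm : ∀ a ∈ Set.range B.gen, ∀ c ∈ Set.range B.gen, a * c = c * a := by
    rintro _ ⟨x, rfl⟩ _ ⟨y, rfl⟩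
    exact B.gen_comm x y
  have hmul := Algebra.isMulCommutative_adjoin ℂ hcomm
  let _ : CommRing (Algebra.adjoin ℂ (Set.range B.gen)) :=
    { (inferInstance : Ring (Algebra.adjoin ℂ (Set.range B.gen))) with
      mul_comm := fun x y => hmul.is_comm.comm x y }
  let f : SymPoly ι →ₐ[ℂ] Algebra.adjoin ℂ (Set.range B.gen) :=
    aeval (R := ℂ) (S₁ := Algebra.adjoin ℂ (Set.range B.gen)) fun x => ⟨B.gen x, Algebra.subset_adjoin ⟨x, rfl⟩⟩
  let ν : SymPoly ι →ₗ[ℂ] W :=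
    (LinearMap.applyₗ (1 : W)) ∘ₗ (Algebra.adjoin ℂ (Set.range B.gen)).val.toLinearMap ∘ₗ
      f.toLinearMap
  have hν : ∀ p, ν p = (f p : Module.End ℂ W) 1 := fun p => rfl
  have hX : ∀ x p, ν (X x * p) = B.gen x (ν p) := fun x p => by
    rw [hν, hν, map_mul]
    simp only [f, aeval_X]
    rfl
  refine ⟨ν, ?_, fun i p => ?_, fun i p => ?_⟩
  · rw [hν, map_one f]; rfl
  · rw [hX]; rfl
  · rw [hX]; rfl

/-- The normal-ordered operator with a given symbol. -/
def nu : SymPoly ι →ₗ[ℂ] W := B.exists_normalOrder.choose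

lemma nu_one : B.nu 1 = 1 := B.exists_normalOrder.choose_spec.1

lemma nu_X_inl_mul (i : ι) (p : SymPoly ι) : B.nu (X (Sum.inl i) * p) = B.bd i * B.nu p :=
  B.exists_normalOrder.choose_spec.2.1 i p

lemma nu_X_inr_mul (i : ι) (p : SymPoly ι) : B.nu (X (Sum.inr i) * p) = B.nu p * B.b i :=
  B.exists_normalOrder.choose_spec.2.2 i p

lemma nu_C (a : ℂ) : B.nu (C a) = algebraMap ℂ W a := by
  rw [← mul_one (C a), ← smul_eq_C_mul, map_smul, nu_one, Algebra.algebraMap_eq_smul_one]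

lemma b_mul_nu (i : ι) (p : SymPoly ι) :
    B.b i * B.nu p = B.nu (X (Sum.inr i) * p + pderiv (Sum.inl i) p) := by
  induction p using MvPolynomial.induction_on with
  | C a => rw [pderiv_C, add_zero, nu_X_inr_mul, nu_C, Algebra.commutes]
  | add p q hp hq => simp only [map_add, mul_add, hp, hq]; abel
  | mul_X p x ih =>
    rw [map_add, nu_X_inr_mul] at ih ⊢
    rw [mul_comm p, pderiv_mul, map_add, pderiv_X, Pi.single_apply]
    rcases x with j | j
    · rw [nu_X_inl_mul, nu_X_inl_mul, ← mul_assoc, B.ccr, add_mul, mul_assoc, ih]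
      simp only [Sum.inl.injEq, eq_comm (a := j)]
      split_ifs <;> simp <;> noncomm_ring
    · rw [nu_X_inr_mul, nu_X_inr_mul, ← mul_assoc, ih, add_mul, mul_assoc, B.b_comm]
      simp [mul_assoc]

lemma nu_mul_bd (i : ι) (p : SymPoly ι) :
    B.nu p * B.bd i = B.nu (X (Sum.inl i) * p + pderiv (Sum.inr i) p) := by
  induction p using MvPolynomial.induction_on with
  | C a => rw [pderiv_C, add_zero, nu_X_inl_mul, nu_C, Algebra.commutes]
  | add p q hp hq => simp only [map_add, mul_add, add_mul, hp, hq]; abel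
  | mul_X p x ih =>
    rw [map_add, nu_X_inl_mul] at ih ⊢
    rw [mul_comm p, pderiv_mul, map_add, pderiv_X, Pi.single_apply]
    rcases x with j | j
    · rw [nu_X_inl_mul, nu_X_inl_mul, mul_assoc, ih, mul_add, ← mul_assoc, B.bd_comm]
      simp [mul_assoc]
    · rw [nu_X_inr_mul, nu_X_inr_mul, mul_assoc, B.ccr, mul_add, ← mul_assoc, ih]
      simp only [Sum.inr.injEq]
      split_ifs <;> simp <;> noncomm_ring

/-- The commutation relations turn commutators with phonon operators into partial derivatives of the
symbol. So the kernel is stable under derivatives, and induction on the degree reduces it to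
constants. -/
lemma nu_injective [Nontrivial W] : Function.Injective B.nu := by
  rw [injective_iff_map_eq_zero]
  have key : ∀ n, ∀ p : SymPoly ι, p.totalDegree < n → B.nu p = 0 → p = 0 := by
    intro n
    induction n with
    | zero => exact fun p hp => absurd hp (Nat.not_lt_zero _)
    | succ n ih =>
      intro p hp h
      have hder : ∀ x, B.nu (pderiv x p) = 0 := by
        rintro (i | i)
        · have := B.b_mul_nu i p
          rwa [map_add, nu_X_inr_mul, h, mul_zero, zero_mul, zero_add, eq_comm] at this
        · have := B.nu_mul_bd i p
          rwa [map_add, nu_X_inl_mul, h, mul_zero, zero_mul, zero_add, eq_comm] at this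
      have hd : ∀ x, pderiv x p = 0 := by
        intro x
        by_contra hne
        refine hne (ih _ ?_ (hder x))
        obtain ⟨M, hM, hMd⟩ := (pderiv x p).support.exists_mem_eq_sup
          (support_nonempty.mpr hne) fun M => M.sum fun _ e => e
        have h1 : (pderiv x p).totalDegree = M.degree := hMd
        have h2 : coeff (M + Finsupp.single x 1) p ≠ 0 := by
          rw [mem_support_iff, coeff_pderiv] at hM
          exact left_ne_zero_of_mul hM
        have h3 : (M + Finsupp.single x 1).degree ≤ p.totalDegree :=
          le_totalDegree (mem_support_iff.mpr h2)
        rw [map_add, Finsupp.degree_single] at h3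
        omega
      rw [eq_C_of_pderiv_eq_zero hd] at h ⊢
      rw [nu_C] at h
      rw [(map_eq_zero_iff _ (algebraMap ℂ W).injective).mp h, map_zero]
  exact fun p => key _ p (Nat.lt_succ_self _)

end WeylRep

end HolsteinHubbard

namespace HolsteinHubbard

open MvPolynomial Matrix

/-! ### Matrix-valued symbols -/

/-- The part of degree `n - 1` of a polynomial (zero for `n = 0`). -/
def prevComponent {σ : Type*} (n : ℕ) (p : MvPolynomial σ ℂ) : MvPolynomial σ ℂ :=
  if n = 0 then 0 else homogeneousComponent (n - 1) p

lemma homogeneousComponent_X_mul {σ : Type*} (n : ℕ) (j : σ) (p : MvPolynomial σ ℂ) :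
    homogeneousComponent n (X j * p) = X j * prevComponent n p := by
  rcases n with _ | n
  · rw [homogeneousComponent_zero_X_mul]; simp [prevComponent]
  · simp [prevComponent, homogeneousComponent_succ_X_mul]

section Symbols

variable {L : ℕ} [NeZero L] {Cfg : Type*} [Fintype Cfg] [DecidableEq Cfg]
  (R : FermionRep (Site L × Spin) Cfg)

/-- The hopping matrix, with entries regarded as constant polynomials. -/
def hopSym : Matrix Cfg Cfg (SymPoly (Site L)) := R.hop.map C

lemma lie_hopSym_apply (q : Matrix Cfg Cfg (SymPoly (Site L))) (S S' : Cfg) :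
    ⁅hopSym R, q⁆ S S' = ∑ S'', (R.hop S S'' • q S'' S' - R.hop S'' S' • q S S'') := by
  rw [Ring.lie_def, Matrix.sub_apply, Matrix.mul_apply, Matrix.mul_apply, Finset.sum_sub_distrib]
  congr 1
  · exact Finset.sum_congr rfl fun _ _ => by rw [hopSym, Matrix.map_apply, smul_eq_C_mul]
  · exact Finset.sum_congr rfl fun _ _ => by
      rw [hopSym, Matrix.map_apply, smul_eq_C_mul, mul_comm]

/-- The change of the number of electrons at each site. -/
def charge (S S' : Cfg) (i : Site L) : ℂ := (R.occ S i : ℂ) - R.occ S' i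

/-- The Coulomb energy of a configuration. -/
def coul (S : Cfg) : ℂ := ∑ i, ((R.occ S i : ℂ) ^ 2 - R.occ S i)

/-- The linear form `∑ δ_i (X i + λ i)`. -/
def linForm (δ : Site L → ℂ) : SymPoly (Site L) :=
  ∑ i, δ i • (X (Sum.inl i) + X (Sum.inr i))

/-- The vanishing of the commutator with the Hamiltonian, in terms of symbols. -/
def SymEq (t g ω U : ℂ) (q : Matrix Cfg Cfg (SymPoly (Site L))) : Prop :=
  ∀ S S', t • ⁅hopSym R, q⁆ S S' + (U * (coul R S - coul R S')) • q S S' + ω • wt (q S S') +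
    g • (linForm (charge R S S') * q S S' + ∑ i, ((R.occ S i : ℂ) • pderiv (Sum.inl i) (q S S') -
      (R.occ S' i : ℂ) • pderiv (Sum.inr i) (q S S'))) = 0

lemma linForm_ne_zero {δ : Site L → ℂ} (h : δ ≠ 0) : linForm δ ≠ 0 := by
  intro h0
  refine h (funext fun i => ?_)
  simpa [linForm, coeff_sum, coeff_smul, coeff_X, Finsupp.single_left_inj] using
    congrArg (coeff (Finsupp.single (Sum.inl i) 1)) h0

lemma linForm_zero : linForm (0 : Site L → ℂ) = 0 := by simp [linForm]

lemma homogeneousComponent_linForm_mul (n : ℕ) (δ : Site L → ℂ) (p : SymPoly (Site L)) :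
    homogeneousComponent n (linForm δ * p) = linForm δ * prevComponent n p := by
  simp only [linForm, Finset.sum_mul, smul_mul_assoc, add_mul, map_sum, map_smul, map_add,
    homogeneousComponent_X_mul]

variable {R}

omit [NeZero L] in
lemma occ_eq_of_charge_eq_zero {S S' : Cfg} (h : charge R S S' = 0) (i : Site L) :
    R.occ S i = R.occ S' i := by
  have := congrFun h i
  rw [charge, Pi.zero_apply, sub_eq_zero] at this
  exact_mod_cast this

omit [NeZero L] in
lemma charge_eq_zero_iff {S S' : Cfg} : charge R S S' = 0 ↔ ∀ i, R.occ S i = R.occ S' i :=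
  ⟨occ_eq_of_charge_eq_zero, fun h => funext fun i => by simp [charge, h i]⟩

lemma coul_eq_of_charge_eq_zero {S S' : Cfg} (h : charge R S S' = 0) : coul R S = coul R S' := by
  simp only [coul, occ_eq_of_charge_eq_zero h]

lemma hop_apply_eq_zero (hL : 1 < L) {S S' : Cfg} (h : charge R S S' = 0) : R.hop S S' = 0 := by
  rw [FermionRep.hop, Matrix.sum_apply]
  refine Finset.sum_eq_zero fun i _ => ?_
  have hne := FermionRep.site_ne_add_one hL i
  have h0 : (R.occ S i : ℂ) - R.occ S' i = 0 := by simp [occ_eq_of_charge_eq_zero h]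
  have h1 : R.E i (i + 1) S S' = 0 := by
    by_contra hne0
    have := R.occ_sub_of_E_apply_ne_zero hne0 i
    rw [h0, if_pos rfl, if_neg hne] at this
    norm_num at this
  have h2 : R.E (i + 1) i S S' = 0 := by
    by_contra hne0
    have := R.occ_sub_of_E_apply_ne_zero hne0 i
    rw [h0, if_pos rfl, if_neg hne] at this
    norm_num at this
  rw [Matrix.add_apply, h1, h2, add_zero]

lemma SymEq.component {t g ω U : ℂ} {q : Matrix Cfg Cfg (SymPoly (Site L))}
    (h : SymEq R t g ω U q) (n : ℕ) (S S' : Cfg) :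
    t • ⁅hopSym R, q.map (homogeneousComponent n)⁆ S S' +
      (U * (coul R S - coul R S')) • homogeneousComponent n (q S S') +
      ω • wt (homogeneousComponent n (q S S')) +
      g • (linForm (charge R S S') * prevComponent n (q S S') +
        ∑ i, ((R.occ S i : ℂ) • pderiv (Sum.inl i) (homogeneousComponent (n + 1) (q S S')) -
          (R.occ S' i : ℂ) • pderiv (Sum.inr i) (homogeneousComponent (n + 1) (q S S')))) = 0 := by
  have := congrArg (homogeneousComponent n) (h S S')
  rw [map_zero] at this
  rw [← this]
  simp only [map_add, map_smul, map_sum, map_sub, homogeneousComponent_linForm_mul,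
    homogeneousComponent_pderiv, homogeneousComponent_wt, lie_hopSym_apply, Matrix.map_apply]

/-- A nonzero entry of the hopping always changes some occupation, so its product with a
charge-preserving matrix does too. -/
lemma lie_hop_eq_zero (hL : 1 < L) {q : Matrix Cfg Cfg (SymPoly (Site L))}
    (hq : ∀ S S', charge R S S' ≠ 0 → q S S' = 0) {S S' : Cfg} (h : charge R S S' = 0) :
    ⁅hopSym R, q⁆ S S' = 0 := by
  rw [lie_hopSym_apply]
  refine Finset.sum_eq_zero fun S'' _ => ?_
  have h1 : R.hop S S'' • q S'' S' = 0 := by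
    by_cases h2 : charge R S'' S' = 0
    · rw [hop_apply_eq_zero hL, zero_smul]
      rw [charge_eq_zero_iff] at *
      exact fun i => (h i).trans (h2 i).symm
    · rw [hq _ _ h2, smul_zero]
  have h3 : R.hop S'' S' • q S S'' = 0 := by
    by_cases h2 : charge R S S'' = 0
    · rw [hop_apply_eq_zero hL, zero_smul]
      rw [charge_eq_zero_iff] at *
      exact fun i => (h2 i).symm.trans (h i)
    · rw [hq _ _ h2, smul_zero]
  rw [h1, h3, sub_zero]

/-! ### Consequences of the symbol equation for the highest-degree part. -/

section Top

variable {t g ω U : ℂ} {q : Matrix Cfg Cfg (SymPoly (Site L))} {d : ℕ}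

/-- In degree `d + 1` only the product of the linear form with the top part is left. -/
lemma SymEq.top_eq_zero_of_charge (h : SymEq R t g ω U q) (hg : g ≠ 0)
    (hd : ∀ n, d < n → ∀ S S', homogeneousComponent n (q S S') = 0) {S S' : Cfg}
    (hc : charge R S S' ≠ 0) : homogeneousComponent d (q S S') = 0 := by
  have h1 := h.component (d + 1) S S'
  have hz : q.map (homogeneousComponent (d + 1)) = 0 := by
    ext1 S S'; exact hd _ (Nat.lt_succ_self d) S S'
  have hz2 : ∀ S S', homogeneousComponent (d + 1) (q S S') = 0 := hd _ (Nat.lt_succ_self d)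
  have hz3 : ∀ S S', homogeneousComponent (d + 1 + 1) (q S S') = 0 := hd _ (by omega)
  rw [hz, lie_hopSym_apply] at h1
  simp only [hz2, hz3, map_zero, smul_zero, sub_zero, Finset.sum_const_zero, add_zero, zero_add,
    Matrix.zero_apply, prevComponent, Nat.succ_ne_zero, if_false, Nat.add_sub_cancel] at h1
  rw [smul_eq_zero, or_iff_right hg, mul_eq_zero] at h1
  exact h1.resolve_left (linForm_ne_zero hc)

/-- At a charge-preserving entry in degree `d`, the hopping, the linear form and the Coulomb
difference all drop out, and `ω` times the weight remains. -/
lemma SymEq.top_wt (h : SymEq R t g ω U q) (hL : 1 < L) (hg : g ≠ 0) (hω : ω ≠ 0)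
    (hd : ∀ n, d < n → ∀ S S', homogeneousComponent n (q S S') = 0) (S S' : Cfg) :
    wt (homogeneousComponent d (q S S')) = 0 := by
  by_cases hc : charge R S S' = 0
  · have h1 := h.component d S S'
    have hz2 : ∀ S S', homogeneousComponent (d + 1) (q S S') = 0 := hd _ (Nat.lt_succ_self d)
    rw [lie_hop_eq_zero hL (q := q.map (homogeneousComponent d))
      (fun S S' hc => h.top_eq_zero_of_charge hg hd hc) hc, hc, linForm_zero,
      coul_eq_of_charge_eq_zero hc] at h1
    simpa [hz2, hω] using h1
  · rw [h.top_eq_zero_of_charge hg hd hc, map_zero]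

/-- At a charge-changing entry in degree `d`, the equation reads `t ⁅hop, q_d⁆ = -g · linForm ·
q_{d-1}`. The left side has weight zero, and the linear form divides no nonzero polynomial of weight
zero. -/
lemma SymEq.top_lie_hop (h : SymEq R t g ω U q) (hL : 1 < L) (ht : t ≠ 0) (hg : g ≠ 0)
    (hω : ω ≠ 0) (hd : ∀ n, d < n → ∀ S S', homogeneousComponent n (q S S') = 0) :
    ⁅hopSym R, q.map (homogeneousComponent d)⁆ = 0 := by
  ext1 S S'
  rw [Matrix.zero_apply]
  by_cases hc : charge R S S' = 0
  · exact lie_hop_eq_zero hL (fun S S' hc => h.top_eq_zero_of_charge hg hd hc) hc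
  · have h1 := h.component d S S'
    have hz2 : ∀ S S', homogeneousComponent (d + 1) (q S S') = 0 := hd _ (Nat.lt_succ_self d)
    simp only [h.top_eq_zero_of_charge hg hd hc, hz2, map_zero, smul_zero, sub_zero,
      Finset.sum_const_zero, add_zero] at h1
    have hexp : ⁅hopSym R, q.map (homogeneousComponent d)⁆ S S' =
        ∑ S'', (R.hop S S'' • homogeneousComponent d (q S'' S') -
          R.hop S'' S' • homogeneousComponent d (q S S'')) := lie_hopSym_apply _ _ _ _
    refine eq_zero_of_wt_of_dvd (d := d) (h := -(g / t) • prevComponent d (q S S')) hc ?_ ?_ ?_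
    · rw [hexp]
      refine IsHomogeneous.sum _ _ _ fun S'' _ => ?_
      have hs : ∀ (r : ℂ) (p : SymPoly (Site L)),
          r • homogeneousComponent d p ∈ homogeneousSubmodule (Site L ⊕ Site L) ℂ d := fun r p =>
        Submodule.smul_mem _ _ (homogeneousComponent_isHomogeneous d p)
      exact Submodule.sub_mem _ (hs _ _) (hs _ _)
    · rw [hexp, map_sum]
      refine Finset.sum_eq_zero fun S'' _ => ?_
      rw [map_sub, map_smul, map_smul, h.top_wt hL hg hω hd, h.top_wt hL hg hω hd, smul_zero,
        smul_zero, sub_zero]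
    · change _ = linForm _ * _
      have h2 : linForm (charge R S S') * (-(g / t) • prevComponent d (q S S')) =
          -(t⁻¹ • (g • (linForm (charge R S S') * prevComponent d (q S S')))) := by
        rw [mul_smul_comm, neg_smul, smul_smul, div_eq_inv_mul]
      rw [h2, ← smul_neg, ← eq_neg_of_add_eq_zero_left h1, smul_smul, inv_mul_cancel₀ ht, one_smul]

lemma SymEq.prev_eq_zero_of_charge (h : SymEq R t g ω U q) (hL : 1 < L) (ht : t ≠ 0) (hg : g ≠ 0)
    (hω : ω ≠ 0) (hd : ∀ n, d < n → ∀ S S', homogeneousComponent n (q S S') = 0) {S S' : Cfg}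
    (hc : charge R S S' ≠ 0) : prevComponent d (q S S') = 0 := by
  have h1 := h.component d S S'
  have hz2 : ∀ S S', homogeneousComponent (d + 1) (q S S') = 0 := hd _ (Nat.lt_succ_self d)
  rw [h.top_lie_hop hL ht hg hω hd] at h1
  simp only [h.top_eq_zero_of_charge hg hd hc, hz2, map_zero, smul_zero, sub_zero,
    Finset.sum_const_zero, add_zero, Matrix.zero_apply, zero_add] at h1
  rw [smul_eq_zero, or_iff_right hg, mul_eq_zero] at h1
  exact h1.resolve_left (linForm_ne_zero hc)

lemma commute_E_of_charge {X : Matrix Cfg Cfg ℂ} (hX : ∀ S S', charge R S S' ≠ 0 → X S S' = 0)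
    (i : Site L) : Commute (R.E i i) X := by
  rw [commute_iff_lie_eq]
  ext S S'
  have := R.lie_E_self_apply i X S S'
  by_cases hc : charge R S S' = 0
  · refine this.trans ?_
    rw [occ_eq_of_charge_eq_zero hc, sub_self, zero_mul]; rfl
  · refine this.trans ?_
    rw [hX _ _ hc, mul_zero]; rfl

lemma commute_par_of_charge {X : Matrix Cfg Cfg ℂ} (hX : ∀ S S', charge R S S' ≠ 0 → X S S' = 0) :
    Commute R.par X := by
  rw [R.par_eq]
  ext S S'
  rw [diagonal_mul, mul_diagonal]
  by_cases hc : charge R S S' = 0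
  · simp only [occ_eq_of_charge_eq_zero hc, mul_comm]
  · rw [hX _ _ hc, mul_zero, zero_mul]

/-- The coefficient matrices of the top-degree part commute with all hopping bilinears. -/
lemma SymEq.top_commute (h : SymEq R t g ω U q) (hL : 1 < L) (ht : t ≠ 0) (hg : g ≠ 0)
    (hω : ω ≠ 0) (hd : ∀ n, d < n → ∀ S S', homogeneousComponent n (q S S') = 0)
    {M : Site L ⊕ Site L →₀ ℕ} (hM : M.degree = d) (i j : Site L) :
    Commute (R.E i j) (q.map (coeff M)) := by
  have hcoeff : ∀ p : SymPoly (Site L), coeff M (homogeneousComponent d p) = coeff M p := fun p => by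
    rw [coeff_homogeneousComponent, if_pos hM]
  refine R.commute_E_of_commute_hop hL (commute_E_of_charge fun S S' hc => ?_) ?_ i j
  · rw [Matrix.map_apply, ← hcoeff, h.top_eq_zero_of_charge hg hd hc, coeff_zero]
  · rw [commute_iff_lie_eq]
    ext S S'
    have := congrArg (coeff M) (congrFun (congrFun (h.top_lie_hop hL ht hg hω hd) S) S')
    rw [lie_hopSym_apply, coeff_sum] at this
    simp only [coeff_sub, coeff_smul, Matrix.map_apply, hcoeff] at this
    rw [Finset.sum_sub_distrib] at this
    refine Eq.trans ?_ this
    rw [Ring.lie_def, Matrix.sub_apply, Matrix.mul_apply, Matrix.mul_apply]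
    simp only [Matrix.map_apply, smul_eq_mul, mul_comm]

end Top

end Symbols

end HolsteinHubbard

namespace HolsteinHubbard

open MvPolynomial Matrix

/-! ### Conserved symbols -/

section Weight

variable {ι : Type*} [Fintype ι]

lemma wt_pderiv_inl (i : ι) (p : SymPoly ι) :
    wt (pderiv (Sum.inl i) p) = pderiv (Sum.inl i) (wt p) - pderiv (Sum.inl i) p := by
  classical
  ext M
  rw [coeff_sub, coeff_wt, coeff_pderiv, coeff_pderiv, coeff_wt]
  simp only [Finsupp.add_apply, Finset.sum_add_distrib, Finsupp.single_apply, Sum.inl.injEq,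
    reduceCtorEq, if_false, Finset.sum_ite_eq, Finset.mem_univ, if_true, Finset.sum_const_zero]
  push_cast
  ring

lemma wt_pderiv_inr (i : ι) (p : SymPoly ι) :
    wt (pderiv (Sum.inr i) p) = pderiv (Sum.inr i) (wt p) + pderiv (Sum.inr i) p := by
  classical
  ext M
  rw [coeff_add, coeff_wt, coeff_pderiv, coeff_pderiv, coeff_wt]
  simp only [Finsupp.add_apply, Finset.sum_add_distrib, Finsupp.single_apply, Sum.inr.injEq,
    reduceCtorEq, if_false, Finset.sum_ite_eq, Finset.mem_univ, if_true, Finset.sum_const_zero]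
  push_cast
  ring

/-- The symbol of the number of phonons. -/
def phononSym (ι : Type*) [Fintype ι] : SymPoly ι := ∑ i, X (Sum.inl i) * X (Sum.inr i)

lemma isHomogeneous_phononSym : (phononSym ι).IsHomogeneous 2 :=
  IsHomogeneous.sum _ _ _ fun i _ => (isHomogeneous_X ℂ (Sum.inl i)).mul (isHomogeneous_X ℂ (Sum.inr i))

end Weight

namespace FermionRep

variable {L : ℕ} {Cfg : Type*} [Fintype Cfg] [DecidableEq Cfg] (R : FermionRep (Site L × Spin) Cfg)

/-- The graded commutator with a creation operator. -/
def skew (a : Site L × Spin) : Matrix Cfg Cfg ℂ →ₗ[ℂ] Matrix Cfg Cfg ℂ where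
  toFun Y := R.cr a * Y - R.par * Y * R.par * R.cr a
  map_add' Y Z := by noncomm_ring
  map_smul' r Y := by
    simp only [mul_smul_comm, smul_mul_assoc, smul_sub, RingHom.id_apply]

lemma skew_apply (a : Site L × Spin) (Y : Matrix Cfg Cfg ℂ) :
    R.skew a Y = R.cr a * Y - R.par * Y * R.par * R.cr a := rfl

lemma skew_eq_of_commute (a : Site L × Spin) {Y : Matrix Cfg Cfg ℂ} (h : Commute R.par Y) :
    R.skew a Y = R.cr a * Y - Y * R.cr a := by
  rw [skew_apply, h.eq, mul_assoc Y, R.par_par, mul_one]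

end FermionRep

section

variable {L : ℕ} [NeZero L] {Cfg : Type*} [Fintype Cfg] [DecidableEq Cfg]
  {R : FermionRep (Site L × Spin) Cfg}

/-- The consequences, for the symbol of an operator, of the absence of terms that act both on `a`
and on `a + n`. -/
structure PairLocal (R : FermionRep (Site L × Spin) Cfg) (n : ℕ)
    (q : Matrix Cfg Cfg (SymPoly (Site L))) : Prop where
  mixed : ∀ a S S', MixedZero (q S S') a (a + n)
  skew : ∀ a M σ, (M (Sum.inl a) ≠ 0 ∨ M (Sum.inr a) ≠ 0) →
    R.skew (a + n, σ) (q.map (coeff M)) = 0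
  skew_skew : ∀ a M σ τ, R.skew (a, σ) (R.skew (a + n, τ) (q.map (coeff M))) = 0

variable {t g ω U : ℂ} {q : Matrix Cfg Cfg (SymPoly (Site L))} {d n : ℕ}

/-- As `d ≠ 0`, each top monomial contains a phonon variable at some `a`. Locality then makes its
coefficient matrix commute with the creation operators at `a + n`, and a matrix that also commutes
with all `E i j` is scalar. -/
lemma SymEq.top_apply (h : SymEq R t g ω U q) (hq : PairLocal R n q) (hL : 1 < L) (ht : t ≠ 0)
    (hg : g ≠ 0) (hω : ω ≠ 0) (hd0 : d ≠ 0)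
    (hd : ∀ n, d < n → ∀ S S', homogeneousComponent n (q S S') = 0) :
    ∃ p, ∀ S S', homogeneousComponent d (q S S') = if S = S' then p else 0 := by
  have key : ∀ M : Site L ⊕ Site L →₀ ℕ, M.degree = d → ∃ α : ℂ,
      q.map (coeff M) = α • (1 : Matrix Cfg Cfg ℂ) := by
    intro M hM
    have hcoeff : ∀ p : SymPoly (Site L), coeff M (homogeneousComponent d p) = coeff M p :=
      fun p => by rw [coeff_homogeneousComponent, if_pos hM]
    obtain ⟨a, ha⟩ : ∃ a : Site L, M (Sum.inl a) ≠ 0 ∨ M (Sum.inr a) ≠ 0 := by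
      by_contra! h0
      refine hd0 ?_
      rw [← hM, degree_eq_add]
      simp [h0]
    have hpar : Commute R.par (q.map (coeff M)) := commute_par_of_charge fun S S' hc => by
      rw [Matrix.map_apply, ← hcoeff, h.top_eq_zero_of_charge hg hd hc, coeff_zero]
    refine R.eq_smul_one_of_commute (fun i j => h.top_commute hL ht hg hω hd hM i j) (a + n)
      fun σ => ?_
    have := hq.skew a M σ ha
    rw [R.skew_eq_of_commute _ hpar, sub_eq_zero] at this
    exact this
  rcases isEmpty_or_nonempty Cfg with hE | ⟨⟨S₀⟩⟩
  · exact ⟨0, fun S => hE.elim S⟩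
  · refine ⟨homogeneousComponent d (q S₀ S₀), fun S S' => ?_⟩
    ext M
    rw [coeff_homogeneousComponent, apply_ite (coeff M), coeff_homogeneousComponent, coeff_zero]
    by_cases hM : M.degree = d
    · obtain ⟨α, hα⟩ := key M hM
      have hα' : ∀ S S', coeff M (q S S') = α * (1 : Matrix Cfg Cfg ℂ) S S' := fun S S' =>
        congrFun (congrFun hα S) S'
      rw [if_pos hM, if_pos hM, hα', hα', one_apply_eq, one_apply]
      split_ifs <;> simp
    · simp [hM]

/-- The part of degree one below the top, at entries that do not move electrons. -/
lemma SymEq.component_eq_of_charge {e : ℕ} (h : SymEq R t g ω U q) (hL : 1 < L) (ht : t ≠ 0)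
    (hg : g ≠ 0) (hω : ω ≠ 0) (he : Odd e)
    (hd : ∀ n, e + 1 < n → ∀ S S', homogeneousComponent n (q S S') = 0) {S S' : Cfg}
    (hc : charge R S S' = 0) :
    homogeneousComponent e (q S S') = (g / ω) • ∑ i, (R.occ S i : ℂ) •
      (pderiv (Sum.inl i) (homogeneousComponent (e + 1) (q S S')) +
        pderiv (Sum.inr i) (homogeneousComponent (e + 1) (q S S'))) := by
  have h1 := h.component e S S'
  have hprev : ∀ S S', charge R S S' ≠ 0 → homogeneousComponent e (q S S') = 0 :=
    fun S S' hc => by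
      simpa [prevComponent] using h.prev_eq_zero_of_charge hL ht hg hω hd hc
  rw [lie_hop_eq_zero hL (q := q.map (homogeneousComponent e)) hprev hc, hc, linForm_zero,
    coul_eq_of_charge_eq_zero hc, sub_self, mul_zero, zero_smul, smul_zero, zero_mul, zero_add,
    zero_add, zero_add] at h1
  simp only [← occ_eq_of_charge_eq_zero hc] at h1
  rw [← sub_eq_zero]
  have hw := h.top_wt hL hg hω hd S S'
  -- In odd degree nothing nonzero has weight zero, so it suffices to compare weights. The
  -- derivatives in `X` and in `λ` shift the weight by `-1` and `+1`, which accounts for the plus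
  -- sign in the claim and the minus sign in the equation.
  refine eq_zero_of_wt_of_odd (d := e) ?_ ?_ he
  · refine (homogeneousComponent_isHomogeneous e _).sub ?_
    have hs : ∀ y, pderiv y (homogeneousComponent (e + 1) (q S S')) ∈
        homogeneousSubmodule (Site L ⊕ Site L) ℂ e := fun y =>
      (homogeneousComponent_isHomogeneous (e + 1) _).pderiv
    exact Submodule.smul_mem _ _ (Submodule.sum_mem _ fun i _ =>
      Submodule.smul_mem _ _ (Submodule.add_mem _ (hs _) (hs _)))
  · rw [map_sub, map_smul, map_sum]
    simp only [map_smul, map_add, wt_pderiv_inl, wt_pderiv_inr, hw, map_zero]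
    have h2 : wt (homogeneousComponent e (q S S')) = -((g / ω) • ∑ i, ((R.occ S i : ℂ) •
        pderiv (Sum.inl i) (homogeneousComponent (e + 1) (q S S')) - (R.occ S i : ℂ) •
        pderiv (Sum.inr i) (homogeneousComponent (e + 1) (q S S')))) := by
      rw [div_eq_inv_mul, mul_smul, ← smul_neg, ← eq_neg_of_add_eq_zero_left h1, smul_smul,
        inv_mul_cancel₀ hω, one_smul]
    rw [h2, ← smul_neg, ← Finset.sum_neg_distrib, ← smul_sub, ← Finset.sum_sub_distrib,
      Finset.sum_eq_zero, smul_zero]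
    intro i _
    rw [← smul_sub, ← smul_neg, ← smul_sub]
    rw [show ∀ x y : SymPoly (Site L), -(x - y) - (0 - x + (0 + y)) = 0 from fun x y => by ring,
      smul_zero]

lemma linForm_single_sub (i j : Site L) :
    linForm (fun m => (if m = i then (1 : ℂ) else 0) - if m = j then 1 else 0) =
      (X (Sum.inl i) - X (Sum.inl j)) + (X (Sum.inr i) - X (Sum.inr j)) := by
  simp only [linForm, sub_smul, ite_smul, one_smul, zero_smul, Finset.sum_sub_distrib,
    Finset.sum_ite_eq', Finset.mem_univ, if_true]
  ring

/-- Consider degree one below the top at an entry where an electron hops from `i + 1` to `i`. The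
hopping commutator is the difference of the explicit diagonal values at the two configurations, and
it must be divisible by `(X i - X (i+1)) + (λ i - λ (i+1))`. Separating `X`-degrees with
`mul_eq_mul_of_XDeg` gives the identity. -/
lemma SymEq.rotInv_top {m : ℕ} (h : SymEq R t g ω U q) (hL : 1 < L) (ht : t ≠ 0) (hg : g ≠ 0)
    (hω : ω ≠ 0) (hd : ∀ n, 2 * m + 1 + 1 < n → ∀ S S', homogeneousComponent n (q S S') = 0)
    {p : SymPoly (Site L)}
    (hp : ∀ S S', homogeneousComponent (2 * m + 1 + 1) (q S S') = if S = S' then p else 0)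
    (i : Site L) : RotInv p i (i + 1) := by
  obtain ⟨S, S', hhop, hocc⟩ := R.exists_hop_apply_ne_zero hL i
  have hne := FermionRep.site_ne_add_one hL i
  have hch : charge R S S' = fun m => (if m = i then (1 : ℂ) else 0) - if m = i + 1 then 1 else 0 :=
    funext hocc
  have hc : charge R S S' ≠ 0 := fun h0 => by
    have := congrFun (hch.symm.trans h0) i
    simp [hne] at this
  have hSS' : S ≠ S' := by
    rintro rfl
    exact hc (funext fun i => by simp [charge])
  have hphom : p.IsHomogeneous (2 * m + 1 + 1) := by
    have := homogeneousComponent_isHomogeneous (2 * m + 1 + 1) (q S S)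
    rwa [hp, if_pos rfl] at this
  have hpw : wt p = 0 := by
    have := h.top_wt hL hg hω hd S S
    rwa [hp, if_pos rfl] at this
  have hpX : XDeg (m + 1) p := fun M hM => by
    have := (two_mul_sum_of_wt hphom hpw hM).1
    omega
  have hlow : ∀ S₁ S₂, homogeneousComponent (2 * m + 1) (q S₁ S₂) = if S₁ = S₂ then
      (g / ω) • ∑ i, (R.occ S₁ i : ℂ) • (pderiv (Sum.inl i) p + pderiv (Sum.inr i) p) else 0 := by
    intro S₁ S₂
    by_cases hc : charge R S₁ S₂ = 0
    · rw [h.component_eq_of_charge hL ht hg hω ⟨m, rfl⟩ hd hc, hp]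
      split_ifs
      · rfl
      · simp
    · rw [if_neg]
      · simpa [prevComponent] using h.prev_eq_zero_of_charge hL ht hg hω hd hc
      · rintro rfl
        exact hc (funext fun i => by simp [charge])
  have h1 := h.component (2 * m + 1) S S'
  rw [hp, hlow, if_neg hSS', if_neg hSS', lie_hopSym_apply] at h1
  simp only [Matrix.map_apply, hlow, smul_ite, smul_zero, map_zero, sub_zero, add_zero,
    Finset.sum_const_zero, Finset.sum_sub_distrib, Finset.sum_ite_eq', Finset.sum_ite_eq,
    Finset.mem_univ, if_true] at h1
  rw [hch, linForm_single_sub] at h1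
  have h2 : ∑ j, (R.occ S j : ℂ) • (pderiv (Sum.inl j) p + pderiv (Sum.inr j) p) -
      ∑ j, (R.occ S' j : ℂ) • (pderiv (Sum.inl j) p + pderiv (Sum.inr j) p) =
      (pderiv (Sum.inl i) p - pderiv (Sum.inl (i + 1)) p) +
        (pderiv (Sum.inr i) p - pderiv (Sum.inr (i + 1)) p) := by
    have h3 : ∀ w : Site L → SymPoly (Site L), ∑ j, ((R.occ S j : ℂ) • w j - (R.occ S' j : ℂ) • w j) =
        w i - w (i + 1) := fun w => by
      simp only [← sub_smul, hocc]
      simp only [sub_smul, ite_smul, one_smul, zero_smul, Finset.sum_sub_distrib,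
        Finset.sum_ite_eq', Finset.mem_univ, if_true]
    rw [← Finset.sum_sub_distrib, h3]
    ring
  have hX : ∀ j, XDeg 1 (X (Sum.inl j) : SymPoly (Site L)) ∧
      XDeg 0 (X (Sum.inr j) : SymPoly (Site L)) := fun j => by
    constructor <;> intro M hM <;> rw [coeff_X, ne_eq, ite_eq_right_iff, Classical.not_imp] at hM <;>
      simp [← hM.1, Finsupp.single_apply]
  refine mul_eq_mul_of_XDeg (m := m) (h := (ω / (t * R.hop S S')) •
      prevComponent (2 * m + 1) (q S S')) ?_ ?_ ?_ ?_ ?_ ?_ ?_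
  · rw [sub_eq_add_neg, ← neg_one_smul ℂ]
    exact (hX i).1.add ((hX _).1.smul _)
  · rw [sub_eq_add_neg, ← neg_one_smul ℂ]
    exact (hX i).2.add ((hX _).2.smul _)
  · rw [sub_ne_zero, (X_injective (R := ℂ)).ne_iff]
    simpa using hne
  · rw [sub_ne_zero, (X_injective (R := ℂ)).ne_iff]
    simpa using hne
  · rw [sub_eq_add_neg, ← neg_one_smul ℂ (pderiv _ _)]
    exact (hpX.pderiv_inl _).add ((hpX.pderiv_inl _).smul _)
  · rw [sub_eq_add_neg, ← neg_one_smul ℂ (pderiv _ _)]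
    exact (hpX.pderiv_inr _).add ((hpX.pderiv_inr _).smul _)
  · rw [← h2, mul_smul_comm]
    refine smul_right_injective _ (r := t * R.hop S S' * (g / ω))
      (mul_ne_zero (mul_ne_zero ht hhop) (div_ne_zero hg hω)) ?_
    simp only [smul_smul]
    rw [show t * R.hop S S' * (g / ω) * (ω / (t * R.hop S S')) = g by field_simp]
    refine sub_eq_zero.mp (Eq.trans ?_ (neg_eq_zero.mpr h1))
    module

lemma SymEq.exists_top (h : SymEq R t g ω U q) (hq : PairLocal R n q) (hL : 1 < L) (hn : 0 < n)
    (hnL : n < L) (ht : t ≠ 0) (hg : g ≠ 0) (hω : ω ≠ 0) (hd0 : d ≠ 0)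
    (hd : ∀ n, d < n → ∀ S S', homogeneousComponent n (q S S') = 0) :
    ∃ r : ℂ, ∀ S S', homogeneousComponent d (q S S') =
      if S = S' then r • phononSym (Site L) else 0 := by
  obtain ⟨p, hp⟩ := h.top_apply hq hL ht hg hω hd0 hd
  rcases isEmpty_or_nonempty Cfg with hE | ⟨⟨S⟩⟩
  · exact ⟨0, fun S => hE.elim S⟩
  suffices ∃ r : ℂ, p = r • phononSym (Site L) by
    obtain ⟨r, rfl⟩ := this
    exact ⟨r, hp⟩
  have hpS : homogeneousComponent d (q S S) = p := by rw [hp, if_pos rfl]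
  have hphom : p.IsHomogeneous d := hpS ▸ homogeneousComponent_isHomogeneous d (q S S)
  have hpw : wt p = 0 := hpS ▸ h.top_wt hL hg hω hd S S
  rcases Nat.even_or_odd d with he | ho
  · obtain ⟨m, rfl⟩ : ∃ m, d = 2 * m + 1 + 1 := by
      obtain ⟨k, rfl⟩ := he
      exact ⟨k - 1, by omega⟩
    refine eq_smul_sum_of_rotInv hphom hd0 hpw hL (h.rotInv_top hL ht hg hω hd hp) hn hnL
      fun a z z' hz hz' => ?_
    rw [← hpS, ← homogeneousComponent_pderiv, ← homogeneousComponent_pderiv,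
      hq.mixed a S S z z' hz hz', map_zero]
  · exact ⟨0, by rw [zero_smul]; exact eq_zero_of_wt_of_odd hphom hpw ho⟩

/-- The symbol of a conserved quantity has degree at most two, with a scalar top part. -/
lemma SymEq.exists_homogeneousComponent_two (h : SymEq R t g ω U q) (hq : PairLocal R n q)
    (hL : 1 < L) (hn : 0 < n) (hnL : n < L) (ht : t ≠ 0) (hg : g ≠ 0) (hω : ω ≠ 0) :
    (∀ n, 2 < n → ∀ S S', homogeneousComponent n (q S S') = 0) ∧
    ∃ r : ℂ, ∀ S S', homogeneousComponent 2 (q S S') =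
      if S = S' then r • phononSym (Site L) else 0 := by
  -- Descent from a bound on all degrees: a top part of degree above two would be a multiple of a
  -- quadratic polynomial, hence zero.
  have key : ∀ D, (∀ n, 2 + D < n → ∀ S S', homogeneousComponent n (q S S') = 0) →
      ∀ n, 2 < n → ∀ S S', homogeneousComponent n (q S S') = 0 := by
    intro D
    induction D with
    | zero => exact fun h => h
    | succ D ih =>
      refine fun hD => ih fun n hn' S S' => ?_
      rcases (show 2 + D + 1 ≤ n from hn').eq_or_lt with rfl | h1
      · obtain ⟨r, hr⟩ := h.exists_top hq hL hn hnL ht hg hω (Nat.succ_ne_zero _) hD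
        have h2 := homogeneousComponent_of_mem (n := 2) (m := 2 + D + 1)
          (isHomogeneous_phononSym (ι := Site L))
        rw [if_neg (by omega)] at h2
        have h3 : homogeneousComponent (2 + D + 1) (q S S') = _ := hr S S'
        have h4 := homogeneousComponent_of_mem (m := 2 + D + 1)
          (homogeneousComponent_isHomogeneous (2 + D + 1) (q S S'))
        rw [if_pos rfl] at h4
        rw [← h4, h3]
        split_ifs
        · rw [map_smul, h2, smul_zero]
        · rw [map_zero]
      · exact hD n h1 S S'
  have h0 := key (∑ S, ∑ S', (q S S').totalDegree) fun n hn S S' => by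
    refine homogeneousComponent_eq_zero _ _ (lt_of_le_of_lt ?_ hn)
    refine le_trans ?_ (Nat.le_add_left _ _)
    exact (Finset.single_le_sum (f := fun S' => (q S S').totalDegree) (fun _ _ => Nat.zero_le _)
      (Finset.mem_univ S')).trans (Finset.single_le_sum
        (f := fun S => ∑ S', (q S S').totalDegree) (fun _ _ => Nat.zero_le _) (Finset.mem_univ S))
  exact ⟨h0, h.exists_top hq hL hn hnL ht hg hω two_ne_zero h0⟩

/-- Conserved symbols of degree at most one are constant. -/
lemma SymEq.exists_eq_map_C (h : SymEq R t g ω U q) (hL : 1 < L) (ht : t ≠ 0) (hg : g ≠ 0)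
    (hω : ω ≠ 0) (h1 : ∀ n, 1 < n → ∀ S S', homogeneousComponent n (q S S') = 0) :
    ∃ Y : Matrix Cfg Cfg ℂ, q = Y.map C ∧ ∀ i j, Commute (R.E i j) Y := by
  have h0 : ∀ n, 0 < n → ∀ S S', homogeneousComponent n (q S S') = 0 := fun n hn S S' => by
    rcases (show 1 ≤ n from hn).eq_or_lt with rfl | hn
    · exact eq_zero_of_wt_of_odd (homogeneousComponent_isHomogeneous _ _)
        (h.top_wt hL hg hω h1 S S') odd_one
    · exact h1 n hn S S'
  refine ⟨q.map (coeff 0), ?_, fun i j => h.top_commute hL ht hg hω h0 (map_zero _) i j⟩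
  ext1 S S'
  rw [Matrix.map_apply, Matrix.map_apply]
  ext M
  rw [coeff_C]
  split_ifs with hM
  · rw [hM]
  · have := congrArg (coeff M) (h0 M.degree (Nat.pos_of_ne_zero fun h => hM
      ((Finsupp.degree_eq_zero_iff M).mp h).symm) S S')
    rwa [coeff_homogeneousComponent, if_pos rfl] at this

end

end HolsteinHubbard

namespace HolsteinHubbard

open MvPolynomial Matrix

/-! ### Locality of electron operators -/

namespace FermionRep

variable {L : ℕ} {Cfg : Type*} [Fintype Cfg] [DecidableEq Cfg] (R : FermionRep (Site L × Spin) Cfg)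

/-- The algebra generated by the electron operators at the sites of `S`. -/
def localAlg (S : Set (Site L)) : Subalgebra ℂ (Matrix Cfg Cfg ℂ) :=
  Algebra.adjoin ℂ {A | ∃ i ∈ S, ∃ σ, A = R.cr (i, σ) ∨ A = R.an (i, σ)}

lemma par_mul_mul_par {A : Matrix Cfg Cfg ℂ} (h : R.par * A + A * R.par = 0) :
    R.par * A * R.par = -A := by
  rw [eq_neg_of_add_eq_zero_left h, neg_mul, mul_assoc, R.par_par, mul_one]

/-- This graded Leibniz rule reduces the vanishing of `skew` on a local algebra to its generators.
-/
lemma skew_mul (a : Site L × Spin) (Y Z : Matrix Cfg Cfg ℂ) :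
    R.skew a (Y * Z) = R.skew a Y * Z + R.par * Y * R.par * R.skew a Z := by
  have h : R.par * (Y * Z) * R.par = R.par * Y * R.par * (R.par * Z * R.par) := by
    have : R.par * Y * R.par * (R.par * Z * R.par) =
      R.par * Y * (R.par * R.par) * Z * R.par := by noncomm_ring
    rw [this, R.par_par]
    noncomm_ring
  rw [skew_apply, skew_apply, skew_apply, h]
  noncomm_ring

lemma skew_skew (a b : Site L × Spin) (Y : Matrix Cfg Cfg ℂ) :
    R.skew a (R.skew b Y) = R.cr a * R.cr b * Y - R.cr a * (R.par * Y * R.par) * R.cr b +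
      R.cr b * (R.par * Y * R.par) * R.cr a - Y * (R.cr b * R.cr a) := by
  have hb := R.par_mul_mul_par (R.par_cr b)
  have h1 : R.par * (R.cr b * Y) * R.par = -(R.cr b * (R.par * Y * R.par)) := by
    have : R.par * (R.cr b * Y) * R.par = R.par * R.cr b * (R.par * R.par) * Y * R.par := by
      rw [R.par_par]; noncomm_ring
    rw [this, ← mul_assoc (R.par * R.cr b), hb]
    noncomm_ring
  have h2 : R.par * (R.par * Y * R.par * R.cr b) * R.par = -(Y * R.cr b) := by
    have : R.par * (R.par * Y * R.par * R.cr b) * R.par =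
        (R.par * R.par) * Y * (R.par * R.cr b * R.par) := by noncomm_ring
    rw [this, hb, R.par_par]
    noncomm_ring
  rw [skew_apply, skew_apply, mul_sub R.par, sub_mul, h1, h2]
  noncomm_ring

lemma skew_comm (a b : Site L × Spin) (Y : Matrix Cfg Cfg ℂ) :
    R.skew a (R.skew b Y) = -R.skew b (R.skew a Y) := by
  rw [skew_skew, skew_skew, eq_neg_of_add_eq_zero_left (R.cr_cr a b)]
  noncomm_ring

lemma skew_skew_eq_Phi (a b : Site L × Spin) {Y : Matrix Cfg Cfg ℂ} (h : Commute R.par Y) :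
    R.skew a (R.skew b Y) = Phi Y (R.cr a) (R.cr b) := by
  rw [skew_skew, h.eq, mul_assoc Y, R.par_par, mul_one, Phi]
  noncomm_ring

lemma skew_eq_zero_of_mem {S : Set (Site L)} {Y : Matrix Cfg Cfg ℂ} (hY : Y ∈ R.localAlg S)
    {a : Site L} (ha : a ∉ S) (σ : Spin) : R.skew (a, σ) Y = 0 := by
  have hne : ∀ i ∈ S, ∀ τ, (i, τ) ≠ (a, σ) := fun i hi τ h => ha ((Prod.mk.inj h).1 ▸ hi)
  induction hY using Algebra.adjoin_induction with
  | mem x hx =>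
    obtain ⟨i, hi, τ, rfl | rfl⟩ := hx
    · rw [skew_apply, R.par_mul_mul_par (R.par_cr _), neg_mul, sub_neg_eq_add, R.cr_cr]
    · have h := R.an_cr (i, τ) (a, σ)
      rw [if_neg (hne i hi τ)] at h
      rw [skew_apply, R.par_mul_mul_par (R.par_an _), neg_mul, sub_neg_eq_add, add_comm, h]
  | algebraMap r =>
    rw [Algebra.algebraMap_eq_smul_one, map_smul, skew_apply, mul_one, mul_one, R.par_par, one_mul,
      sub_self, smul_zero]
  | add x y _ _ hx hy => rw [map_add, hx, hy, add_zero]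
  | mul x y _ _ hx hy => rw [skew_mul, hx, hy, zero_mul, mul_zero, add_zero]

lemma commute_E_of_mem {S : Set (Site L)} {Y : Matrix Cfg Cfg ℂ} (hY : Y ∈ R.localAlg S)
    {a : Site L} (ha : a ∉ S) : Commute (R.E a a) Y := by
  have hne : ∀ i ∈ S, ∀ τ σ : Spin, (i, τ) ≠ (a, σ) := fun i hi τ σ h =>
    ha ((Prod.mk.inj h).1 ▸ hi)
  induction hY using Algebra.adjoin_induction with
  | mem x hx =>
    rw [commute_iff_lie_eq]
    obtain ⟨i, hi, τ, rfl | rfl⟩ := hx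
    · rw [lie_E_cr, if_neg fun h : a = i => ha (h ▸ hi)]
    · rw [E, ring_sum_lie]
      refine Finset.sum_eq_zero fun σ _ => ?_
      rw [lie_bil_an, if_neg (hne i hi τ σ), neg_zero]
  | algebraMap r => exact Algebra.commute_algebraMap_right r _
  | add x y _ _ hx hy => exact hx.add_right hy
  | mul x y _ _ hx hy => exact hx.mul_right hy

lemma apply_eq_zero_of_commute {Y : Matrix Cfg Cfg ℂ} {a : Site L} (h : Commute (R.E a a) Y)
    {S S' : Cfg} (hc : charge R S S' a ≠ 0) : Y S S' = 0 := by
  have h1 := R.lie_E_self_apply a Y S S'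
  rw [commute_iff_lie_eq.mp h] at h1
  exact (mul_eq_zero.mp h1.symm).resolve_left hc

end FermionRep

/-! ### Symbols of local operators -/

section Local

variable {L : ℕ} {Cfg : Type*} [Fintype Cfg] [DecidableEq Cfg]
  {R : FermionRep (Site L × Spin) Cfg}

/-- The symbols of operators supported on the set of sites `S`. -/
def IsLocSym (R : FermionRep (Site L × Spin) Cfg) (S : Set (Site L))
    (q : Matrix Cfg Cfg (SymPoly (Site L))) : Prop :=
  ∀ M, q.map (coeff M) ∈ R.localAlg S ∧
    ∀ y ∉ S, (M (Sum.inl y) ≠ 0 ∨ M (Sum.inr y) ≠ 0) → q.map (coeff M) = 0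

lemma isLocSym_one (S : Set (Site L)) : IsLocSym R S 1 := by
  intro M
  by_cases hM : M = 0
  · subst hM
    refine ⟨?_, fun y _ hy => by simp at hy⟩
    have : (1 : Matrix Cfg Cfg (SymPoly (Site L))).map (coeff 0) = 1 := by
      ext S S'; rw [Matrix.map_apply, one_apply, one_apply, apply_ite (coeff 0)]; simp
    rw [this]; exact one_mem _
  · have : (1 : Matrix Cfg Cfg (SymPoly (Site L))).map (coeff M) = 0 := by
      ext S S'; rw [Matrix.map_apply, one_apply, apply_ite (coeff M)]; simp [coeff_one, Ne.symm hM]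
    exact ⟨this ▸ zero_mem _, fun _ _ _ => this⟩

lemma IsLocSym.add {S : Set (Site L)} {p q : Matrix Cfg Cfg (SymPoly (Site L))}
    (hp : IsLocSym R S p) (hq : IsLocSym R S q) : IsLocSym R S (p + q) := by
  intro M
  have : (p + q).map (coeff M) = p.map (coeff M) + q.map (coeff M) := by
    ext; simp
  rw [this]
  exact ⟨add_mem (hp M).1 (hq M).1, fun y hy h => by
    rw [(hp M).2 y hy h, (hq M).2 y hy h, add_zero]⟩

lemma IsLocSym.smul {S : Set (Site L)} {q : Matrix Cfg Cfg (SymPoly (Site L))}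
    (hq : IsLocSym R S q) (r : ℂ) : IsLocSym R S (r • q) := by
  intro M
  have : (r • q).map (coeff M) = r • q.map (coeff M) := by
    ext; simp
  rw [this]
  exact ⟨Subalgebra.smul_mem _ (hq M).1 _, fun y hy h => by rw [(hq M).2 y hy h, smul_zero]⟩

lemma IsLocSym.map_C_mul {S : Set (Site L)} {q : Matrix Cfg Cfg (SymPoly (Site L))}
    (hq : IsLocSym R S q) {A : Matrix Cfg Cfg ℂ} (hA : A ∈ R.localAlg S) :
    IsLocSym R S (A.map C * q) := by
  intro M
  have : (A.map C * q).map (coeff M) = A * q.map (coeff M) := by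
    ext; simp [Matrix.mul_apply, coeff_sum]
  rw [this]
  exact ⟨mul_mem hA (hq M).1, fun y hy h => by rw [(hq M).2 y hy h, mul_zero]⟩

lemma IsLocSym.X_mul {S : Set (Site L)} {q : Matrix Cfg Cfg (SymPoly (Site L))}
    (hq : IsLocSym R S q) {i : Site L} (hi : i ∈ S) {x : Site L ⊕ Site L}
    (hx : x = Sum.inl i ∨ x = Sum.inr i) : IsLocSym R S (q.map (X x * ·)) := by
  intro M
  by_cases hM : x ∈ M.support
  · have : (q.map (X x * ·)).map (coeff M) = q.map (coeff (M - Finsupp.single x 1)) := by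
      ext; simp only [Matrix.map_apply]; rw [coeff_X_mul', if_pos hM]
    rw [this]
    refine ⟨(hq _).1, fun y hy h => (hq _).2 y hy ?_⟩
    have hyi : i ≠ y := fun h => hy (h ▸ hi)
    rcases hx with rfl | rfl <;> simpa [Finsupp.single_apply, hyi] using h
  · have : (q.map (X x * ·)).map (coeff M) = 0 := by
      ext; simp only [Matrix.map_apply]; rw [coeff_X_mul', if_neg hM]; rfl
    exact ⟨this ▸ zero_mem _, fun _ _ _ => this⟩

lemma IsLocSym.pderiv {S : Set (Site L)} {q : Matrix Cfg Cfg (SymPoly (Site L))}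
    (hq : IsLocSym R S q) (x : Site L ⊕ Site L) : IsLocSym R S (q.map (pderiv x)) := by
  intro M
  have : (q.map (MvPolynomial.pderiv x)).map (coeff M) =
      ((M x : ℂ) + 1) • q.map (coeff (M + Finsupp.single x 1)) := by
    ext
    simp only [Matrix.map_apply, Matrix.smul_apply]
    rw [coeff_pderiv, smul_eq_mul, mul_comm]
  rw [this]
  refine ⟨Subalgebra.smul_mem _ (hq _).1 _, fun y hy h => ?_⟩
  rw [(hq _).2 y hy, smul_zero]
  simp only [Finsupp.add_apply]
  omega

lemma IsLocSym.coeff_eq_zero {S : Set (Site L)} {q : Matrix Cfg Cfg (SymPoly (Site L))}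
    (hq : IsLocSym R S q) {y : Site L} (hy : y ∉ S) {M : Site L ⊕ Site L →₀ ℕ}
    (h : M (Sum.inl y) ≠ 0 ∨ M (Sum.inr y) ≠ 0) (S₁ S₂ : Cfg) : coeff M (q S₁ S₂) = 0 :=
  congrFun (congrFun ((hq M).2 y hy h) S₁) S₂

lemma IsLocSym.apply_eq_zero {S : Set (Site L)} {q : Matrix Cfg Cfg (SymPoly (Site L))}
    (hq : IsLocSym R S q) {y : Site L} (hy : y ∉ S) {S₁ S₂ : Cfg} (hc : charge R S₁ S₂ y ≠ 0) :
    q S₁ S₂ = 0 := by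
  ext M
  exact R.apply_eq_zero_of_commute (R.commute_E_of_mem (hq M).1 hy) hc

lemma IsLocSym.pairLocal {S : Set (Site L)} {q : Matrix Cfg Cfg (SymPoly (Site L))} {n : ℕ}
    (hq : IsLocSym R S q) (hS : ∀ a, a ∉ S ∨ a + n ∉ S) : PairLocal R n q where
  mixed a S₁ S₂ z z' hz hz' := by
    ext M
    rw [coeff_pderiv, coeff_pderiv, coeff_zero]
    rcases hS a with ha | ha
    · rw [hq.coeff_eq_zero ha, zero_mul, zero_mul]
      rcases hz with rfl | rfl
      · left; simp only [Finsupp.add_apply, Finsupp.single_eq_same]; omega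
      · right; simp only [Finsupp.add_apply, Finsupp.single_eq_same]; omega
    · rw [hq.coeff_eq_zero ha, zero_mul, zero_mul]
      rcases hz' with rfl | rfl
      · left; simp only [Finsupp.add_apply, Finsupp.single_eq_same]; omega
      · right; simp only [Finsupp.add_apply, Finsupp.single_eq_same]; omega
  skew a M σ hM := by
    rcases hS a with ha | ha
    · rw [(hq M).2 a ha hM, map_zero]
    · exact R.skew_eq_zero_of_mem (hq M).1 ha σ
  skew_skew a M σ τ := by
    rcases hS a with ha | ha
    · rw [R.skew_comm, R.skew_eq_zero_of_mem (hq M).1 ha σ, map_zero, neg_zero]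
    · rw [R.skew_eq_zero_of_mem (hq M).1 ha τ, map_zero]

lemma PairLocal.add {n : ℕ} {p q : Matrix Cfg Cfg (SymPoly (Site L))} (hp : PairLocal R n p)
    (hq : PairLocal R n q) : PairLocal R n (p + q) := by
  have key : ∀ M, (p + q).map (coeff M) = p.map (coeff M) + q.map (coeff M) := fun M => by
    ext; simp
  exact
  { mixed := fun a S S' z z' hz hz' => by
      rw [Matrix.add_apply, map_add, map_add, hp.mixed a S S' z z' hz hz',
        hq.mixed a S S' z z' hz hz', add_zero]
    skew := fun a M σ h => by rw [key, map_add, hp.skew a M σ h, hq.skew a M σ h, add_zero]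
    skew_skew := fun a M σ τ => by
      rw [key, map_add, map_add, hp.skew_skew, hq.skew_skew, add_zero] }

lemma PairLocal.smul {n : ℕ} {q : Matrix Cfg Cfg (SymPoly (Site L))} (hq : PairLocal R n q)
    (r : ℂ) : PairLocal R n (r • q) := by
  have key : ∀ M, (r • q).map (coeff M) = r • q.map (coeff M) := fun M => by
    ext; simp
  exact
  { mixed := fun a S S' z z' hz hz' => by
      rw [Matrix.smul_apply, Derivation.map_smul, Derivation.map_smul, hq.mixed a S S' z z' hz hz', smul_zero]
    skew := fun a M σ h => by rw [key, map_smul, hq.skew a M σ h, smul_zero]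
    skew_skew := fun a M σ τ => by
      rw [key, map_smul, map_smul, hq.skew_skew, smul_zero] }

lemma PairLocal.zero {n : ℕ} : PairLocal R n 0 := by
  have key : ∀ M, (0 : Matrix Cfg Cfg (SymPoly (Site L))).map (coeff M) = 0 := fun M => by
    ext; simp
  exact
  { mixed := fun a S S' z z' hz hz' => by rw [Matrix.zero_apply, map_zero, map_zero]
    skew := fun a M σ h => by rw [key, map_zero]
    skew_skew := fun a M σ τ => by rw [key, map_zero, map_zero] }

/-- Two sites at the maximal distance are not contained in a window of at most half the length. -/
lemma notMem_window_or {k : ℕ} (hk : 2 * k ≤ L) (i a : Site L) :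
    a ∉ window i k ∨ a + (L / 2 : ℕ) ∉ window i k := by
  by_contra! h
  obtain ⟨⟨m, hm, h1⟩, m', hm', h2⟩ := h
  have h3 : ((m + L / 2 : ℕ) : Site L) = (m' : ℕ) := by
    rw [h1, add_assoc] at h2
    push_cast
    exact add_left_cancel h2
  -- Both numbers are below `L`, so the congruence is an equality `m + L / 2 = m'`, impossible
  -- because `m' < k ≤ L / 2`.
  rw [ZMod.natCast_eq_natCast_iff, Nat.ModEq, Nat.mod_eq_of_lt (by omega),
    Nat.mod_eq_of_lt (by omega)] at h3
  omega

end Local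

end HolsteinHubbard

namespace HolsteinHubbard

open MvPolynomial Matrix

/-! ### Operators with matrix entries in the phonon algebra -/

section Theta

variable {L : ℕ} {Cfg W : Type*} [Fintype Cfg] [DecidableEq Cfg] [Ring W] [Algebra ℂ W]
  (B : WeylRep (Site L) W) (R : FermionRep (Site L × Spin) Cfg)

/-- The operator with a given symbol. -/
def theta : Matrix Cfg Cfg (SymPoly (Site L)) →ₗ[ℂ] Matrix Cfg Cfg W := B.nu.mapMatrix

omit [Fintype Cfg] [DecidableEq Cfg] in
lemma theta_apply (q : Matrix Cfg Cfg (SymPoly (Site L))) (S S' : Cfg) :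
    theta B q S S' = B.nu (q S S') := rfl

/-- A matrix of numbers as an operator. -/
def scal (W : Type*) [Ring W] [Algebra ℂ W] : Matrix Cfg Cfg ℂ →ₐ[ℂ] Matrix Cfg Cfg W :=
  (Algebra.ofId ℂ W).mapMatrix

lemma scal_apply (A : Matrix Cfg Cfg ℂ) (S S' : Cfg) :
    scal W A S S' = algebraMap ℂ W (A S S') := rfl

omit [Fintype Cfg] in
lemma theta_one : theta B (1 : Matrix Cfg Cfg (SymPoly (Site L))) = 1 := by
  ext S S'
  rw [theta_apply, one_apply, one_apply, apply_ite B.nu, B.nu_one, map_zero]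

lemma theta_map_C (A : Matrix Cfg Cfg ℂ) : theta B (A.map C) = scal W A := by
  ext S S'
  rw [theta_apply, Matrix.map_apply, B.nu_C, scal_apply]

omit [Fintype Cfg] [DecidableEq Cfg] in
lemma theta_injective [Nontrivial W] :
    Function.Injective (theta B : Matrix Cfg Cfg (SymPoly (Site L)) →ₗ[ℂ] Matrix Cfg Cfg W) := by
  intro p q h
  ext1 S S'
  exact B.nu_injective (congrFun (congrFun h S) S')

lemma scal_mul_theta (A : Matrix Cfg Cfg ℂ) (q : Matrix Cfg Cfg (SymPoly (Site L))) :
    scal W A * theta B q = theta B (A.map C * q) := by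
  ext S S'
  rw [theta_apply, Matrix.mul_apply, Matrix.mul_apply, map_sum]
  exact Finset.sum_congr rfl fun _ _ => by
    rw [scal_apply, theta_apply, Matrix.map_apply, ← smul_eq_C_mul, map_smul, Algebra.smul_def]

lemma diagonal_bd_mul_theta (i : Site L) (q : Matrix Cfg Cfg (SymPoly (Site L))) :
    (diagonal fun _ => B.bd i) * theta B q = theta B (q.map (X (Sum.inl i) * ·)) := by
  ext S S'
  rw [diagonal_mul, theta_apply, theta_apply, Matrix.map_apply, B.nu_X_inl_mul]

lemma diagonal_b_mul_theta (i : Site L) (q : Matrix Cfg Cfg (SymPoly (Site L))) :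
    (diagonal fun _ => B.b i) * theta B q =
      theta B (q.map (X (Sum.inr i) * ·) + q.map (pderiv (Sum.inl i))) := by
  ext S S'
  rw [diagonal_mul, theta_apply, theta_apply, Matrix.add_apply, Matrix.map_apply, Matrix.map_apply,
    B.b_mul_nu]

/-- The algebra generated by the operators at the sites of `S`. -/
def opAlg (S : Set (Site L)) : Subalgebra ℂ (Matrix Cfg Cfg W) :=
  Algebra.adjoin ℂ {A | ∃ i ∈ S, A = (diagonal fun _ => B.bd i) ∨ A = (diagonal fun _ => B.b i) ∨
    ∃ σ, A = scal W (R.cr (i, σ)) ∨ A = scal W (R.an (i, σ))}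

variable {B R}

lemma exists_isLocSym {S : Set (Site L)} {A : Matrix Cfg Cfg W} (hA : A ∈ opAlg B R S) :
    ∃ q, IsLocSym R S q ∧ A = theta B q := by
  -- The symbol of a product is not the product of the symbols. The induction therefore runs on left
  -- multiplication, under which local symbols are stable.
  suffices ∀ q', IsLocSym R S q' → ∃ q, IsLocSym R S q ∧ A * theta B q' = theta B q by
    simpa only [theta_one, mul_one] using this 1 (isLocSym_one S)
  induction hA using Algebra.adjoin_induction with
  | mem x hx =>
    intro q' hq'
    obtain ⟨i, hi, rfl | rfl | ⟨σ, rfl | rfl⟩⟩ := hx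
    · exact ⟨_, hq'.X_mul hi (Or.inl rfl), diagonal_bd_mul_theta B i q'⟩
    · exact ⟨_, (hq'.X_mul hi (Or.inr rfl)).add (hq'.pderiv _), diagonal_b_mul_theta B i q'⟩
    · exact ⟨_, hq'.map_C_mul (Algebra.subset_adjoin ⟨i, hi, σ, Or.inl rfl⟩), scal_mul_theta B _ q'⟩
    · exact ⟨_, hq'.map_C_mul (Algebra.subset_adjoin ⟨i, hi, σ, Or.inr rfl⟩), scal_mul_theta B _ q'⟩
  | algebraMap r =>
    intro q' hq'
    exact ⟨_, hq'.smul r, by rw [map_smul, Algebra.smul_def]⟩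
  | add x y _ _ hx hy =>
    intro q' hq'
    obtain ⟨q, hq, h⟩ := hx q' hq'
    obtain ⟨p, hp, h'⟩ := hy q' hq'
    exact ⟨_, hq.add hp, by rw [add_mul, h, h', map_add]⟩
  | mul x y _ _ hx hy =>
    intro q' hq'
    obtain ⟨p, hp, h⟩ := hy q' hq'
    obtain ⟨q, hq, h'⟩ := hx p hp
    exact ⟨q, hq, by rw [mul_assoc, h, h']⟩

variable (B R) in
/-- The sums of operators supported on `k` consecutive sites. -/
def opSums (k : ℕ) : Submodule ℂ (Matrix Cfg Cfg W) :=
  Submodule.span ℂ {A | ∃ i, A ∈ opAlg B R (window i k)}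

lemma exists_pairLocal {k : ℕ} (hk : 2 * k ≤ L) {A : Matrix Cfg Cfg W} (hA : A ∈ opSums B R k) :
    ∃ q, PairLocal R (L / 2) q ∧ A = theta B q := by
  induction hA using Submodule.span_induction with
  | mem x hx =>
    obtain ⟨i, hi⟩ := hx
    obtain ⟨q, hq, h⟩ := exists_isLocSym hi
    exact ⟨q, hq.pairLocal (notMem_window_or hk i), h⟩
  | zero => exact ⟨0, PairLocal.zero, (map_zero _).symm⟩
  | add x y _ _ hx hy =>
    obtain ⟨p, hp, rfl⟩ := hx
    obtain ⟨q, hq, rfl⟩ := hy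
    exact ⟨_, hp.add hq, (map_add _ _ _).symm⟩
  | smul r x _ hx =>
    obtain ⟨p, hp, rfl⟩ := hx
    exact ⟨_, hp.smul r, (map_smul _ _ _).symm⟩

lemma exists_apply_eq_zero {A : Matrix Cfg Cfg W} (hA : A ∈ opSums B R 1) :
    ∃ q, (∀ S S' i j, i ≠ j → charge R S S' i ≠ 0 → charge R S S' j ≠ 0 → q S S' = 0) ∧
      A = theta B q := by
  induction hA using Submodule.span_induction with
  | mem x hx =>
    obtain ⟨a, ha⟩ := hx
    obtain ⟨q, hq, h⟩ := exists_isLocSym ha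
    refine ⟨q, fun S S' i j hij hi hj => ?_, h⟩
    have hw : ∀ m, m ∈ window a 1 → m = a := by
      rintro m ⟨l, hl, rfl⟩
      rw [Nat.lt_one_iff.mp hl, Nat.cast_zero, add_zero]
    by_cases h1 : i ∈ window a 1
    · refine hq.apply_eq_zero (fun h2 => hij ?_) hj
      rw [hw i h1, hw j h2]
    · exact hq.apply_eq_zero h1 hi
  | zero => exact ⟨0, fun _ _ _ _ _ _ _ => rfl, (map_zero _).symm⟩
  | add x y _ _ hx hy =>
    obtain ⟨p, hp, rfl⟩ := hx
    obtain ⟨q, hq, rfl⟩ := hy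
    exact ⟨p + q, fun S S' i j h h1 h2 => by
      rw [Matrix.add_apply, hp S S' i j h h1 h2, hq S S' i j h h1 h2, add_zero],
      (map_add _ _ _).symm⟩
  | smul r x _ hx =>
    obtain ⟨p, hp, rfl⟩ := hx
    exact ⟨r • p, fun S S' i j h h1 h2 => by
      rw [Matrix.smul_apply, hp S S' i j h h1 h2, smul_zero], (map_smul _ _ _).symm⟩

end Theta

/-! ### The Hamiltonian -/

section Hamiltonian

variable {L : ℕ} [NeZero L] {Cfg W : Type*} [Fintype Cfg] [DecidableEq Cfg] [Ring W] [Algebra ℂ W]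
  (B : WeylRep (Site L) W) (R : FermionRep (Site L × Spin) Cfg) (t g ω U : ℂ)

/-- The part of the Hamiltonian that does not move electrons. -/
def energy (S : Cfg) : W :=
  (U * coul R S) • 1 + g • ∑ i, (R.occ S i : ℂ) • (B.bd i + B.b i) + ω • ∑ i, B.bd i * B.b i

/-- The Hamiltonian as a matrix. -/
def ham : Matrix Cfg Cfg W := t • scal W R.hop + diagonal (energy B R g ω U)

/-- The symbol of the Hamiltonian. -/
def hamSym : Matrix Cfg Cfg (SymPoly (Site L)) := t • hopSym R + diagonal fun S =>
  (U * coul R S) • 1 + g • ∑ i, (R.occ S i : ℂ) • (X (Sum.inl i) + X (Sum.inr i)) +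
    ω • phononSym (Site L)

omit [NeZero L] in
lemma nu_X_inl (i : Site L) : B.nu (X (Sum.inl i)) = B.bd i := by
  rw [← mul_one (X _), B.nu_X_inl_mul, B.nu_one, mul_one]

omit [NeZero L] in
lemma nu_X_inr (i : Site L) : B.nu (X (Sum.inr i)) = B.b i := by
  rw [← mul_one (X _), B.nu_X_inr_mul, B.nu_one, one_mul]

lemma theta_hamSym : theta B (hamSym R t g ω U) = ham B R t g ω U := by
  rw [hamSym, ham, map_add, map_smul, hopSym, theta_map_C]
  congr 1
  ext S S'
  rw [theta_apply, diagonal_apply, diagonal_apply, apply_ite B.nu, map_zero]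
  simp only [map_add, map_smul, map_sum, phononSym, B.nu_one, nu_X_inl, B.nu_X_inl_mul, nu_X_inr,
    energy]

/-- Reordering a phonon operator past `nu p` produces the derivatives of `p`; in the number operator
the quadratic terms cancel and only `wt p` is left. -/
lemma energy_mul_sub (S S' : Cfg) (p : SymPoly (Site L)) :
    energy B R g ω U S * B.nu p - B.nu p * energy B R g ω U S' =
      B.nu ((U * (coul R S - coul R S')) • p + ω • wt p +
        g • (linForm (charge R S S') * p + ∑ i, ((R.occ S i : ℂ) • pderiv (Sum.inl i) p -
          (R.occ S' i : ℂ) • pderiv (Sum.inr i) p))) := by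
  have h1 : ∀ i, B.bd i * B.b i * B.nu p =
      B.nu (X (Sum.inl i) * (X (Sum.inr i) * p + pderiv (Sum.inl i) p)) := fun i => by
    rw [mul_assoc, B.b_mul_nu, B.nu_X_inl_mul]
  have h2 : ∀ i, B.nu p * (B.bd i * B.b i) =
      B.nu (X (Sum.inr i) * (X (Sum.inl i) * p + pderiv (Sum.inr i) p)) := fun i => by
    rw [← mul_assoc, B.nu_mul_bd, B.nu_X_inr_mul]
  simp only [energy, add_mul, mul_add, smul_mul_assoc, mul_smul_comm, one_mul, mul_one,
    Finset.sum_mul, Finset.mul_sum, h1, h2, B.b_mul_nu, B.nu_mul_bd, ← B.nu_X_inl_mul,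
    ← B.nu_X_inr_mul, ← map_add, ← map_smul, ← map_sum, ← map_sub]
  congr 1
  have h3 : ∑ i, (X (Sum.inl i) * (X (Sum.inr i) * p) + X (Sum.inl i) * pderiv (Sum.inl i) p) -
      ∑ i, (X (Sum.inr i) * (X (Sum.inl i) * p) + X (Sum.inr i) * pderiv (Sum.inr i) p) =
        wt p := by
    rw [wt_apply, ← Finset.sum_sub_distrib]
    exact Finset.sum_congr rfl fun _ _ => by ring
  have h4 : ∑ i, (R.occ S i : ℂ) • (X (Sum.inl i) * p + (X (Sum.inr i) * p + pderiv (Sum.inl i) p)) -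
      ∑ i, (R.occ S' i : ℂ) • (X (Sum.inl i) * p + pderiv (Sum.inr i) p + X (Sum.inr i) * p) =
      linForm (charge R S S') * p + ∑ i, ((R.occ S i : ℂ) • pderiv (Sum.inl i) p -
        (R.occ S' i : ℂ) • pderiv (Sum.inr i) p) := by
    rw [linForm, Finset.sum_mul, ← Finset.sum_sub_distrib, ← Finset.sum_add_distrib]
    refine Finset.sum_congr rfl fun i _ => ?_
    rw [charge, smul_mul_assoc, add_mul]
    module
  have key : ∀ a a' e e' w f : SymPoly (Site L), a - a' = w → e - e' = f →
      (U * coul R S) • p + g • e + ω • a - ((U * coul R S') • p + g • e' + ω • a') =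
        (U * (coul R S - coul R S')) • p + ω • w + g • f := by
    rintro a a' e e' _ _ rfl rfl
    module
  rw [map_smul wt]
  exact key _ _ _ _ _ _ h3 h4

lemma lie_ham_theta_apply (q : Matrix Cfg Cfg (SymPoly (Site L))) (S S' : Cfg) :
    (ham B R t g ω U * theta B q - theta B q * ham B R t g ω U) S S' =
      B.nu (t • ⁅hopSym R, q⁆ S S' + (U * (coul R S - coul R S')) • q S S' + ω • wt (q S S') +
        g • (linForm (charge R S S') * q S S' + ∑ i, ((R.occ S i : ℂ) • pderiv (Sum.inl i) (q S S') -
          (R.occ S' i : ℂ) • pderiv (Sum.inr i) (q S S')))) := by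
  have h1 : ∀ p : SymPoly (Site L), ∀ r : ℂ, algebraMap ℂ W r * B.nu p = r • B.nu p :=
    fun p r => (Algebra.smul_def _ _).symm
  have h2 : ∀ p : SymPoly (Site L), ∀ r : ℂ, B.nu p * algebraMap ℂ W r = r • B.nu p :=
    fun p r => by rw [← Algebra.commutes, h1]
  rw [add_assoc (t • _), add_assoc (t • _), map_add, ← energy_mul_sub, ham, add_mul, mul_add,
    add_sub_add_comm, Matrix.add_apply, lie_hopSym_apply]
  congr 1
  · rw [smul_mul_assoc, mul_smul_comm, ← smul_sub, Matrix.smul_apply, Matrix.sub_apply,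
      Matrix.mul_apply, Matrix.mul_apply, ← Finset.sum_sub_distrib, map_smul, map_sum]
    simp only [map_sub, map_smul, scal_apply, theta_apply, h1, h2]
  · rw [Matrix.sub_apply, diagonal_mul, mul_diagonal, theta_apply]

variable {B R t g ω U}

lemma symEq_of_commute [Nontrivial W] {q : Matrix Cfg Cfg (SymPoly (Site L))}
    (h : Commute (theta B q) (ham B R t g ω U)) : SymEq R t g ω U q := by
  intro S S'
  refine B.nu_injective ?_
  rw [← lie_ham_theta_apply, h.eq, sub_self, map_zero, Matrix.zero_apply]

end Hamiltonian

end HolsteinHubbard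

namespace HolsteinHubbard

open MvPolynomial Matrix

/-! ### Local conserved quantities -/

section Conserved

variable {L : ℕ} [NeZero L] {Cfg W : Type*} [Fintype Cfg] [DecidableEq Cfg] [Ring W] [Algebra ℂ W]
  [Nontrivial W] {B : WeylRep (Site L) W} {R : FermionRep (Site L × Spin) Cfg} {t g ω U : ℂ}

omit [NeZero L] in
lemma charge_self (S : Cfg) : charge R S S = 0 := funext fun _ => sub_self _

/-- Sums of one-site operators have no entry changing the occupation of two sites. A hop does
exactly this, while `Y` preserves all occupations. -/
lemma eq_zero_of_mem_opSums_one (hL : 1 < L) (ht : t ≠ 0) {Y : Matrix Cfg Cfg ℂ}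
    (hY : ∀ i, Commute (R.E i i) Y) {y : ℂ}
    (h : y • ham B R t g ω U + scal W Y ∈ opSums B R 1) : y = 0 := by
  obtain ⟨q, hq, hqA⟩ := exists_apply_eq_zero h
  rw [← theta_hamSym, ← map_smul, ← theta_map_C, ← map_add] at hqA
  have hqA := theta_injective B hqA
  obtain ⟨S, S', hhop, hocc⟩ := R.exists_hop_apply_ne_zero hL 0
  have hne := FermionRep.site_ne_add_one hL 0
  have h0 : charge R S S' 0 ≠ 0 := by
    rw [charge, hocc, if_pos rfl, if_neg hne]; norm_num
  have h1 : charge R S S' (0 + 1) ≠ 0 := by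
    rw [charge, hocc, if_pos rfl, if_neg hne.symm]; norm_num
  have hSS' : S ≠ S' := by
    rintro rfl
    exact h0 (congrFun (charge_self S) 0)
  have h2 := hq S S' 0 (0 + 1) hne h0 h1
  rw [← hqA, Matrix.add_apply, Matrix.smul_apply, hamSym, Matrix.add_apply, Matrix.smul_apply,
    diagonal_apply_ne _ hSS', add_zero, Matrix.map_apply, R.apply_eq_zero_of_commute (hY 0) h0,
    map_zero, add_zero, hopSym, Matrix.map_apply, smul_smul, smul_eq_zero, C_eq_zero] at h2
  exact (mul_eq_zero.mp (h2.resolve_right hhop)).resolve_right ht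

lemma homogeneousComponent_hamSym {n : ℕ} (hn : 1 < n) (S S' : Cfg) :
    homogeneousComponent n (hamSym R t g ω U S S') =
      if S = S' then ω • homogeneousComponent n (phononSym (Site L)) else 0 := by
  have h0 : ∀ a : ℂ, homogeneousComponent n (C a : SymPoly (Site L)) = 0 := fun a => by
    rw [homogeneousComponent_of_mem (isHomogeneous_C _ a), if_neg (by omega)]
  have h1 : ∀ x, homogeneousComponent n (X x : SymPoly (Site L)) = 0 := fun x => by
    rw [homogeneousComponent_of_mem (isHomogeneous_X ℂ x), if_neg (by omega)]
  have h0' := h0 1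
  rw [C_1] at h0'
  rw [hamSym, Matrix.add_apply, Matrix.smul_apply, hopSym, Matrix.map_apply, map_add, map_smul, h0,
    smul_zero, zero_add, diagonal_apply, apply_ite (homogeneousComponent n), map_zero]
  simp only [map_add, map_smul, map_sum, h0', h1, smul_zero, add_zero, Finset.sum_const_zero,
    zero_add]

theorem exists_of_commute {k : ℕ} (ht : t ≠ 0) (hg : g ≠ 0) (hω : ω ≠ 0) (hk1 : 1 ≤ k)
    (hk : 2 * k ≤ L) (hH : 2 ≤ k → ham B R t g ω U ∈ opSums B R k) {A : Matrix Cfg Cfg W}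
    (hA : A ∈ opSums B R k) (hc : Commute A (ham B R t g ω U)) :
    ∃ y : ℂ, ∃ Y ∈ Submodule.span ℂ ({1} ∪ {A | ∃ σ τ, A = R.N σ τ}),
      A = y • ham B R t g ω U + scal W Y := by
  obtain ⟨q, hq, rfl⟩ := exists_pairLocal hk hA
  have hL : 1 < L := by omega
  have hn : 0 < L / 2 := by omega
  have hnL : L / 2 < L := by omega
  have h := symEq_of_commute hc
  obtain ⟨h2, r, hr⟩ := h.exists_homogeneousComponent_two hq hL hn hnL ht hg hω
  have h' : SymEq R t g ω U (q - (r / ω) • hamSym R t g ω U) := by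
    refine symEq_of_commute (B := B) ?_
    rw [map_sub, map_smul, theta_hamSym]
    exact hc.sub_left ((Commute.refl _).smul_left _)
  obtain ⟨Y, hqY, hY⟩ := h'.exists_eq_map_C hL ht hg hω fun n hn S S' => by
    rw [Matrix.sub_apply, Matrix.smul_apply, map_sub, map_smul, homogeneousComponent_hamSym hn,
      homogeneousComponent_of_mem isHomogeneous_phononSym]
    rcases (show 2 ≤ n from hn).eq_or_lt with rfl | hn2
    · rw [hr, if_pos rfl]
      split_ifs
      · rw [smul_smul, div_mul_cancel₀ _ hω, sub_self]
      · rw [smul_zero, sub_zero]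
    · rw [h2 n hn2, if_neg hn2.ne']
      simp
  have hqY' : q = (r / ω) • hamSym R t g ω U + Y.map C := by
    rw [← hqY, add_sub_cancel]
  have hθ : theta B q = (r / ω) • ham B R t g ω U + scal W Y := by
    rw [hqY', map_add, map_smul, theta_hamSym, theta_map_C]
  refine ⟨r / ω, Y, ?_, hθ⟩
  -- `Y` inherits locality from `q` and the Hamiltonian. For `k = 1` the Hamiltonian need not be a
  -- sum of `k`-support operators, but there its coefficient vanishes.
  have hloc : PairLocal R (L / 2) (Y.map C : Matrix Cfg Cfg (SymPoly (Site L))) := by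
    rcases hk1.eq_or_lt with rfl | hk2
    · have h0 := eq_zero_of_mem_opSums_one hL ht (fun i => hY i i) (hθ ▸ hA)
      rw [h0, zero_smul, zero_add] at hqY'
      exact hqY' ▸ hq
    · obtain ⟨p, hp, hHp⟩ := exists_pairLocal hk (hH hk2)
      rw [← theta_hamSym] at hHp
      have hp' := theta_injective B hHp
      rw [← hqY, hp', sub_eq_add_neg, ← neg_smul]
      exact hq.add (hp.smul _)
  have hpar : Commute R.par Y := commute_par_of_charge fun S S' hc => by
    obtain ⟨i, hi⟩ := Function.ne_iff.mp hc
    exact R.apply_eq_zero_of_commute (hY i i) hi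
  refine R.mem_span_of_commute hY (a := 0) (b := 0 + (L / 2 : ℕ)) ?_ fun σ τ => ?_
  · intro h
    rw [left_eq_add, ZMod.natCast_eq_zero_iff] at h
    exact absurd (Nat.le_of_dvd hn h) (by omega)
  · rw [← R.skew_skew_eq_Phi _ _ hpar]
    have := hloc.skew_skew 0 0 σ τ
    have hmap : (Y.map C : Matrix Cfg Cfg (SymPoly (Site L))).map (coeff 0) = Y := by
      ext S S'; simp
    rwa [hmap] at this

end Conserved

/-! ### The Hamiltonian in terms of generators, and its spin symmetry. -/

section Sums

variable {L : ℕ} [NeZero L] {Cfg W : Type*} [Fintype Cfg] [DecidableEq Cfg] [Ring W] [Algebra ℂ W]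
  (B : WeylRep (Site L) W) (R : FermionRep (Site L × Spin) Cfg) (t g ω U : ℂ)

omit [NeZero L] in
-- Completing the sum over distinct spins to a full square adds the terms `n_σ² = n_σ`.
lemma E_self_mul_sub (i : Site L) :
    ∑ σ, ∑ τ ∈ Finset.univ.erase σ, R.bil (i, σ) (i, σ) * R.bil (i, τ) (i, τ) =
      R.E i i * R.E i i - R.E i i := by
  rw [FermionRep.E, Finset.sum_mul_sum, ← Finset.sum_sub_distrib]
  refine Finset.sum_congr rfl fun σ _ => ?_
  rw [eq_sub_iff_add_eq]
  nth_rewrite 2 [← R.bil_self_mul_self]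
  exact Finset.sum_erase_add _ _ (Finset.mem_univ σ)

lemma ham_eq : ham B R t g ω U = t • scal W R.hop + U • ∑ i, scal W (R.E i i * R.E i i - R.E i i) +
    g • ∑ i, scal W (R.E i i) * diagonal (fun _ => B.bd i + B.b i) +
    ω • ∑ i, diagonal fun _ => B.bd i * B.b i := by
  rw [ham, add_assoc, add_assoc, ← add_assoc (U • _)]
  congr 1
  have h1 : ∀ i, scal W (R.E i i) = diagonal fun S => algebraMap ℂ W (R.occ S i) := fun i => by
    rw [R.E_self]
    exact diagonal_map (map_zero _)
  have h2 : ∀ i, scal W (R.E i i * R.E i i - R.E i i) =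
      diagonal fun S => algebraMap ℂ W ((R.occ S i : ℂ) ^ 2 - R.occ S i) := fun i => by
    rw [map_sub, map_mul, h1, diagonal_mul_diagonal, diagonal_sub]
    congr 1
    funext S
    rw [map_sub, map_pow, sq]
  simp only [h1, h2, diagonal_mul_diagonal]
  ext S S'
  simp only [Matrix.add_apply, Matrix.smul_apply, Matrix.sum_apply]
  by_cases h : S = S'
  · subst h
    simp only [diagonal_apply_eq, energy, coul, ← map_sum, ← Algebra.smul_def]
    rw [mul_smul, Algebra.algebraMap_eq_smul_one]
  · simp only [diagonal_apply_ne _ h, Finset.sum_const_zero, smul_zero, add_zero]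

lemma ham_eq_generators : ham B R t g ω U =
    t • ∑ i, ∑ σ, (scal W (R.cr (i, σ)) * scal W (R.an (i + 1, σ)) +
      scal W (R.cr (i + 1, σ)) * scal W (R.an (i, σ))) +
    g • ∑ i, ∑ σ, scal W (R.cr (i, σ)) * scal W (R.an (i, σ)) *
      ((diagonal fun _ => B.bd i) + diagonal fun _ => B.b i) +
    ω • ∑ i, (diagonal fun _ => B.bd i) * (diagonal fun _ => B.b i) +
    U • ∑ i, ∑ σ, ∑ τ ∈ Finset.univ.erase σ, scal W (R.cr (i, σ)) * scal W (R.an (i, σ)) *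
      (scal W (R.cr (i, τ)) * scal W (R.an (i, τ))) := by
  rw [ham_eq]
  simp only [← E_self_mul_sub]
  simp only [FermionRep.hop, FermionRep.E, FermionRep.bil, map_sum, map_mul,
    map_add, diagonal_mul_diagonal, diagonal_add, Finset.sum_mul, Finset.sum_add_distrib]
  have key : ∀ a b c d : Matrix Cfg Cfg W, a + b + c + d = a + c + d + b := fun a b c d => by abel
  exact key _ _ _ _

/-- The electrons enter the Hamiltonian only through the spin-summed bilinears `E i j`, which are
invariant under the spin bilinears. -/
lemma commute_N_ham (σ τ : Spin) : Commute (scal W (R.N σ τ)) (ham B R t g ω U) := by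
  have hE : ∀ i j, Commute (R.N σ τ) (R.E i j) := fun i j => commute_iff_lie_eq.mpr
    (R.lie_N_E σ τ i j)
  have hd : ∀ (A : Matrix Cfg Cfg ℂ) (w : W),
      Commute (scal W A) (diagonal fun _ => w) := fun A w => by
    ext S S'
    rw [mul_diagonal, diagonal_mul, scal_apply, Algebra.commutes]
  rw [ham_eq]
  refine (((Commute.smul_right ?_ t).add_right (Commute.smul_right ?_ U)).add_right
    (Commute.smul_right ?_ g)).add_right (Commute.smul_right ?_ ω)
  · refine Commute.map ?_ _
    exact Commute.sum_right _ _ _ fun i _ => (hE _ _).add_right (hE _ _)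
  · exact Commute.sum_right _ _ _ fun i _ =>
      (((hE i i).mul_right (hE i i)).sub_right (hE i i)).map _
  · exact Commute.sum_right _ _ _ fun i _ => ((hE i i).map _).mul_right (hd _ _)
  · exact Commute.sum_right _ _ _ fun i _ => hd _ _

end Sums

end HolsteinHubbard

namespace HolsteinHubbard

open MvPolynomial Matrix

/-! ### Operators on Fock space -/

/-- The phonon operators in the Bargmann representation. -/
def bargmann (L : ℕ) : WeylRep (Site L) (Module.End ℂ (PhononFock L)) where
  bd i := LinearMap.mulLeft ℂ (X i)
  b i := (pderiv i : Derivation ℂ (PhononFock L) (PhononFock L))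
  bd_comm i j := LinearMap.ext fun p => mul_left_comm _ _ _
  b_comm i j := LinearMap.ext fun p => pderiv_pderiv_comm i j p
  ccr i j := LinearMap.ext fun p => by
    refine ((pderiv i).leibniz (X j) p).trans ?_
    rw [pderiv_X, Pi.single_apply, smul_eq_mul, smul_eq_mul]
    refine congrArg (fun r => X j * pderiv i p + r) ?_
    by_cases h : i = j
    · rw [if_pos h, if_pos h.symm]; exact mul_one p
    · rw [if_neg h, if_neg (Ne.symm h)]; exact mul_zero p

section Fock

variable {L : ℕ} [NeZero L] {Cfg : Type*} [Fintype Cfg] [DecidableEq Cfg]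

/-- A faithful representation of operators on Fock space by matrices of phonon operators. -/
structure MatrixForm (R : FermionRep (Site L × Spin) Cfg) where
  /-- the matrix of an operator -/
  ent : Op L →ₐ[ℂ] Matrix Cfg Cfg (Module.End ℂ (PhononFock L))
  injective : Function.Injective ent
  ent_cDag : ∀ i σ, ent (cDag i σ) = scal _ (R.cr (i, σ))
  ent_c : ∀ i σ, ent (c i σ) = scal _ (R.an (i, σ))
  ent_bDag : ∀ i, ent (bDag i) = diagonal fun _ => (bargmann L).bd i
  ent_b : ∀ i, ent (b i) = diagonal fun _ => (bargmann L).b i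

variable {R : FermionRep (Site L × Spin) Cfg} (F : MatrixForm R)

lemma MatrixForm.ent_hamiltonian (t g ω U : ℝ) :
    F.ent (hamiltonian L t g ω U) = ham (bargmann L) R t g ω U := by
  rw [ham_eq_generators]
  simp only [hamiltonian, hHop, hInt, hPho, hCoul, num, map_add, map_smul, map_sum, map_mul,
    F.ent_cDag, F.ent_c, F.ent_bDag, F.ent_b]

lemma MatrixForm.ent_spinBilinear (σ τ : Spin) :
    F.ent (spinBilinear L σ τ) = scal _ (R.N σ τ) := by
  simp only [spinBilinear, FermionRep.N, FermionRep.bil, map_sum, map_mul, F.ent_cDag, F.ent_c]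

omit [NeZero L] in
lemma MatrixForm.ent_mem_opAlg {S : Set (Site L)} {A : Op L} (hA : A ∈ localAlgebra S) :
    F.ent A ∈ opAlg (bargmann L) R S := by
  have : localAlgebra S ≤ (opAlg (bargmann L) R S).comap F.ent := by
    refine Algebra.adjoin_le ?_
    rintro _ ⟨i, hi, rfl | rfl | ⟨σ, rfl | rfl⟩⟩
    · exact Algebra.subset_adjoin ⟨i, hi, Or.inl (F.ent_bDag i)⟩
    · exact Algebra.subset_adjoin ⟨i, hi, Or.inr (Or.inl (F.ent_b i))⟩
    · exact Algebra.subset_adjoin ⟨i, hi, Or.inr (Or.inr ⟨σ, Or.inl (F.ent_cDag i σ)⟩)⟩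
    · exact Algebra.subset_adjoin ⟨i, hi, Or.inr (Or.inr ⟨σ, Or.inr (F.ent_c i σ)⟩)⟩
  exact this hA

omit [NeZero L] in
lemma MatrixForm.ent_mem_opSums {k : ℕ} {A : Op L} (hA : A ∈ supportSums L k) :
    F.ent A ∈ opSums (bargmann L) R k := by
  have : supportSums L k ≤ (opSums (bargmann L) R k).comap F.ent.toLinearMap := by
    refine Submodule.span_le.mpr ?_
    rintro A ⟨i, hi⟩
    exact Submodule.subset_span ⟨i, F.ent_mem_opAlg hi⟩
  exact this hA

lemma MatrixForm.exists_of_mem_span {Y : Matrix Cfg Cfg ℂ}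
    (hY : Y ∈ Submodule.span ℂ ({1} ∪ {A | ∃ σ τ, A = R.N σ τ})) :
    ∃ A ∈ bilinearSpan L, F.ent A = scal _ Y := by
  have : Submodule.span ℂ ({1} ∪ {A | ∃ σ τ, A = R.N σ τ}) ≤
      ((bilinearSpan L).map F.ent.toLinearMap).comap
        (scal (Module.End ℂ (PhononFock L)) (Cfg := Cfg)).toLinearMap := by
    refine Submodule.span_le.mpr ?_
    rintro A (rfl | ⟨σ, τ, rfl⟩)
    · exact ⟨1, Submodule.subset_span (Or.inl rfl), 
        (map_one F.ent).trans (map_one (scal (Module.End ℂ (PhononFock L)) (Cfg := Cfg))).symm⟩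
    · exact ⟨_, Submodule.subset_span (Or.inr ⟨σ, τ, rfl⟩), F.ent_spinBilinear σ τ⟩
  exact this hY

lemma MatrixForm.exists_of_mem_bilinearSpan {A : Op L} (hA : A ∈ bilinearSpan L) :
    ∃ Y : Matrix Cfg Cfg ℂ, (∀ i, Commute (R.E i i) Y) ∧ F.ent A = scal _ Y := by
  induction hA using Submodule.span_induction with
  | mem x hx =>
    rcases hx with rfl | ⟨σ, τ, rfl⟩
    · exact ⟨1, fun i => Commute.one_right _, (map_one F.ent).trans (map_one _).symm⟩
    · exact ⟨R.N σ τ, fun i => (commute_iff_lie_eq.mpr (R.lie_N_E σ τ i i)).symm,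
        F.ent_spinBilinear σ τ⟩
  | zero => exact ⟨0, fun i => Commute.zero_right _, (map_zero F.ent).trans (map_zero _).symm⟩
  | add x y _ _ hx hy =>
    obtain ⟨Y, hY, h⟩ := hx
    obtain ⟨Z, hZ, h'⟩ := hy
    exact ⟨Y + Z, fun i => (hY i).add_right (hZ i), by rw [map_add, map_add, h, h']⟩
  | smul r x _ hx =>
    obtain ⟨Y, hY, h⟩ := hx
    exact ⟨r • Y, fun i => (hY i).smul_right r, by rw [map_smul, map_smul, h]⟩

variable (L) in
lemma exists_matrixForm : ∃ R : FermionRep (Site L × Spin) (Finset (Site L × Spin)),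
    Nonempty (MatrixForm R) := by
  obtain ⟨R, ent, h, h1, h2, h3, h4⟩ := exists_matrix_form L
  exact ⟨R, ⟨⟨ent, h, h1, h2, h3, h4⟩⟩⟩

end Fock

/-! ### Spaces of local operators -/

section Support

variable {L : ℕ}

lemma window_mono (i : Site L) {k l : ℕ} (h : k ≤ l) : window i k ⊆ window i l := by
  rintro j ⟨m, hm, rfl⟩
  exact ⟨m, hm.trans_le h, rfl⟩

lemma localAlgebra_mono {S T : Set (Site L)} (h : S ⊆ T) : localAlgebra S ≤ localAlgebra T :=
  Algebra.adjoin_mono fun _ ⟨i, hi, hA⟩ => ⟨i, h hi, hA⟩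

lemma supportSums_mono {k l : ℕ} (h : k ≤ l) : supportSums L k ≤ supportSums L l :=
  Submodule.span_mono fun _ ⟨i, hi⟩ => ⟨i, localAlgebra_mono (window_mono i h) hi⟩

lemma supportSums_zero : supportSums L 0 = Submodule.span ℂ {(1 : Op L)} := by
  have hw : ∀ i : Site L, window i 0 = ∅ := fun i =>
    Set.eq_empty_of_forall_notMem fun j ⟨m, hm, _⟩ => absurd hm (Nat.not_lt_zero m)
  refine le_antisymm (Submodule.span_le.mpr ?_) (Submodule.span_le.mpr ?_)
  · rintro A ⟨i, hi⟩
    rw [hw, localAlgebra] at hi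
    simp only [Set.mem_empty_iff_false, false_and, exists_false, Set.ofPred_false] at hi
    rw [Algebra.adjoin_empty, Algebra.mem_bot] at hi
    obtain ⟨r, rfl⟩ := hi
    exact Submodule.mem_span_singleton.mpr ⟨r, (Algebra.algebraMap_eq_smul_one r).symm⟩
  · rintro _ rfl
    exact Submodule.subset_span ⟨0, one_mem _⟩

variable {S : Set (Site L)} {i : Site L}

lemma cDag_mem (hi : i ∈ S) (σ : Spin) : cDag i σ ∈ localAlgebra S :=
  Algebra.subset_adjoin ⟨i, hi, Or.inr (Or.inr ⟨σ, Or.inl rfl⟩)⟩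

lemma c_mem (hi : i ∈ S) (σ : Spin) : c i σ ∈ localAlgebra S :=
  Algebra.subset_adjoin ⟨i, hi, Or.inr (Or.inr ⟨σ, Or.inr rfl⟩)⟩

lemma bDag_mem (hi : i ∈ S) : bDag i ∈ localAlgebra S :=
  Algebra.subset_adjoin ⟨i, hi, Or.inl rfl⟩

lemma b_mem (hi : i ∈ S) : b i ∈ localAlgebra S :=
  Algebra.subset_adjoin ⟨i, hi, Or.inr (Or.inl rfl)⟩

lemma num_mem (hi : i ∈ S) (σ : Spin) : num i σ ∈ localAlgebra S :=
  mul_mem (cDag_mem hi σ) (c_mem hi σ)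

lemma mem_window_self (i : Site L) {k : ℕ} (hk : 0 < k) : i ∈ window i k :=
  ⟨0, hk, by rw [Nat.cast_zero, add_zero]⟩

lemma bilinearSpan_le [NeZero L] : bilinearSpan L ≤ supportSums L 1 := by
  refine Submodule.span_le.mpr ?_
  rintro A (rfl | ⟨σ, τ, rfl⟩)
  · exact Submodule.subset_span ⟨0, one_mem _⟩
  · refine Submodule.sum_mem _ fun i _ => Submodule.subset_span ⟨i, ?_⟩
    exact mul_mem (cDag_mem (mem_window_self i one_pos) σ) (c_mem (mem_window_self i one_pos) τ)

lemma hamiltonian_mem [NeZero L] (t g ω U : ℝ) : hamiltonian L t g ω U ∈ supportSums L 2 := by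
  have h0 := fun i : Site L => mem_window_self i two_pos
  have h1 : ∀ i : Site L, i + 1 ∈ window i 2 := fun i => ⟨1, one_lt_two, by rw [Nat.cast_one]⟩
  have hs : ∀ {A : Op L} (i : Site L), A ∈ localAlgebra (window i 2) → A ∈ supportSums L 2 :=
    fun i hA => Submodule.subset_span ⟨i, hA⟩
  refine Submodule.add_mem _ (Submodule.add_mem _ (Submodule.add_mem _ ?_ ?_) ?_) ?_ <;>
    refine Submodule.smul_mem _ _ (Submodule.sum_mem _ fun i _ => hs i ?_)
  · exact sum_mem fun σ _ => add_mem (mul_mem (cDag_mem (h0 i) σ) (c_mem (h1 i) σ))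
      (mul_mem (cDag_mem (h1 i) σ) (c_mem (h0 i) σ))
  · exact sum_mem fun σ _ => mul_mem (num_mem (h0 i) σ) (add_mem (bDag_mem (h0 i)) (b_mem (h0 i)))
  · exact mul_mem (bDag_mem (h0 i)) (b_mem (h0 i))
  · exact sum_mem fun σ _ => sum_mem fun τ _ => mul_mem (num_mem (h0 i) σ) (num_mem (h0 i) τ)

end Support

/-! ### Classification of the local conserved quantities on Fock space. -/

section Main

variable {L : ℕ} [NeZero L] {t g ω U : ℝ}

lemma bilinearSpan_le_trivialSpan : bilinearSpan L ≤ trivialSpan L t g ω U :=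
  Submodule.span_mono (Set.union_subset_union_left _ (by simp))

lemma trivialSpan_le : trivialSpan L t g ω U ≤ supportSums L 2 := by
  refine Submodule.span_le.mpr ?_
  rintro A ((rfl | rfl) | h)
  · exact Submodule.subset_span ⟨0, one_mem _⟩
  · exact hamiltonian_mem t g ω U
  · exact supportSums_mono one_le_two (bilinearSpan_le (Submodule.subset_span (Or.inr h)))

lemma exists_of_mem_trivialSpan {Q : Op L} (hQ : Q ∈ trivialSpan L t g ω U) :
    ∃ y : ℂ, ∃ A ∈ bilinearSpan L, Q = y • hamiltonian L t g ω U + A := by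
  have : trivialSpan L t g ω U ≤ Submodule.span ℂ {hamiltonian L t g ω U} ⊔ bilinearSpan L := by
    refine Submodule.span_le.mpr ?_
    rintro A ((rfl | rfl) | h)
    · exact Submodule.mem_sup_right (Submodule.subset_span (Or.inl rfl))
    · exact Submodule.mem_sup_left (Submodule.subset_span rfl)
    · exact Submodule.mem_sup_right (Submodule.subset_span (Or.inr h))
  obtain ⟨B, hB, A, hA, h⟩ := Submodule.mem_sup.mp (this hQ)
  obtain ⟨y, rfl⟩ := Submodule.mem_span_singleton.mp hB
  exact ⟨y, A, hA, h.symm⟩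

lemma mem_trivialSpan_of_commute (ht : t ≠ 0) (hg : g ≠ 0) (hω : ω ≠ 0) {k : ℕ} (hk1 : 1 ≤ k)
    (hk : 2 * k ≤ L) {Q : Op L} (hQ : Q ∈ supportSums L k)
    (hc : Commute Q (hamiltonian L t g ω U)) : Q ∈ trivialSpan L t g ω U := by
  obtain ⟨R, ⟨F⟩⟩ := exists_matrixForm L
  have hc' := hc.map F.ent
  rw [F.ent_hamiltonian] at hc'
  obtain ⟨y, Y, hY, h⟩ := exists_of_commute (Complex.ofReal_ne_zero.mpr ht)
    (Complex.ofReal_ne_zero.mpr hg) (Complex.ofReal_ne_zero.mpr hω) hk1 hk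
    (fun hk2 => by
      rw [← F.ent_hamiltonian]
      exact F.ent_mem_opSums (supportSums_mono hk2 (hamiltonian_mem t g ω U)))
    (F.ent_mem_opSums hQ) hc'
  obtain ⟨A, hA, hAY⟩ := F.exists_of_mem_span hY
  have hQA : Q = y • hamiltonian L t g ω U + A := by
    refine F.injective (h.trans ?_)
    rw [map_add, map_smul, F.ent_hamiltonian, hAY]
  rw [hQA]
  exact Submodule.add_mem _ (Submodule.smul_mem _ _
    (Submodule.subset_span (Or.inl (Or.inr rfl)))) (bilinearSpan_le_trivialSpan hA)

lemma commute_of_mem_trivialSpan {Q : Op L} (hQ : Q ∈ trivialSpan L t g ω U) :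
    Commute Q (hamiltonian L t g ω U) := by
  obtain ⟨R, ⟨F⟩⟩ := exists_matrixForm L
  induction hQ using Submodule.span_induction with
  | mem x hx =>
    rcases hx with (rfl | rfl) | ⟨σ, τ, rfl⟩
    · exact Commute.one_left _
    · exact Commute.refl _
    · refine F.injective ?_
      rw [map_mul, map_mul, F.ent_hamiltonian, F.ent_spinBilinear]
      exact commute_N_ham _ _ _ _ _ _ _ _
  | zero => exact Commute.zero_left _
  | add x y _ _ hx hy => exact hx.add_left hy
  | smul r x _ hx => exact hx.smul_left r

lemma mem_bilinearSpan_of_mem_supportSums_one (hL : 1 < L) (ht : t ≠ 0) {Q : Op L}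
    (hQ : Q ∈ trivialSpan L t g ω U) (h1 : Q ∈ supportSums L 1) : Q ∈ bilinearSpan L := by
  obtain ⟨R, ⟨F⟩⟩ := exists_matrixForm L
  obtain ⟨y, A, hA, rfl⟩ := exists_of_mem_trivialSpan hQ
  obtain ⟨Y, hY, h⟩ := F.exists_of_mem_bilinearSpan hA
  have h2 := F.ent_mem_opSums h1
  rw [map_add, map_smul, F.ent_hamiltonian, h] at h2
  have h3 := eq_zero_of_mem_opSums_one hL (Complex.ofReal_ne_zero.mpr ht) hY h2
  rw [h3, zero_smul, zero_add]
  exact hA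

end Main

end HolsteinHubbard

end

theorem mainTheorem3 (L : ℕ) [NeZero L] (t g ω U : ℝ) (ht : t ≠ 0) (hg : g ≠ 0) (hω : ω ≠ 0) :
    -- every `k`-local conserved quantity with `1 ≤ k ≤ L / 2` is a linear combination of
    -- the identity, the Hamiltonian and the spin bilinears
    (∀ k : ℕ, 1 ≤ k → 2 * k ≤ L → ∀ Q : HolsteinHubbard.Op L,
      HolsteinHubbard.IsLocalConserved (HolsteinHubbard.hamiltonian L t g ω U) k Q →
        Q ∈ HolsteinHubbard.trivialSpan L t g ω U) ∧
    -- conversely, all these linear combinations are conserved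
    (∀ Q ∈ HolsteinHubbard.trivialSpan L t g ω U,
      Commute Q (HolsteinHubbard.hamiltonian L t g ω U)) ∧
    -- sorted by `k`: the bilinears for `k = 1`, the Hamiltonian for `k = 2`, none for `k ≥ 3`
    (∀ k : ℕ, 1 ≤ k → 2 * k ≤ L → ∀ Q : HolsteinHubbard.Op L,
      HolsteinHubbard.IsLocalConserved (HolsteinHubbard.hamiltonian L t g ω U) k Q ↔
        (k = 1 ∧ Q ∈ HolsteinHubbard.bilinearSpan L ∧
          Q ∉ Submodule.span ℂ {(1 : HolsteinHubbard.Op L)}) ∨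
        (k = 2 ∧ Q ∈ HolsteinHubbard.trivialSpan L t g ω U ∧
          Q ∉ HolsteinHubbard.bilinearSpan L)) := by
  have h1 : ∀ k : ℕ, 1 ≤ k → 2 * k ≤ L → ∀ Q : HolsteinHubbard.Op L,
      HolsteinHubbard.IsLocalConserved (HolsteinHubbard.hamiltonian L t g ω U) k Q →
        Q ∈ HolsteinHubbard.trivialSpan L t g ω U := fun k hk1 hk Q hQ =>
    HolsteinHubbard.mem_trivialSpan_of_commute ht hg hω hk1 hk hQ.1.2.1 hQ.2
  refine ⟨h1, fun Q => HolsteinHubbard.commute_of_mem_trivialSpan, fun k hk1 hk Q => ⟨fun hQ => ?_, ?_⟩⟩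
  · have hQt := h1 k hk1 hk Q hQ
    obtain ⟨⟨-, hk', hk''⟩, -⟩ := hQ
    -- For `k ≥ 3` all the candidates are already sums of `2`-support operators, hence of `(k -
    -- 1)`-support ones, which contradicts `k`-locality.
    rcases (show k = 1 ∨ k = 2 ∨ 2 ≤ k - 1 by omega) with rfl | rfl | h3
    · refine Or.inl ⟨rfl, HolsteinHubbard.mem_bilinearSpan_of_mem_supportSums_one (by omega) ht hQt
        hk', ?_⟩
      rwa [← HolsteinHubbard.supportSums_zero]
    · exact Or.inr ⟨rfl, hQt, fun h => hk'' (HolsteinHubbard.bilinearSpan_le h)⟩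
    · exact absurd (HolsteinHubbard.supportSums_mono h3 (HolsteinHubbard.trivialSpan_le hQt)) hk''
  · rintro (⟨rfl, hQ, hQ'⟩ | ⟨rfl, hQ, hQ'⟩)
    · refine ⟨⟨le_rfl, HolsteinHubbard.bilinearSpan_le hQ, ?_⟩,
        HolsteinHubbard.commute_of_mem_trivialSpan
          (HolsteinHubbard.bilinearSpan_le_trivialSpan hQ)⟩
      rwa [Nat.sub_self, HolsteinHubbard.supportSums_zero]
    · exact ⟨⟨hk1, HolsteinHubbard.trivialSpan_le hQ, fun h => hQ'
        (HolsteinHubbard.mem_bilinearSpan_of_mem_supportSums_one (by omega) ht hQ h)⟩,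
        HolsteinHubbard.commute_of_mem_trivialSpan hQ⟩
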